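/- **Setting.** For a unit sphere $S$ in a Euclidean space let $d\alpha$ be the rotation invariant measure on $S$ of total mass $2\pi$. The squared projection covariance of random vectors $x,y$ is $$\mathrm{Pcov}(x,y)^2=\iiint\big(F_{U,V}(u,v)-F_U(u)F_V(v)\big)^2\,dF_{U,V}(u,v)\,d\alpha\,d\beta,\qquad U=\alpha^{\top}x,\ V=\beta^{\top}y, \tag{1}$$ and, in its explicit form, with $(x_1,y_1),\dots,(x_5,y_5)$ independent copies of $(x,y)$, $\angle(u,v)=\arccos\{u^{\top}v/(\|u\|\|v\|)\}$ and $0/0=0$, $$\mathrm{Pcov}(x,y)^2=E[\angle(x_1-x_3,x_4-x_3)\angle(y_1-y_3,y_4-y_3)]+E[\angle(x_1-x_3,x_4-x_3)\angle(y_2-y_3,y_5-y_3)]-2E[\angle(x_1-x_3,x_4-x_3)\angle(y_2-y_3,y_4-y_3)]. \tag{2}$$ The two forms agree when the laws of $x$ and $y$ have no atoms. Put $\mathrm{PC}(x,y)^2=\mathrm{Pcov}(x,y)^2/\{\mathrm{Pcov}(x,x)\mathrm{Pcov}(y,y)\}$ with $0/0=0$. For samples $\mathbf X=(x_1,\dots,x_n)$,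 $\mathbf Y=(y_1,\dots,y_n)$ let $a_{klr}=\angle(x_k-x_r,x_l-x_r)$, with $a_{klr}=0$ if $k=r$ or $l=r$, let $A_{klr}=a_{klr}-n^{-1}\sum_{l'}a_{kl'r}-n^{-1}\sum_{k'}a_{k'lr}+n^{-2}\sum_{k',l'}a_{k'l'r}$, define $B_{klr}$ in the same way from $\mathbf Y$, and put $\widehat{\mathrm{Pcov}}(\mathbf X,\mathbf Y)^2=n^{-3}\sum_{k,l,r}A_{klr}B_{klr}$ and $\widehat{\mathrm{PC}}(\mathbf X,\mathbf Y)^2=\widehat{\mathrm{Pcov}}(\mathbf X,\mathbf Y)^2/\{\widehat{\mathrm{Pcov}}(\mathbf X,\mathbf X)\widehat{\mathrm{Pcov}}(\mathbf Y,\mathbf Y)\}$. Let $x=(X_1,\dots,X_p)$ be random features and $y\in\mathbb R^q$ a random response. Feature $k$ is inactive if some version of the conditional distribution of $y$ given $x$ does not functionally depend on the $k$-th coordinate of $x$, and active otherwise; $\mathcal A$ is the set of active features and $s=|\mathcal A|$. A random vector $\tilde x=(\tilde X_1,\dots,\tilde X_p)$ is an exact knockoff copy of $x$ if, for every $j$,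 exchanging $X_j$ and $\tilde X_j$ leaves the joint law of $(x,\tilde x)$ unchanged, and $\tilde x$ is conditionally independent of $y$ given $x$. Put $$W_j=\mathrm{PC}(X_j,y)^2-\mathrm{PC}(\tilde X_j,y)^2,\qquad \widehat W_j=\widehat{\mathrm{PC}}(\mathbf X_j,\mathbf Y)^2-\widehat{\mathrm{PC}}(\tilde{\mathbf X}_j,\mathbf Y)^2,$$ where $\widehat W_j$ is computed from $n$ i.i.d. copies of $(x,\tilde x,y)$, and $\widehat{\mathcal A}_W(\delta)=\{j:\widehat W_j\ge\delta\}$. **Theorem.** Let $q\ge 0$ be an integer and let $\sigma_0>0$, $c_3>0$ and $0<\kappa<1/2$. Use form (2) of $\mathrm{Pcov}^2$, or use form (1) and assume that the laws of $X_1,\dots,X_p$ and of $y$ have no atoms. There are constants $C,c_4>0$, depending only on $q,\sigma_0,c_3,\kappa$ and the choice of form, such that the following holds for all $n\ge1$, all $p$ and all laws of $(x,\tilde x,y)$. Suppose that $\tilde x$ is an exact knockoff copy of $x$, that $\mathrm{Pcov}(X_k,X_k)^2\ge\sigma_0^2$ for all $k\le p$ and $\mathrm{Pcov}(Y_k,Y_k)^2\ge\sigma_0^2$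 for all $k\le q$, where $Y_k$ are the coordinates of $y$, and that $W_k\ge 2c_3n^{-\kappa}$ for all $k\in\mathcal A$. Then (i) $\Pr\{\mathcal A\subseteq\widehat{\mathcal A}_W(\delta)\}\ge 1-C\,s\exp(-c_4n^{1-2\kappa})$ for every $\delta\le c_3n^{-\kappa}$; (ii) $\Pr\{\widehat W_k>\widehat W_j\text{ for all }k\in\mathcal A,\ j\notin\mathcal A\}\ge 1-C\,p\exp(-c_4n^{1-2\kappa})$, that is, $\min_{k\in\mathcal A}\widehat W_k-\max_{j\notin\mathcal A}\widehat W_j>0$ with at least this probability. No signal-strength condition is imposed on the inactive features. -/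

import Mathlib

open MeasureTheory ProbabilityTheory

noncomputable section

namespace ProjCorr

section General

variable {E F : Type*}
  [NormedAddCommGroup E] [InnerProductSpace ℝ E] [FiniteDimensional ℝ E]
  [MeasurableSpace E] [BorelSpace E]
  [NormedAddCommGroup F] [InnerProductSpace ℝ F] [FiniteDimensional ℝ F]
  [MeasurableSpace F] [BorelSpace F]

/-- The rotation invariant measure `dα` on the unit sphere of `E`, normalized to total mass `2π`.
The projection correlation does not depend on the normalization; with this one the integral form
and the arccosine form of the squared projection covariance agree for atomless marginals. -/
def dirMeasure (E : Type*) [NormedAddCommGroup E] [InnerProductSpace ℝ E] [FiniteDimensional ℝ E]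
    [MeasurableSpace E] [BorelSpace E] : Measure (Metric.sphere (0 : E) 1) :=
  (ENNReal.ofReal (2 * Real.pi) / (volume : Measure E).toSphere Set.univ) •
    (volume : Measure E).toSphere

/-- `∬ (F_{U,V}(u,v) - F_U(u) F_V(v))² dF_{U,V}(u,v)` for a joint law `ρ` of `(U,V)` on `ℝ²`. -/
def cdfGap (ρ : Measure (ℝ × ℝ)) : ℝ :=
  ∫ t, (ρ.real {w | w.1 ≤ t.1 ∧ w.2 ≤ t.2}
      - ρ.real {w | w.1 ≤ t.1} * ρ.real {w | w.2 ≤ t.2}) ^ 2 ∂ρ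

/-- Integral form of the squared projection covariance of a pair `(x, y)` with joint law `ν`:
the quantity `cdfGap` of `(αᵀx, βᵀy)`, integrated over all unit vectors `α` and `β`. -/
def pcovSqIntegral (ν : Measure (E × F)) : ℝ :=
  ∫ α : Metric.sphere (0 : E) 1, ∫ β : Metric.sphere (0 : F) 1,
    cdfGap (ν.map fun w => (inner ℝ (α : E) w.1, inner ℝ (β : F) w.2))
      ∂(dirMeasure F) ∂(dirMeasure E)

/-- Arccosine form `S₁ + S₂ - 2 S₃` of the squared projection covariance, an expectation over five
independent copies of `(x, y)`. Mathlib's `angle u v` is `arccos (uᵀv / (‖u‖ ‖v‖))`, with the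
convention `0 / 0 = 0` inside the arccosine. -/
def pcovSqArccos (ν : Measure (E × F)) : ℝ :=
  (∫ z, InnerProductGeometry.angle ((z 0).1 - (z 2).1) ((z 3).1 - (z 2).1)
      * InnerProductGeometry.angle ((z 0).2 - (z 2).2) ((z 3).2 - (z 2).2)
      ∂(Measure.pi fun _ : Fin 5 => ν))
  + (∫ z, InnerProductGeometry.angle ((z 0).1 - (z 2).1) ((z 3).1 - (z 2).1)
      * InnerProductGeometry.angle ((z 1).2 - (z 2).2) ((z 4).2 - (z 2).2)
      ∂(Measure.pi fun _ : Fin 5 => ν))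
  - 2 * (∫ z, InnerProductGeometry.angle ((z 0).1 - (z 2).1) ((z 3).1 - (z 2).1)
      * InnerProductGeometry.angle ((z 1).2 - (z 2).2) ((z 3).2 - (z 2).2)
      ∂(Measure.pi fun _ : Fin 5 => ν))

/-- The two forms of the squared projection covariance. -/
inductive PcovForm
  | integral
  | arccos

/-- Squared projection covariance `Pcov(x, y)²` of a pair with joint law `ν`. -/
def pcovSq (form : PcovForm) (ν : Measure (E × F)) : ℝ :=
  match form with
  | .integral => pcovSqIntegral ν
  | .arccos => pcovSqArccos ν

/-- Squared projection variance `Pcov(x, x)²` of a random vector with law `ρ`. -/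
def pvarSq (form : PcovForm) (ρ : Measure E) : ℝ :=
  pcovSq form (ρ.map fun x => (x, x))

/-- Squared projection correlation `PC(x, y)² = Pcov(x, y)² / (Pcov(x, x) Pcov(y, y))`, where
`Pcov` is the square root of `Pcov²`, with the convention `0 / 0 = 0`. -/
def pcSq (form : PcovForm) (ν : Measure (E × F)) : ℝ :=
  pcovSq form ν / (√(pvarSq form (ν.map Prod.fst)) * √(pvarSq form (ν.map Prod.snd)))

variable {n : ℕ}

/-- `a_{klr}`: the angle at the sample point `r` between the sample points `k` and `l`. -/
def ang (x : Fin n → E) (k l r : Fin n) : ℝ :=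
  if k = r ∨ l = r then 0 else InnerProductGeometry.angle (x k - x r) (x l - x r)

/-- `A_{klr}`: the doubly centred version of `a_{klr}`. -/
def angC (x : Fin n → E) (k l r : Fin n) : ℝ :=
  ang x k l r
    - (n : ℝ)⁻¹ * ∑ l', ang x k l' r
    - (n : ℝ)⁻¹ * ∑ k', ang x k' l r
    + ((n : ℝ) ^ 2)⁻¹ * ∑ k', ∑ l', ang x k' l' r

/-- Squared sample projection covariance `n⁻³ ∑ A_{klr} B_{klr}`. -/
def samplePcovSq (x : Fin n → E) (y : Fin n → F) : ℝ :=
  ((n : ℝ) ^ 3)⁻¹ * ∑ k, ∑ l, ∑ r, angC x k l r * angC y k l r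

/-- Squared sample projection correlation. -/
def samplePcSq (x : Fin n → E) (y : Fin n → F) : ℝ :=
  samplePcovSq x y / (√(samplePcovSq x x) * √(samplePcovSq y y))

end General

/-- A triple `(x, x̃, y)`: `p` features, their `p` knockoffs, and a response in `ℝ^q`. -/
abbrev Obs (p q : ℕ) : Type := (Fin p → ℝ) × (Fin p → ℝ) × EuclideanSpace ℝ (Fin q)

variable {p q n : ℕ}

/-- Exchange the `j`th feature with its knockoff. -/
def swapAt (j : Fin p) (u : (Fin p → ℝ) × (Fin p → ℝ)) : (Fin p → ℝ) × (Fin p → ℝ) :=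
  (Function.update u.1 j (u.2 j), Function.update u.2 j (u.1 j))

/-- `x̃` is an exact knockoff copy of `x`: pairwise exchangeability of `(x, x̃)`, and conditional
independence of `x̃` and `y` given `x`. Here `μ` is the law of `(x, x̃, y)`. -/
structure IsExactKnockoff (μ : Measure (Obs p q)) [IsFiniteMeasure μ] : Prop where
  exchangeable : ∀ j : Fin p,
    (μ.map fun w => (w.1, w.2.1)).map (swapAt j) = μ.map fun w => (w.1, w.2.1)
  condIndep : CondIndepFun (MeasurableSpace.comap (fun w : Obs p q => w.1) inferInstance)
    measurable_fst.comap_le (fun w : Obs p q => w.2.1) (fun w : Obs p q => w.2.2) μ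

/-- The `k`th feature is inactive: some version `κ` of the conditional distribution of `y`
given `x` does not functionally depend on the `k`th coordinate of `x`. -/
def IsInactive (μ : Measure (Obs p q)) (k : Fin p) : Prop :=
  ∃ κ : Kernel (Fin p → ℝ) (EuclideanSpace ℝ (Fin q)), IsMarkovKernel κ ∧
    (∀ (x : Fin p → ℝ) (t : ℝ), κ (Function.update x k t) = κ x) ∧
    (μ.map fun w => (w.1, w.2.2)) = (μ.map fun w => w.1).compProd κ

open Classical in
/-- The index set of active features. -/
def activeSet (μ : Measure (Obs p q)) : Finset (Fin p) :=
  Finset.univ.filter fun k => ¬ IsInactive μ k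

/-- Law of the `k`th feature. -/
def featureLaw (μ : Measure (Obs p q)) (k : Fin p) : Measure ℝ := μ.map fun w => w.1 k

/-- Law of the response vector. -/
def responseLaw (μ : Measure (Obs p q)) : Measure (EuclideanSpace ℝ (Fin q)) :=
  μ.map fun w => w.2.2

/-- Non-degeneracy: every feature and every coordinate of the response has squared projection
variance at least `σ₀²`. -/
def Nondegenerate (form : PcovForm) (μ : Measure (Obs p q)) (σ₀ : ℝ) : Prop :=
  (∀ k : Fin p, σ₀ ^ 2 ≤ pvarSq form (featureLaw μ k)) ∧
  (∀ k : Fin q, σ₀ ^ 2 ≤ pvarSq form ((responseLaw μ).map fun y => y k))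

/-- `W_j = PC(X_j, y)² - PC(X̃_j, y)²`. -/
def W (form : PcovForm) (μ : Measure (Obs p q)) (j : Fin p) : ℝ :=
  pcSq form (μ.map fun w => (w.1 j, w.2.2)) - pcSq form (μ.map fun w => (w.2.1 j, w.2.2))

/-- `Ŵ_j`: squared sample projection correlation of the `j`th feature with the response, minus
that of its knockoff, for the sample `z`. -/
def sampleW (z : Fin n → Obs p q) (j : Fin p) : ℝ :=
  samplePcSq (fun i => (z i).1 j) (fun i => (z i).2.2)
    - samplePcSq (fun i => (z i).2.1 j) (fun i => (z i).2.2)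

open Classical in
/-- The screened set `{j : Ŵ_j ≥ δ}`. -/
def screenedSet (z : Fin n → Obs p q) (δ : ℝ) : Finset (Fin p) :=
  Finset.univ.filter fun j => δ ≤ sampleW z j

end ProjCorr

end

open ProjCorr

/-! The knockoff statistic of an inactive feature has population value exactly zero. Given `(x, x̃)`
the response is drawn from a kernel that ignores `x̃` and the `j`th coordinate of `x`, so exchanging
the `j`th feature with its knockoff preserves the joint law with the response
(`map_swapAt_of_isInactive`). Active features have `W ≥ 2 c₃ n^(-κ)`. If every `Ŵ_j` is within `c₃
n^(-κ)` of `W_j`, the level `c₃ n^(-κ)` separates active from inactive features; both claims follow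
by a union bound, over the active features for (i) and over all features for (ii).

Concentration: the squared sample covariance is a V-statistic of order five with bounded kernel. One
observation changes it by `O(1/n)` and its bias is `O(1/n)`, so McDiarmid's inequality gives
`measure_samplePcovSq_sub_ge_le`. The squared correlation is a Lipschitz function of three such
quantities as long as the projection variances stay away from zero (`abs_ratio_sub_le`).

For features that lower bound is assumed, and knockoffs share the marginal laws. For the response
vector it is assumed only coordinatewise. The link is the probability `δ` that two independent
copies differ: in dimension `d` the projection variance is at most `π²/4 · δ` and at least `π²/(144
d⁶) · δ²` (`pcovSqArccos_diag_le`, `pcovSqArccos_diag_ge`), and `δ` can only shrink when passing to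
a coordinate. The lower bound writes `π/2 - ∠(u,v)` as an average of `sign⟪α,u⟫ sign⟪α,v⟫` over
directions `α`, tests the centred kernel against a coordinate of the direction seen from the vertex,
and uses that some angle of a triangle is at least `π/3`.

The integral form reduces to the arccosine form because the directions separating `u` from `v` have
measure `2∠(u,v)` (`sepMeasure_eq_angle`); without atoms the degenerate configurations are null. -/

noncomputable section

namespace ProjCorr

/-! ### McDiarmid's bounded differences inequality. -/

section BoundedDifferences

variable {S : Type*} [MeasurableSpace S]

lemma measurable_insertNth {n : ℕ} (i : Fin (n + 1)) :
    Measurable fun w : S × (Fin n → S) => (i.insertNth w.1 w.2 : Fin (n + 1) → S) :=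
  (MeasurableEquiv.piFinSuccAbove (fun _ : Fin (n + 1) => S) i).symm.measurable

lemma integral_pi_insertNth {n : ℕ} (ν : Measure S) [IsProbabilityMeasure ν] (i : Fin (n + 1))
    {f : (Fin (n + 1) → S) → ℝ} (hf : Measurable f) {M : ℝ} (hM : ∀ z, |f z| ≤ M) :
    ∫ z, f z ∂(Measure.pi fun _ => ν)
      = ∫ s, ∫ zs, f (i.insertNth s zs) ∂(Measure.pi fun _ : Fin n => ν) ∂ν := by
  have h := (measurePreserving_piFinSuccAbove (fun _ : Fin (n + 1) => ν) i).symm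
  rw [← h.integral_comp (MeasurableEquiv.measurableEmbedding _) f]
  rw [integral_prod]
  · rfl
  · exact Integrable.of_bound ((hf.comp (measurable_insertNth i)).aestronglyMeasurable) M
      (Filter.Eventually.of_forall fun w => hM _)

lemma abs_integral_le_of_abs_le {α : Type*} [MeasurableSpace α] {ν : Measure α}
    [IsProbabilityMeasure ν] {f : α → ℝ} {M : ℝ} (h : ∀ a, |f a| ≤ M) : |∫ a, f a ∂ν| ≤ M := by
  have := norm_integral_le_of_norm_le_const (μ := ν) (f := f) (C := M)
    (Filter.Eventually.of_forall fun w => h w)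
  simpa using this

lemma exp_le_of_abs_le {a b t : ℝ} (h : |a| ≤ b) : Real.exp (t * a) ≤ Real.exp (|t| * b) := by
  apply Real.exp_le_exp.2
  calc t * a ≤ |t * a| := le_abs_self _
    _ = |t| * |a| := abs_mul _ _
    _ ≤ _ := by gcongr

/-- The moment generating function bound behind McDiarmid's inequality. -/
lemma integral_exp_bounded_differences (ν : Measure S) [IsProbabilityMeasure ν] {c : ℝ}
    (hc : 0 ≤ c) (t M : ℝ) :
    ∀ (n : ℕ) (f : (Fin n → S) → ℝ), Measurable f → (∀ z, |f z| ≤ M) →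
      (∀ z i s, |f (Function.update z i s) - f z| ≤ c) →
      ∫ z, Real.exp (t * (f z - ∫ z', f z' ∂(Measure.pi fun _ => ν))) ∂(Measure.pi fun _ => ν)
        ≤ Real.exp (n * c ^ 2 * t ^ 2 / 2) := by
  intro n
  induction n with
  | zero =>
    intro f _ _ _
    have : ∀ z, f z = f default := fun z => by rw [Subsingleton.elim z default]
    simp [this]
  | succ n ih =>
    intro f hf hM hd
    -- Split `f - E f` into `f - F` and `F - E F`. The induction hypothesis treats the first with
    -- the first coordinate frozen, Hoeffding's lemma treats the second.
    set F : S → ℝ := fun s => ∫ zs, f (Fin.insertNth 0 s zs) ∂(Measure.pi fun _ : Fin n => ν)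
      with hF
    have hfi : Measurable fun w : S × (Fin n → S) => f (Fin.insertNth 0 w.1 w.2) :=
      hf.comp (measurable_insertNth 0)
    have hFm : Measurable F := (hfi.stronglyMeasurable.integral_prod_right').measurable
    have hEF : ∫ z', f z' ∂(Measure.pi fun _ => ν) = ∫ s, F s ∂ν :=
      integral_pi_insertNth ν 0 hf hM
    have hfs : ∀ s, Measurable fun zs : Fin n → S => f (Fin.insertNth 0 s zs) := fun s =>
      hfi.comp measurable_prodMk_left
    have hint : ∀ s, Integrable (fun zs : Fin n → S => f (Fin.insertNth 0 s zs))
        (Measure.pi fun _ => ν) := fun s =>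
      Integrable.of_bound (hfs s).aestronglyMeasurable M (Filter.Eventually.of_forall fun w => hM _)
    have hFM : ∀ s, |F s| ≤ M := fun s => abs_integral_le_of_abs_le fun _ => hM _
    have hFd : ∀ s s', |F s - F s'| ≤ c := fun s s' => by
      simp only [hF]
      rw [← integral_sub (hint s) (hint s')]
      refine abs_integral_le_of_abs_le fun w => ?_
      have := hd (Fin.insertNth 0 s' w) 0 s
      rwa [show Function.update (Fin.insertNth 0 s' w : Fin (n + 1) → S) 0 s
        = Fin.insertNth 0 s w by simp [Fin.insertNth_zero', Fin.update_cons_zero]] at this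
    have hFi : Integrable F ν :=
      Integrable.of_bound hFm.aestronglyMeasurable M (Filter.Eventually.of_forall fun w => hFM _)
    have hcen : ∀ s, F s - ∫ s', F s' ∂ν ∈ Set.Icc (-c) c := fun s => by
      have h1 : F s - ∫ s', F s' ∂ν = ∫ s', (F s - F s') ∂ν := by
        rw [integral_sub (integrable_const _) hFi]; simp
      rw [h1]
      exact abs_le.1 (abs_integral_le_of_abs_le fun s' => hFd s s')
    have hsub := hasSubgaussianMGF_of_mem_Icc_of_integral_eq_zero (μ := ν)
      (X := fun s => F s - ∫ s', F s' ∂ν) (a := -c) (b := c)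
      (hFm.sub_const _).aemeasurable (Filter.Eventually.of_forall hcen) (by
        rw [integral_sub hFi (integrable_const _)]; simp)
    have hsub' := hsub.mgf_le t
    -- The centred `F` is only placed in `[-c, c]`, an interval of length `2c`, so its variance
    -- proxy is `c²`; this is where the optimal constant is lost.
    have hcc : (((‖c - -c‖₊ / 2) ^ 2 : NNReal) : ℝ) = c ^ 2 := by
      push_cast
      rw [show c - -c = 2 * c by ring, Real.norm_of_nonneg (by positivity)]; ring
    rw [hcc, mgf] at hsub'
    rw [hEF, integral_pi_insertNth ν 0 (M := Real.exp (|t| * (M + M)))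
      (by fun_prop) (by
        intro z
        rw [abs_of_pos (Real.exp_pos _)]
        apply exp_le_of_abs_le
        exact (abs_sub _ _).trans (add_le_add (hM z) (abs_integral_le_of_abs_le hFM)))]
    calc _ = ∫ s, (∫ zs, Real.exp (t * (f (Fin.insertNth 0 s zs) - F s))
              ∂(Measure.pi fun _ : Fin n => ν)) * Real.exp (t * (F s - ∫ s', F s' ∂ν)) ∂ν := by
          congr 1; ext s
          rw [← integral_mul_const]
          congr 1; ext zs
          rw [← Real.exp_add]; congr 1; ring
      _ ≤ ∫ s, Real.exp (n * c ^ 2 * t ^ 2 / 2) * Real.exp (t * (F s - ∫ s', F s' ∂ν)) ∂ν := by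
          apply integral_mono_of_nonneg
          · exact Filter.Eventually.of_forall fun s =>
              mul_nonneg (integral_nonneg fun _ => (Real.exp_pos _).le) (Real.exp_pos _).le
          · exact (hsub.integrable_exp_mul t).const_mul _
          · refine Filter.Eventually.of_forall fun s => ?_
            refine mul_le_mul_of_nonneg_right ?_ (Real.exp_pos _).le
            apply ih (fun zs => f (Fin.insertNth 0 s zs)) (hfs s) (fun _ => hM _)
            intro z i s'
            have := hd (Fin.insertNth 0 s z) i.succ s'
            rwa [show Function.update (Fin.insertNth 0 s z : Fin (n+1) → S) i.succ s'
              = Fin.insertNth 0 s (Function.update z i s') by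
                simp [Fin.insertNth_zero']] at this
      _ ≤ _ := by
          rw [integral_const_mul]
          refine (mul_le_mul_of_nonneg_left hsub' (Real.exp_pos _).le).trans ?_
          rw [← Real.exp_add]
          apply Real.exp_le_exp.2
          push_cast; apply le_of_eq; ring

/-- **McDiarmid's inequality**, with a non-optimal constant. -/
theorem measure_bounded_differences (ν : Measure S) [IsProbabilityMeasure ν] {c M : ℝ}
    (hc : 0 ≤ c) {n : ℕ} {f : (Fin n → S) → ℝ} (hf : Measurable f) (hM : ∀ z, |f z| ≤ M)
    (hd : ∀ z i s, |f (Function.update z i s) - f z| ≤ c) {ε : ℝ} (hε : 0 ≤ ε) :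
    (Measure.pi fun _ => ν).real {z | ε ≤ |f z - ∫ z', f z' ∂(Measure.pi fun _ => ν)|}
      ≤ 2 * Real.exp (-ε ^ 2 / (2 * (n * c ^ 2))) := by
  have key : HasSubgaussianMGF (fun z => f z - ∫ z', f z' ∂(Measure.pi fun _ => ν))
      ⟨n * c ^ 2, by positivity⟩ (Measure.pi fun _ => ν) := by
    constructor
    · intro t
      refine Integrable.of_bound (by fun_prop) (Real.exp (|t| * (M + M)))
        (Filter.Eventually.of_forall fun z => ?_)
      rw [Real.norm_eq_abs, abs_of_pos (Real.exp_pos _)]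
      apply exp_le_of_abs_le
      exact (abs_sub _ _).trans (add_le_add (hM z) (abs_integral_le_of_abs_le hM))
    · exact fun t => integral_exp_bounded_differences ν hc t M n f hf hM hd
  have h1 := key.measure_ge_le hε
  have h2 := key.neg.measure_ge_le hε
  have hsub : {z | ε ≤ |f z - ∫ z', f z' ∂(Measure.pi fun _ => ν)|}
      ⊆ {z | ε ≤ f z - ∫ z', f z' ∂(Measure.pi fun _ => ν)}
        ∪ {z | ε ≤ (-fun z => f z - ∫ z', f z' ∂(Measure.pi fun _ => ν)) z} := by
    intro z hz
    rcases le_abs.1 (show ε ≤ _ from hz) with h | h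
    · left; exact h
    · right; exact h
  refine (measureReal_mono hsub).trans ((measureReal_union_le _ _).trans ?_)
  refine (add_le_add h1 h2).trans (le_of_eq ?_)
  exact (two_mul _).symm

end BoundedDifferences

section

open scoped Pointwise

/-! ### Half-spaces, signs and planar reflections. -/

section Directions

variable {E : Type*} [NormedAddCommGroup E] [InnerProductSpace ℝ E]

/-- The indicator of the half-space `{α | ⟪α, u⟫ ≤ 0}`. -/
def halfInd (u α : E) : ℝ := if inner ℝ α u ≤ 0 then 1 else 0

lemma halfInd_nonneg (u α : E) : 0 ≤ halfInd u α := by unfold halfInd; split_ifs <;> norm_num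

lemma halfInd_le_one (u α : E) : halfInd u α ≤ 1 := by unfold halfInd; split_ifs <;> norm_num

lemma halfInd_eq (u α : E) : halfInd u α = 0 ∨ halfInd u α = 1 := by
  unfold halfInd; split_ifs <;> simp

lemma halfInd_smul {r : ℝ} (hr : 0 < r) (u α : E) : halfInd (r • u) α = halfInd u α := by
  simp only [halfInd, inner_smul_right, mul_nonpos_iff_pos_imp_nonpos, hr]
  congr 1
  simp only [eq_iff_iff]
  constructor
  · intro h; exact h.1 trivial
  · intro h; exact ⟨fun _ => h, fun _ => hr.le⟩

lemma halfInd_neg {u α : E} (h : inner ℝ α u ≠ 0) : halfInd (-u) α = 1 - halfInd u α := by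
  unfold halfInd
  rw [inner_neg_right]
  rcases lt_or_gt_of_ne h with h | h
  · rw [if_neg (by linarith), if_pos (by linarith)]; norm_num
  · rw [if_pos (by linarith), if_neg (by linarith)]; norm_num

lemma halfInd_isometry (L : E ≃ₗᵢ[ℝ] E) (u α : E) : halfInd (L u) (L α) = halfInd u α := by
  simp [halfInd]

/-- The sign of `⟪α, u⟫`. -/
def sgnInner (u α : E) : ℝ := Real.sign (inner ℝ α u)

lemma abs_sgnInner_le (u α : E) : |sgnInner u α| ≤ 1 := by
  unfold sgnInner
  rcases Real.sign_apply_eq (inner ℝ α u) with h | h | h <;> simp [h]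

lemma sgnInner_eq {u α : E} (h : inner ℝ α u ≠ 0) : sgnInner u α = 1 - 2 * halfInd u α := by
  unfold sgnInner halfInd
  rcases lt_or_gt_of_ne h with h | h
  · rw [Real.sign_of_neg h, if_pos h.le]; norm_num
  · rw [Real.sign_of_pos h, if_neg (by linarith)]; norm_num

lemma abs_inner_sphere_le (α : Metric.sphere (0 : E) 1) (u : E) : |inner ℝ (α : E) u| ≤ ‖u‖ := by
  have := abs_real_inner_le_norm (α : E) u
  simpa using this

/-- A bounded additive function on `[0, 2T)` that vanishes at `T` is zero. -/
lemma eq_zero_of_additive_of_bounded {T M : ℝ} {e : ℝ → ℝ}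
    (hadd : ∀ s t, 0 ≤ s → 0 ≤ t → s + t < 2 * T → e (s + t) = e s + e t)
    (hT : e T = 0) (hM : ∀ t, 0 ≤ t → t < 2 * T → |e t| ≤ M) :
    ∀ t, 0 ≤ t → t < 2 * T → e t = 0 := by
  -- Since `e T = 0`, adding `T` does not change `e`. So `2t` can be brought back into `[0, T)`, and
  -- `e (2t) = 2 e t` halves the bound at each round.
  have key : ∀ k : ℕ, ∀ t, 0 ≤ t → t < T → |e t| ≤ M / 2 ^ k := by
    intro k
    induction k with
    | zero => intro t h0 h1; simpa using hM t h0 (by linarith)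
    | succ k ih =>
      intro t h0 h1
      have h2 : e (t + t) = 2 * e t := by rw [hadd t t h0 h0 (by linarith)]; ring
      have h3 : |e (t + t)| ≤ M / 2 ^ k := by
        rcases lt_or_ge (t + t) T with h | h
        · exact ih _ (by linarith) h
        · have h4 := hadd T (t + t - T) (by linarith) (by linarith) (by linarith)
          rw [hT, zero_add, add_sub_cancel] at h4
          rw [h4]
          exact ih _ (by linarith) (by linarith)
      rw [h2, abs_mul, abs_two] at h3
      rw [pow_succ, ← div_div, le_div_iff₀ two_pos]
      linarith
  have key' : ∀ t, 0 ≤ t → t < T → e t = 0 := by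
    intro t h0 h1
    have hlim : Filter.Tendsto (fun k : ℕ => M / 2 ^ k) Filter.atTop (nhds 0) := by
      have := (tendsto_pow_atTop_nhds_zero_of_lt_one (r := (1 / 2 : ℝ)) (by norm_num)
        (by norm_num)).const_mul M
      simpa [div_eq_mul_inv] using this
    exact abs_eq_zero.1 (le_antisymm (ge_of_tendsto' hlim fun k => key k t h0 h1) (abs_nonneg _))
  intro t h0 h1
  rcases lt_or_ge t T with h | h
  · exact key' t h0 h
  · have h4 := hadd T (t - T) (by linarith) (by linarith) (by linarith)
    rw [hT, zero_add, add_sub_cancel] at h4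
    rw [h4]
    exact key' _ (by linarith) (by linarith)

variable {e₁ e₂ : E}

lemma norm_cos_smul_add_sin_smul (h₁ : ‖e₁‖ = 1) (h₂ : ‖e₂‖ = 1) (h : inner ℝ e₁ e₂ = 0) (t : ℝ) :
    ‖Real.cos t • e₁ + Real.sin t • e₂‖ = 1 := by
  have := norm_add_sq_real (Real.cos t • e₁) (Real.sin t • e₂)
  rw [inner_smul_left, inner_smul_right, h, norm_smul, norm_smul, h₁, h₂] at this
  simp only [Real.norm_eq_abs, mul_one, sq_abs, mul_zero, add_zero, Real.cos_sq_add_sin_sq] at this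
  rw [← Real.sqrt_sq (norm_nonneg _), this, Real.sqrt_one]

/-- Reflections stand in for rotations of the plane: they are already isometries of the whole space,
and on angles they act by `t ↦ 2φ - t`. -/
lemma reflection_cos_smul_add_sin_smul (h₁ : ‖e₁‖ = 1) (h₂ : ‖e₂‖ = 1) (h : inner ℝ e₁ e₂ = 0)
    (φ t : ℝ) :
    (ℝ ∙ (Real.cos φ • e₁ + Real.sin φ • e₂)).reflection (Real.cos t • e₁ + Real.sin t • e₂)
      = Real.cos (2 * φ - t) • e₁ + Real.sin (2 * φ - t) • e₂ := by
  have h' : inner ℝ e₂ e₁ = 0 := by rw [real_inner_comm]; exact h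
  have hin : inner ℝ (Real.cos φ • e₁ + Real.sin φ • e₂) (Real.cos t • e₁ + Real.sin t • e₂)
      = Real.cos (φ - t) := by
    simp only [inner_add_left, inner_add_right, inner_smul_left, inner_smul_right, h, h',
      real_inner_self_eq_norm_sq, h₁, h₂, Real.cos_sub]
    simp
    ring
  rw [Submodule.reflection_singleton_apply, hin, norm_cos_smul_add_sin_smul h₁ h₂ h]
  have e1 : Real.cos (2 * φ - t) = 2 * Real.cos (φ - t) * Real.cos φ - Real.cos t := by
    rw [show 2 * φ - t = (φ - t) + φ by ring, Real.cos_add]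
    have : Real.cos t = Real.cos (φ - (φ - t)) := by ring_nf
    rw [this, Real.cos_sub φ (φ - t)]; ring
  have e2 : Real.sin (2 * φ - t) = 2 * Real.cos (φ - t) * Real.sin φ - Real.sin t := by
    rw [show 2 * φ - t = (φ - t) + φ by ring, Real.sin_add]
    have : Real.sin t = Real.sin (φ - (φ - t)) := by ring_nf
    rw [this, Real.sin_sub φ (φ - t)]; ring
  rw [e1, e2]
  simp only [RCLike.ofReal_real_eq_id, id, one_pow, div_one]
  module

end Directions

/-! ### The invariant measure on directions, and angles as measures of separating directions. -/

section Sphere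

variable {E : Type*} [NormedAddCommGroup E] [InnerProductSpace ℝ E] [FiniteDimensional ℝ E]
  [MeasurableSpace E] [BorelSpace E]

/-- The spherical measure of a set is a multiple of the volume of the cone over it; a linear
isometry carries cones to cones and preserves volume. -/
lemma toSphere_map_isometry (L : E ≃ₗᵢ[ℝ] E) :
    (volume : Measure E).toSphere.map
      (fun α : Metric.sphere (0 : E) 1 => (⟨L α, by simp⟩ : Metric.sphere (0 : E) 1))
      = (volume : Measure E).toSphere := by
  have hm : Measurable
      (fun α : Metric.sphere (0 : E) 1 => (⟨L α, by simp⟩ : Metric.sphere (0 : E) 1)) :=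
    (L.continuous.measurable.comp measurable_subtype_coe).subtype_mk
  ext s hs
  rw [Measure.map_apply hm hs, Measure.toSphere_apply' _ (hm hs), Measure.toSphere_apply' _ hs]
  congr 1
  conv_rhs => rw [← L.measurePreserving.measure_preimage_equiv (f := L.toHomeomorph.toMeasurableEquiv)]
  congr 1
  ext x
  change x ∈ (_ : Set E) ↔ L x ∈ (_ : Set E)
  constructor
  · rintro ⟨r, hr, _, ⟨α, hα, rfl⟩, rfl⟩
    exact ⟨r, hr, _, ⟨_, hα, rfl⟩, by simp⟩
  · rintro ⟨r, hr, _, ⟨β, hβ, rfl⟩, h⟩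
    refine ⟨r, hr, _, ⟨⟨L.symm β, by simp⟩, ?_, rfl⟩, ?_⟩
    · simpa using hβ
    · apply L.injective
      simpa using h

instance : IsFiniteMeasure (dirMeasure E) := by
  rcases subsingleton_or_nontrivial E with h | h
  · have : dirMeasure E = 0 := by
      rw [dirMeasure, (Measure.toSphere_eq_zero_iff (μ := (volume : Measure E))).2 h, smul_zero]
    rw [this]; infer_instance
  · unfold dirMeasure
    apply Measure.smul_finite
    apply ENNReal.div_ne_top ENNReal.ofReal_ne_top
    rw [Ne, Measure.measure_univ_eq_zero]
    exact Measure.toSphere_ne_zero _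

lemma dirMeasure_univ [Nontrivial E] : (dirMeasure E).real Set.univ = 2 * Real.pi := by
  rw [dirMeasure, measureReal_ennreal_smul_apply, measureReal_def, ENNReal.toReal_div,
    ENNReal.toReal_ofReal (by positivity), div_mul_cancel₀]
  rw [ENNReal.toReal_ne_zero, Ne, Measure.measure_univ_eq_zero]
  exact ⟨Measure.toSphere_ne_zero _, measure_ne_top _ _⟩

lemma integral_dirMeasure_isometry (L : E ≃ₗᵢ[ℝ] E) {f : E → ℝ} (hf : Measurable f) :
    ∫ α : Metric.sphere (0 : E) 1, f (L α) ∂(dirMeasure E)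
      = ∫ α : Metric.sphere (0 : E) 1, f α ∂(dirMeasure E) := by
  have hm : Measurable
      (fun α : Metric.sphere (0 : E) 1 => (⟨L α, by simp⟩ : Metric.sphere (0 : E) 1)) :=
    (L.continuous.measurable.comp measurable_subtype_coe).subtype_mk
  simp only [dirMeasure, integral_smul_measure]
  congr 1
  conv_rhs => rw [← toSphere_map_isometry L]
  rw [integral_map hm.aemeasurable]
  exact (hf.comp measurable_subtype_coe).aestronglyMeasurable

/-- The cone over the great sphere orthogonal to `u` lies in a proper subspace, which has volume
zero. -/
lemma ae_inner_ne_zero {u : E} (hu : u ≠ 0) :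
    ∀ᵐ α : Metric.sphere (0 : E) 1 ∂(dirMeasure E), inner ℝ (α : E) u ≠ 0 := by
  have hms : MeasurableSet {α : Metric.sphere (0 : E) 1 | inner ℝ (α : E) u = 0} :=
    measurableSet_eq_fun (by fun_prop) measurable_const
  have h0 : (volume : Measure E).toSphere
      {α : Metric.sphere (0 : E) 1 | inner ℝ (α : E) u = 0} = 0 := by
    rw [Measure.toSphere_apply' _ hms]
    have hsub : Set.Ioo (0 : ℝ) 1 • (Subtype.val ''
        {α : Metric.sphere (0 : E) 1 | inner ℝ (α : E) u = 0}) ⊆ (((ℝ ∙ u)ᗮ : Submodule ℝ E) : Set E) := by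
      rintro _ ⟨r, -, _, ⟨α, hα, rfl⟩, rfl⟩
      have hα' : inner ℝ (α : E) u = 0 := hα
      rw [SetLike.mem_coe, Submodule.mem_orthogonal_singleton_iff_inner_left]
      simp [inner_smul_left, hα']
    have hne : (ℝ ∙ u)ᗮ ≠ ⊤ := by
      intro h
      have : u ∈ (ℝ ∙ u)ᗮ := h ▸ Submodule.mem_top
      rw [Submodule.mem_orthogonal_singleton_iff_inner_left] at this
      exact hu (inner_self_eq_zero.1 this)
    rw [measure_mono_null hsub (Measure.addHaar_submodule _ _ hne), mul_zero]
  rw [ae_iff, dirMeasure]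
  simp only [not_not, Measure.smul_apply, h0, smul_zero]

lemma measurable_halfInd : Measurable fun w : E × E => halfInd w.1 w.2 :=
  Measurable.ite (measurableSet_le (by fun_prop) measurable_const) measurable_const
    measurable_const

lemma measurable_halfInd_right (u : E) : Measurable (halfInd u) :=
  measurable_halfInd.comp measurable_prodMk_left

/-- The measure of the set of directions that separate `u` from `v`. -/
def sepMeasure (u v : E) : ℝ :=
  ∫ α : Metric.sphere (0 : E) 1, |halfInd u α - halfInd v α| ∂(dirMeasure E)

lemma integrable_dirMeasure {f : E → ℝ} (hf : Measurable f) {M : ℝ} (hM : ∀ α, |f α| ≤ M) :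
    Integrable (fun α : Metric.sphere (0 : E) 1 => f α) (dirMeasure E) :=
  Integrable.of_bound (hf.comp measurable_subtype_coe).aestronglyMeasurable M
    (Filter.Eventually.of_forall fun _ => hM _)

lemma integrable_halfInd (u : E) :
    Integrable (fun α : Metric.sphere (0 : E) 1 => halfInd u α) (dirMeasure E) :=
  integrable_dirMeasure (measurable_halfInd_right u) (M := 1) fun α => by
    rw [abs_of_nonneg (halfInd_nonneg _ _)]; exact halfInd_le_one _ _

lemma integrable_abs_halfInd_sub (u v : E) : Integrable
    (fun α : Metric.sphere (0 : E) 1 => |halfInd u α - halfInd v α|) (dirMeasure E) :=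
  ((integrable_halfInd u).sub (integrable_halfInd v)).abs

lemma sepMeasure_comm (u v : E) : sepMeasure u v = sepMeasure v u := by
  simp only [sepMeasure, abs_sub_comm]

lemma sepMeasure_self (u : E) : sepMeasure u u = 0 := by simp [sepMeasure]

lemma sepMeasure_nonneg (u v : E) : 0 ≤ sepMeasure u v :=
  integral_nonneg fun _ => abs_nonneg _

lemma sepMeasure_smul_left {r : ℝ} (hr : 0 < r) (u v : E) :
    sepMeasure (r • u) v = sepMeasure u v := by
  simp only [sepMeasure, halfInd_smul hr]

lemma sepMeasure_smul_right {r : ℝ} (hr : 0 < r) (u v : E) :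
    sepMeasure u (r • v) = sepMeasure u v := by
  simp only [sepMeasure, halfInd_smul hr]

lemma sepMeasure_isometry (L : E ≃ₗᵢ[ℝ] E) (u v : E) :
    sepMeasure (L u) (L v) = sepMeasure u v := by
  unfold sepMeasure
  rw [← integral_dirMeasure_isometry L (f := fun α => |halfInd (L u) α - halfInd (L v) α|)
    (((measurable_halfInd_right _).sub (measurable_halfInd_right _)).abs)]
  simp only [halfInd_isometry]

/-- Almost every direction lies in exactly one of the half-spaces of `u` and `-u`, so it separates
`v` from exactly one of them. -/
lemma sepMeasure_add_neg [Nontrivial E] {u : E} (hu : u ≠ 0) (v : E) :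
    sepMeasure u v + sepMeasure v (-u) = 2 * Real.pi := by
  unfold sepMeasure
  rw [← integral_add (integrable_abs_halfInd_sub _ _) (integrable_abs_halfInd_sub _ _)]
  have : ∀ᵐ α : Metric.sphere (0 : E) 1 ∂(dirMeasure E),
      |halfInd u α - halfInd v α| + |halfInd v α - halfInd (-u) α| = 1 := by
    filter_upwards [ae_inner_ne_zero hu] with α hα
    rw [halfInd_neg hα]
    rcases halfInd_eq u (α : E) with h | h <;> rcases halfInd_eq v (α : E) with h' | h' <;>
      simp [h, h']
  rw [integral_congr_ae this]
  simp [dirMeasure_univ]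

lemma sepMeasure_neg [Nontrivial E] {u : E} (hu : u ≠ 0) :
    sepMeasure u (-u) = 2 * Real.pi := by
  simpa [sepMeasure_self] using sepMeasure_add_neg hu u

/-- A direction separating `u` from `w` separates `v` from exactly one of them when `v` is a
nonnegative combination of `u` and `w`. -/
lemma sepMeasure_add {u v w : E} {a b : ℝ} (ha : 0 < a) (hb : 0 < b)
    (hv : v = a • u + b • w) : sepMeasure u w = sepMeasure u v + sepMeasure v w := by
  unfold sepMeasure
  rw [← integral_add (integrable_abs_halfInd_sub _ _) (integrable_abs_halfInd_sub _ _)]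
  congr 1
  ext α
  have hin : inner ℝ (α : E) v = a * inner ℝ (α : E) u + b * inner ℝ (α : E) w := by
    rw [hv, inner_add_right, inner_smul_right, inner_smul_right]
  unfold halfInd
  rw [hin]
  by_cases h1 : inner ℝ (α : E) u ≤ 0 <;> by_cases h2 : inner ℝ (α : E) w ≤ 0
  · have : a * inner ℝ (α : E) u + b * inner ℝ (α : E) w ≤ 0 := by nlinarith
    simp [h1, h2, this]
  · simp only [h1, h2, if_true, if_false]
    split_ifs <;> norm_num
  · simp only [h1, h2, if_true, if_false]
    split_ifs <;> norm_num
  · have : ¬ a * inner ℝ (α : E) u + b * inner ℝ (α : E) w ≤ 0 := by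
      push Not at h1 h2 ⊢; positivity
    simp [h1, h2, this]

section Plane

variable {e₁ e₂ : E}

/-- Along a unit circle the separating measure is rotation invariant and additive, hence linear in
the angle. The slope is read off at `π / 2`, where symmetry halves the total mass. -/
lemma sepMeasure_plane [Nontrivial E] (h₁ : ‖e₁‖ = 1) (h₂ : ‖e₂‖ = 1) (h : inner ℝ e₁ e₂ = 0)
    {t : ℝ} (ht0 : 0 ≤ t) (ht : t < Real.pi) :
    sepMeasure e₁ (Real.cos t • e₁ + Real.sin t • e₂) = 2 * t := by
  set c : ℝ → E := fun t => Real.cos t • e₁ + Real.sin t • e₂ with hc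
  have hc0 : c 0 = e₁ := by simp [hc]
  have he₁ : e₁ ≠ 0 := by intro h0; simp [h0] at h₁
  -- Reflecting in the line at angle `b / 2` sends the angles `a` and `b` to `b - a` and `0`.
  have hrot : ∀ a b, sepMeasure (c a) (c b) = sepMeasure (c 0) (c (b - a)) := by
    intro a b
    rw [← sepMeasure_isometry ((ℝ ∙ c (b / 2)).reflection) (c a) (c b)]
    simp only [hc]
    rw [reflection_cos_smul_add_sin_smul h₁ h₂ h, reflection_cos_smul_add_sin_smul h₁ h₂ h,
      sepMeasure_comm]
    ring_nf
  have hneg : ∀ a, c (a + Real.pi) = - c a := by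
    intro a; simp only [hc, Real.cos_add_pi, Real.sin_add_pi]; module
  set e : ℝ → ℝ := fun t => sepMeasure (c 0) (c t) - 2 * t with he
  have hz := eq_zero_of_additive_of_bounded (T := Real.pi / 2) (M := 4 * Real.pi) (e := e) ?_ ?_ ?_
    t ht0 (by linarith)
  · simp only [he, hc0] at hz; linarith
  · intro s t hs ht hst
    rcases hs.eq_or_lt with rfl | hs
    · simp [he, sepMeasure_self]
    rcases ht.eq_or_lt with rfl | ht
    · simp [he, sepMeasure_self]
    have hpos : 0 < Real.sin (s + t) := Real.sin_pos_of_pos_of_lt_pi (by linarith) (by linarith)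
    have hsub : sepMeasure (c 0) (c (s + t)) = sepMeasure (c 0) (c s) + sepMeasure (c s) (c (s + t)) := by
      -- The weights come from the sine rule; they are positive because `s + t < π`.
      apply sepMeasure_add (a := Real.sin t / Real.sin (s + t)) (b := Real.sin s / Real.sin (s + t))
      · exact div_pos (Real.sin_pos_of_pos_of_lt_pi ht (by linarith)) hpos
      · exact div_pos (Real.sin_pos_of_pos_of_lt_pi hs (by linarith)) hpos
      · have h1 : Real.sin (s + t) • c s = Real.sin t • c 0 + Real.sin s • c (s + t) := by
          simp only [hc, smul_add, smul_smul, Real.cos_zero, Real.sin_zero, mul_one, mul_zero]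
          have i1 : Real.sin (s + t) * Real.cos s
              = Real.sin t + Real.sin s * Real.cos (s + t) := by
            have : Real.sin t = Real.sin ((s + t) - s) := by ring_nf
            rw [this, Real.sin_sub]; ring
          rw [i1, mul_comm (Real.sin (s + t)) (Real.sin s)]
          module
        rw [div_eq_inv_mul, div_eq_inv_mul, mul_smul, mul_smul, ← smul_add, ← h1,
          inv_smul_smul₀ hpos.ne']
    simp only [he]
    rw [hsub, hrot s (s + t), add_sub_cancel_left]
    ring
  · have h1 := sepMeasure_add_neg (u := c 0) (by rwa [hc0]) (c (Real.pi / 2))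
    rw [← hneg 0, hrot (Real.pi / 2)] at h1
    rw [show 0 + Real.pi - Real.pi / 2 = Real.pi / 2 by ring] at h1
    simp only [he]; linarith
  · intro t h0 h1
    have h2 := sepMeasure_add_neg (u := c 0) (by rwa [hc0]) (c t)
    have h3 := sepMeasure_nonneg (c t) (- c 0)
    have h4 := sepMeasure_nonneg (c 0) (c t)
    simp only [he]
    rw [abs_le]; constructor <;> linarith [Real.pi_pos]

end Plane

/-- The directions separating `u` from `v` have measure `2 ∠(u, v)`. -/
theorem sepMeasure_eq_angle {u v : E} (hu : u ≠ 0) (hv : v ≠ 0) :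
    sepMeasure u v = 2 * InnerProductGeometry.angle u v := by
  have hnt : Nontrivial E := ⟨u, 0, hu⟩
  by_cases hs : Real.sin (InnerProductGeometry.angle u v) = 0
  · rcases InnerProductGeometry.sin_eq_zero_iff_angle_eq_zero_or_angle_eq_pi.1 hs with h | h
    · rw [h]
      obtain ⟨-, r, hr, rfl⟩ := InnerProductGeometry.angle_eq_zero_iff.1 h
      rw [sepMeasure_smul_right hr, sepMeasure_self, mul_zero]
    · rw [h]
      obtain ⟨-, r, hr, rfl⟩ := InnerProductGeometry.angle_eq_pi_iff.1 h
      rw [show r • u = (-r) • (-u) by simp, sepMeasure_smul_right (by linarith), sepMeasure_neg hu]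
  · set φ := InnerProductGeometry.angle u v with hφ
    have hφ0 : 0 ≤ φ := InnerProductGeometry.angle_nonneg _ _
    have hφ1 : φ < Real.pi := lt_of_le_of_ne (InnerProductGeometry.angle_le_pi _ _) (by
      intro h; rw [h] at hs; simp at hs)
    set e₁ : E := ‖u‖⁻¹ • u with he₁
    set w : E := ‖v‖⁻¹ • v with hw
    set e₂ : E := (Real.sin φ)⁻¹ • (w - Real.cos φ • e₁) with he₂
    have n₁ : ‖e₁‖ = 1 := by simp [he₁, norm_smul, hu]
    have nw : ‖w‖ = 1 := by simp [hw, norm_smul, hv]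
    have hin : inner ℝ e₁ w = Real.cos φ := by
      rw [hφ, InnerProductGeometry.cos_angle, he₁, hw, inner_smul_left, inner_smul_right]
      have := norm_ne_zero_iff.2 hu
      have := norm_ne_zero_iff.2 hv
      simp; field_simp
    have ho : inner ℝ e₁ e₂ = 0 := by
      rw [he₂, inner_smul_right, inner_sub_right, hin, inner_smul_right,
        real_inner_self_eq_norm_sq, n₁]; simp
    have n₂ : ‖e₂‖ = 1 := by
      have hsq : ‖w - Real.cos φ • e₁‖ ^ 2 = Real.sin φ ^ 2 := by
        rw [norm_sub_sq_real, nw, inner_smul_right, real_inner_comm, hin, norm_smul _ e₁, n₁,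
          Real.sin_sq]
        simp only [Real.norm_eq_abs, mul_one, sq_abs]; ring
      have hs0 : 0 < Real.sin φ := lt_of_le_of_ne (InnerProductGeometry.sin_angle_nonneg _ _) (Ne.symm hs)
      rw [he₂, norm_smul, norm_inv, Real.norm_of_nonneg hs0.le,
        (pow_left_inj₀ (norm_nonneg _) hs0.le two_ne_zero).1 hsq, inv_mul_cancel₀ hs]
    have hw' : w = Real.cos φ • e₁ + Real.sin φ • e₂ := by
      rw [he₂, smul_inv_smul₀ hs]; simp
    rw [← sepMeasure_smul_left (inv_pos.2 (norm_pos_iff.2 hu)) u v,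
      ← sepMeasure_smul_right (inv_pos.2 (norm_pos_iff.2 hv)), ← he₁, ← hw, hw',
      sepMeasure_plane n₁ n₂ ho hφ0 hφ1]

/-- Opposite half-spaces share the total mass `2π` equally, by the symmetry `α ↦ -α`. -/
lemma integral_halfInd {u : E} (hu : u ≠ 0) :
    ∫ α : Metric.sphere (0 : E) 1, halfInd u α ∂(dirMeasure E) = Real.pi := by
  have hnt : Nontrivial E := ⟨u, 0, hu⟩
  have h1 : ∫ α : Metric.sphere (0 : E) 1, halfInd (-u) α ∂(dirMeasure E)
      = ∫ α : Metric.sphere (0 : E) 1, halfInd u α ∂(dirMeasure E) := by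
    rw [← integral_dirMeasure_isometry (LinearIsometryEquiv.neg ℝ) (measurable_halfInd_right (-u))]
    simp [halfInd]
  have h2 : ∫ α : Metric.sphere (0 : E) 1, halfInd (-u) α ∂(dirMeasure E)
      = ∫ α : Metric.sphere (0 : E) 1, (1 - halfInd u α) ∂(dirMeasure E) := by
    apply integral_congr_ae
    filter_upwards [ae_inner_ne_zero hu] with α hα using halfInd_neg hα
  rw [integral_sub (integrable_const _) (integrable_halfInd u), h1] at h2
  simp [dirMeasure_univ] at h2
  linarith

/-- Inclusion-exclusion: a product of indicators is half of their sum minus their absolute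
difference, giving `(π + π - 2∠) / 2`. -/
lemma integral_halfInd_mul {u v : E} (hu : u ≠ 0) (hv : v ≠ 0) :
    ∫ α : Metric.sphere (0 : E) 1, halfInd u α * halfInd v α ∂(dirMeasure E)
      = Real.pi - InnerProductGeometry.angle u v := by
  have h := sepMeasure_eq_angle hu hv
  unfold sepMeasure at h
  have h2 : ∀ α : Metric.sphere (0 : E) 1, halfInd u (α : E) * halfInd v α
      = (halfInd u α + halfInd v α - |halfInd u α - halfInd v α|) / 2 := by
    intro α
    rcases halfInd_eq u (α : E) with h | h <;> rcases halfInd_eq v (α : E) with h' | h' <;>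
      simp [h, h']
  simp_rw [h2]
  rw [integral_div, integral_sub, integral_add, h, integral_halfInd hu, integral_halfInd hv]
  · ring
  · exact integrable_halfInd u
  · exact integrable_halfInd v
  · exact (integrable_halfInd u).add (integrable_halfInd v)
  · exact integrable_abs_halfInd_sub u v

lemma measurable_realSign : Measurable Real.sign := by
  unfold Real.sign
  exact Measurable.ite measurableSet_Iio measurable_const
    (Measurable.ite measurableSet_Ioi measurable_const measurable_const)

lemma measurable_sgnInner : Measurable fun w : E × E => sgnInner w.1 w.2 :=
  measurable_realSign.comp (by fun_prop)

lemma measurable_sgnInner_right (u : E) : Measurable (sgnInner u) :=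
  measurable_sgnInner.comp measurable_prodMk_left

/-- `π / 2 - ∠(u, v)` is a positive definite kernel, also where `u` or `v` vanishes. -/
lemma integral_sgnInner_mul (u v : E) :
    ∫ α : Metric.sphere (0 : E) 1, sgnInner u α * sgnInner v α ∂(dirMeasure E)
      = 4 * (Real.pi / 2 - InnerProductGeometry.angle u v) := by
  -- At a zero vector both sides vanish, since `Real.sign 0 = 0` and the angle with zero is `π / 2`.
  -- Half-space indicators do not have this property, so signs are used when atoms are allowed.
  by_cases hu : u = 0
  · simp [hu, sgnInner]
  by_cases hv : v = 0
  · simp [hv, sgnInner]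
  have hnt : Nontrivial E := ⟨u, 0, hu⟩
  have h := sepMeasure_eq_angle hu hv
  unfold sepMeasure at h
  have h2 : ∀ᵐ α : Metric.sphere (0 : E) 1 ∂(dirMeasure E), sgnInner u (α : E) * sgnInner v α
      = 1 - 2 * |halfInd u α - halfInd v α| := by
    filter_upwards [ae_inner_ne_zero hu, ae_inner_ne_zero hv] with α h1 h2
    rw [sgnInner_eq h1, sgnInner_eq h2]
    rcases halfInd_eq u (α : E) with h | h <;> rcases halfInd_eq v (α : E) with h' | h' <;>
      (simp [h, h']; try norm_num)
  rw [integral_congr_ae h2, integral_sub (integrable_const _)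
    ((integrable_abs_halfInd_sub u v).const_mul 2), integral_const_mul, h]
  simp [dirMeasure_univ]
  ring

lemma integrable_inner_mul {e : E} {f : E → ℝ} (hf : Measurable f) (hM : ∀ α, |f α| ≤ 1) :
    Integrable (fun α : Metric.sphere (0 : E) 1 => inner ℝ (α : E) e * f α) (dirMeasure E) := by
  refine Integrable.of_bound ?_ ‖e‖ (Filter.Eventually.of_forall fun α => ?_)
  · exact Measurable.aestronglyMeasurable
      ((by fun_prop : Measurable fun α : Metric.sphere (0 : E) 1 => inner ℝ (α : E) e).mul
        (hf.comp measurable_subtype_coe))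
  · rw [Real.norm_eq_abs, abs_mul]
    calc _ ≤ ‖e‖ * 1 := mul_le_mul (abs_inner_sphere_le α e) (hM _) (abs_nonneg _) (norm_nonneg _)
      _ = _ := mul_one _

/-- The first moment of the sign field recovers the direction of `u`. -/
lemma exists_integral_inner_mul_sgnInner [Nontrivial E] :
    ∃ c : ℝ, 2 * Real.pi / Module.finrank ℝ E ≤ c ∧ ∀ e u : E,
      ∫ α : Metric.sphere (0 : E) 1, inner ℝ (α : E) e * sgnInner u α ∂(dirMeasure E)
        = c * inner ℝ e (‖u‖⁻¹ • u) := by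
  obtain ⟨e₀, he₀⟩ := exists_norm_eq (E := E) (zero_le_one)
  set c := ∫ α : Metric.sphere (0 : E) 1, |inner ℝ (α : E) e₀| ∂(dirMeasure E) with hc
  -- A reflection carries `e₀` to any other unit vector, so `c` does not depend on the choice of
  -- `e₀`.
  have hcu : ∀ u : E, ‖u‖ = 1 →
      ∫ α : Metric.sphere (0 : E) 1, |inner ℝ (α : E) u| ∂(dirMeasure E) = c := by
    intro u hu
    set R := (ℝ ∙ (e₀ - u))ᗮ.reflection with hR
    have hRe : R e₀ = u := Submodule.reflection_sub (by rw [hu, he₀])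
    rw [hc, ← integral_dirMeasure_isometry R (f := fun α => |inner ℝ (α : E) u|) (by fun_prop)]
    simp only [← hRe, LinearIsometryEquiv.inner_map_map]
  refine ⟨c, ?_, ?_⟩
  · set b := stdOrthonormalBasis ℝ E
    have h1 : ∑ i, ∫ α : Metric.sphere (0 : E) 1, |inner ℝ (α : E) (b i)| ∂(dirMeasure E)
        = Module.finrank ℝ E * c := by
      simp [hcu _ (b.norm_eq_one _)]
    have hi : ∀ u : E, Integrable (fun α : Metric.sphere (0 : E) 1 => |inner ℝ (α : E) u|)
        (dirMeasure E) := fun u => by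
      refine Integrable.of_bound (Measurable.aestronglyMeasurable (by fun_prop)) ‖u‖
        (Filter.Eventually.of_forall fun α => ?_)
      rw [Real.norm_eq_abs, abs_abs]; exact abs_inner_sphere_le α u
    rw [← integral_finsetSum _ fun i _ => hi _] at h1
    -- In an orthonormal basis the coordinates of `α` are at most one in absolute value, so their
    -- absolute values sum to at least the sum of squares, which is one.
    have h2 : ∫ _α : Metric.sphere (0 : E) 1, (1 : ℝ) ∂(dirMeasure E)
        ≤ ∫ α : Metric.sphere (0 : E) 1, ∑ i, |inner ℝ (α : E) (b i)| ∂(dirMeasure E) := by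
      apply integral_mono (integrable_const _) (integrable_finsetSum _ fun i _ => hi _)
      intro α
      have h3 := b.sum_sq_norm_inner_left (α : E)
      have h4 : ‖(α : E)‖ = 1 := by simp
      rw [h4, one_pow] at h3
      refine h3.symm.le.trans (Finset.sum_le_sum ?_)
      intro i _
      rw [Real.norm_eq_abs, sq]
      have := abs_inner_sphere_le α (b i)
      rw [b.norm_eq_one] at this
      exact mul_le_of_le_one_left (abs_nonneg _) this
    rw [integral_const, dirMeasure_univ, h1] at h2
    rw [div_le_iff₀ (by exact_mod_cast Module.finrank_pos)]
    simp at h2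
    linarith
  · intro e u
    by_cases hu : u = 0
    · simp [hu, sgnInner]
    set v : E := ‖u‖⁻¹ • u with hv
    have nv : ‖v‖ = 1 := by simp [hv, norm_smul, hu]
    have hsg : ∀ α : E, sgnInner u α = sgnInner v α := by
      intro α
      unfold sgnInner
      rw [hv, inner_smul_right]
      have hp : 0 < ‖u‖⁻¹ := inv_pos.2 (norm_pos_iff.2 hu)
      rcases lt_trichotomy (inner ℝ α u) 0 with h | h | h
      · rw [Real.sign_of_neg h, Real.sign_of_neg (mul_neg_of_pos_of_neg hp h)]
      · simp [h]
      · rw [Real.sign_of_pos h, Real.sign_of_pos (mul_pos hp h)]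
    simp only [hsg]
    set w : E := e - inner ℝ e v • v with hw
    have hwv : inner ℝ v w = 0 := by
      rw [hw, inner_sub_right, inner_smul_right, real_inner_self_eq_norm_sq, nv,
        real_inner_comm]; ring
    have hdec : e = inner ℝ e v • v + w := by rw [hw]; simp
    -- The reflection in the line through `v` fixes `v` and negates `w`, so it flips the sign of the
    -- integrand.
    have h0 : ∫ α : Metric.sphere (0 : E) 1, inner ℝ (α : E) w * sgnInner v α ∂(dirMeasure E)
        = 0 := by
      have h1 := integral_dirMeasure_isometry ((ℝ ∙ v).reflection)
        (f := fun α => inner ℝ α w * sgnInner v α)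
        ((by fun_prop : Measurable fun α : E => inner ℝ α w).mul (measurable_sgnInner_right v))
      have h2 : ∀ α : E, inner ℝ ((ℝ ∙ v).reflection α) w * sgnInner v ((ℝ ∙ v).reflection α)
          = - (inner ℝ α w * sgnInner v α) := by
        intro α
        have hRv : (ℝ ∙ v).reflection v = v := by
          rw [Submodule.reflection_singleton_apply, real_inner_self_eq_norm_sq, nv]
          simp only [RCLike.ofReal_real_eq_id, id, one_pow, div_one]; module
        have hRw : (ℝ ∙ v).reflection w = - w := by
          rw [Submodule.reflection_singleton_apply, hwv]; simp
        have h3 : inner ℝ ((ℝ ∙ v).reflection α) w = - inner ℝ α w := by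
          have := (ℝ ∙ v).reflection.inner_map_map α w
          rw [hRw, inner_neg_right] at this
          linarith
        have h4 : inner ℝ ((ℝ ∙ v).reflection α) v = inner ℝ α v := by
          have := (ℝ ∙ v).reflection.inner_map_map α v
          rwa [hRv] at this
        unfold sgnInner
        rw [h3, h4]; ring
      simp only [h2] at h1
      rw [integral_neg] at h1
      linarith
    have hsplit : ∀ α : E, inner ℝ α e * sgnInner v α
        = inner ℝ e v * |inner ℝ α v| + inner ℝ α w * sgnInner v α := by
      intro α
      have h1 : inner ℝ α e = inner ℝ e v * inner ℝ α v + inner ℝ α w := by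
        conv_lhs => rw [hdec]
        rw [inner_add_right, inner_smul_right]
      have h2 : inner ℝ α v * sgnInner v α = |inner ℝ α v| := by
        unfold sgnInner
        rcases lt_trichotomy (inner ℝ α v) 0 with h | h | h
        · rw [Real.sign_of_neg h, abs_of_neg h]; ring
        · simp [h]
        · rw [Real.sign_of_pos h, abs_of_pos h]; ring
      rw [h1, add_mul, mul_assoc, h2]
    simp only [hsplit]
    rw [integral_add, integral_const_mul, hcu v nv, h0]
    · ring
    · refine Integrable.of_bound (Measurable.aestronglyMeasurable (by fun_prop)) |inner ℝ e v|
        (Filter.Eventually.of_forall fun α => ?_)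
      rw [Real.norm_eq_abs, abs_mul, abs_abs]
      have := abs_inner_sphere_le α v
      rw [nv] at this
      exact mul_le_of_le_one_right (abs_nonneg _) this
    · exact integrable_inner_mul (measurable_sgnInner_right v) (abs_sgnInner_le v)

end Sphere

end

/-! ### A calculus of bounded measurable functions for Fubini and Cauchy–Schwarz. -/

section BoundedMeasurable

variable {α β : Type*} [MeasurableSpace α] [MeasurableSpace β]

/-- Bounded measurable real functions. -/
structure BddMeas (f : α → ℝ) : Prop where
  meas : Measurable f
  bdd : ∃ M, ∀ a, |f a| ≤ M

namespace BddMeas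

variable {f g : α → ℝ}

lemma integrable (hf : BddMeas f) (ν : Measure α) [IsFiniteMeasure ν] : Integrable f ν := by
  obtain ⟨M, hM⟩ := hf.bdd
  exact Integrable.of_bound hf.meas.aestronglyMeasurable M (Filter.Eventually.of_forall hM)

lemma const (c : ℝ) : BddMeas fun _ : α => c := ⟨measurable_const, |c|, fun _ => le_rfl⟩

lemma add (hf : BddMeas f) (hg : BddMeas g) : BddMeas fun a => f a + g a := by
  obtain ⟨M, hM⟩ := hf.bdd
  obtain ⟨N, hN⟩ := hg.bdd
  exact ⟨hf.meas.add hg.meas, M + N, fun a => (abs_add_le _ _).trans (add_le_add (hM a) (hN a))⟩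

lemma sub (hf : BddMeas f) (hg : BddMeas g) : BddMeas fun a => f a - g a := by
  obtain ⟨M, hM⟩ := hf.bdd
  obtain ⟨N, hN⟩ := hg.bdd
  exact ⟨hf.meas.sub hg.meas, M + N, fun a => (abs_sub _ _).trans (add_le_add (hM a) (hN a))⟩

lemma mul (hf : BddMeas f) (hg : BddMeas g) : BddMeas fun a => f a * g a := by
  obtain ⟨M, hM⟩ := hf.bdd
  obtain ⟨N, hN⟩ := hg.bdd
  refine ⟨hf.meas.mul hg.meas, M * N, fun a => ?_⟩
  rw [abs_mul]
  exact mul_le_mul (hM a) (hN a) (abs_nonneg _) ((abs_nonneg _).trans (hM a))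

lemma const_mul (c : ℝ) (hf : BddMeas f) : BddMeas fun a => c * f a := (const c).mul hf

lemma sq (hf : BddMeas f) : BddMeas fun a => f a ^ 2 := by
  simpa only [pow_two] using hf.mul hf

lemma comp (hf : BddMeas f) {φ : β → α} (hφ : Measurable φ) : BddMeas fun b => f (φ b) := by
  obtain ⟨M, hM⟩ := hf.bdd
  exact ⟨hf.meas.comp hφ, M, fun b => hM _⟩

lemma integral_right {F : α × β → ℝ} (hF : BddMeas F) (ν : Measure β) [IsFiniteMeasure ν] :
    BddMeas fun a => ∫ b, F (a, b) ∂ν := by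
  obtain ⟨M, hM⟩ := hF.bdd
  refine ⟨hF.meas.stronglyMeasurable.integral_prod_right'.measurable, M * ν.real Set.univ,
    fun a => ?_⟩
  have := norm_integral_le_of_norm_le_const (μ := ν) (f := fun b => F (a, b)) (C := M)
    (Filter.Eventually.of_forall fun w => hM _)
  simpa using this

lemma integral_swap {F : α × β → ℝ} (hF : BddMeas F) (μ : Measure α) (ν : Measure β)
    [IsFiniteMeasure μ] [IsFiniteMeasure ν] :
    ∫ a, ∫ b, F (a, b) ∂ν ∂μ = ∫ b, ∫ a, F (a, b) ∂μ ∂ν :=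
  integral_integral_swap (f := fun a b => F (a, b)) (hF.integrable _)

/-- The Cauchy–Schwarz inequality for bounded functions. -/
lemma sq_integral_mul_le (hf : BddMeas f) (hg : BddMeas g) (ν : Measure α) [IsFiniteMeasure ν] :
    (∫ a, f a * g a ∂ν) ^ 2 ≤ (∫ a, f a ^ 2 ∂ν) * ∫ a, g a ^ 2 ∂ν := by
  have h : ∀ t : ℝ, 0 ≤ (∫ a, g a ^ 2 ∂ν) * (t * t) + (-2 * ∫ a, f a * g a ∂ν) * t
      + ∫ a, f a ^ 2 ∂ν := by
    intro t
    have h1 : 0 ≤ ∫ a, (f a - t * g a) ^ 2 ∂ν := integral_nonneg fun _ => sq_nonneg _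
    have h2 : ∀ a, (f a - t * g a) ^ 2 = (f a ^ 2 - 2 * t * (f a * g a)) + t ^ 2 * g a ^ 2 :=
      fun a => by ring
    simp_rw [h2] at h1
    rw [integral_add ((hf.sq.sub ((hf.mul hg).const_mul (2 * t))).integrable ν)
      ((hg.sq.const_mul (t ^ 2)).integrable ν), integral_sub (hf.sq.integrable ν)
      (((hf.mul hg).const_mul (2 * t)).integrable ν), integral_const_mul, integral_const_mul] at h1
    linarith
  have := discrim_le_zero h
  unfold discrim at this
  linarith

lemma sq_integral_le (hf : BddMeas f) (ν : Measure α) [IsProbabilityMeasure ν] :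
    (∫ a, f a ∂ν) ^ 2 ≤ ∫ a, f a ^ 2 ∂ν := by
  have := sq_integral_mul_le hf (const 1) ν
  simpa using this

end BddMeas

/-- Integration over five independent copies, with the middle one outermost. -/
lemma integral_pi_five (ν : Measure α) [IsProbabilityMeasure ν] {f : (Fin 5 → α) → ℝ}
    (hf : BddMeas f) :
    ∫ z, f z ∂(Measure.pi fun _ => ν)
      = ∫ r, ∫ a, ∫ b, ∫ c, ∫ d, f ![a, b, r, c, d] ∂ν ∂ν ∂ν ∂ν ∂ν := by
  obtain ⟨M, hM⟩ := hf.bdd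
  have hm : ∀ {n : ℕ} (i : Fin (n + 1)) (s : α),
      Measurable fun zs : Fin n → α => (i.insertNth s zs : Fin (n + 1) → α) := fun i s =>
    (measurable_insertNth i).comp measurable_prodMk_left
  -- Index `2` is the common vertex of all angles, so it is extracted first; afterwards the lowest
  -- remaining index is extracted each time.
  rw [integral_pi_insertNth ν 2 hf.meas hM]
  congr 1; ext r
  rw [integral_pi_insertNth ν 0 (f := fun zs : Fin 4 → α => f (Fin.insertNth 2 r zs))
    (hf.meas.comp (hm 2 r)) fun _ => hM _]
  congr 1; ext a
  rw [integral_pi_insertNth ν 0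
    (f := fun zs : Fin 3 → α => f (Fin.insertNth 2 r (Fin.insertNth 0 a zs)))
    (hf.meas.comp ((hm 2 r).comp (hm 0 a))) fun _ => hM _]
  congr 1; ext b
  rw [integral_pi_insertNth ν 0
    (f := fun zs : Fin 2 → α => f (Fin.insertNth 2 r (Fin.insertNth 0 a (Fin.insertNth 0 b zs))))
    (hf.meas.comp ((hm 2 r).comp ((hm 0 a).comp (hm 0 b)))) fun _ => hM _]
  congr 1; ext c
  rw [integral_pi_insertNth ν 0
    (f := fun zs : Fin 1 → α => f (Fin.insertNth 2 r (Fin.insertNth 0 a (Fin.insertNth 0 b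
      (Fin.insertNth 0 c zs)))))
    (hf.meas.comp ((hm 2 r).comp ((hm 0 a).comp ((hm 0 b).comp (hm 0 c))))) fun _ => hM _]
  congr 1; ext d
  rw [integral_unique]
  simp only [probReal_univ, one_smul]
  congr 1
  funext i
  fin_cases i <;> rfl

end BoundedMeasurable

/-! ### Doubly centred kernels. -/

section DoubleCentering

variable {S : Type*} [MeasurableSpace S]

/-- The second moment of a doubly centred symmetric kernel. -/
def centredSq (ν : Measure S) (K : S × S → ℝ) : ℝ :=
  ∫ a, ∫ c, K (a, c) ^ 2 ∂ν ∂ν + (∫ a, ∫ c, K (a, c) ∂ν ∂ν) ^ 2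
    - 2 * ∫ c, (∫ a, K (a, c) ∂ν) ^ 2 ∂ν

lemma integral_iterated_const_mul (ν : Measure S) (t : ℝ) (F : S × S → ℝ) :
    ∫ a, ∫ c, t * F (a, c) ∂ν ∂ν = t * ∫ a, ∫ c, F (a, c) ∂ν ∂ν := by
  simp_rw [integral_const_mul]

variable (ν : Measure S) [IsProbabilityMeasure ν] {K : S × S → ℝ}

lemma integral_iterated_add {F G : S × S → ℝ} (hF : BddMeas F) (hG : BddMeas G) :
    ∫ a, ∫ c, (F (a, c) + G (a, c)) ∂ν ∂ν
      = ∫ a, ∫ c, F (a, c) ∂ν ∂ν + ∫ a, ∫ c, G (a, c) ∂ν ∂ν := by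
  rw [← integral_add ((hF.integral_right ν).integrable ν) ((hG.integral_right ν).integrable ν)]
  congr 1; ext a
  exact integral_add ((hF.comp measurable_prodMk_left).integrable ν)
    ((hG.comp measurable_prodMk_left).integrable ν)

/-- Double centring kills constants. This permits replacing an angle by its difference from `π / 2`,
which vanishes when one side is degenerate. -/
lemma centredSq_add_const (hK : BddMeas K) (t : ℝ) :
    centredSq ν (fun w => K w + t) = centredSq ν K := by
  have hswap : ∫ c, ∫ a, K (a, c) ∂ν ∂ν = ∫ a, ∫ c, K (a, c) ∂ν ∂ν :=
    (hK.integral_swap ν ν).symm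
  have hKs : BddMeas fun w : S × S => K (w.2, w.1) := hK.comp measurable_swap
  have hm : BddMeas fun c => ∫ a, K (a, c) ∂ν := hKs.integral_right ν
  have h1 : ∀ w : S × S, (K w + t) ^ 2 = (K w ^ 2 + 2 * t * K w) + t ^ 2 := fun w => by ring
  have h2 : ∀ c, ∫ a, (K (a, c) + t) ∂ν = ∫ a, K (a, c) ∂ν + t := fun c => by
    rw [integral_add ((hKs.comp measurable_prodMk_left).integrable ν) (integrable_const _)]; simp
  have h3 : ∀ c, (∫ a, K (a, c) ∂ν + t) ^ 2
      = ((∫ a, K (a, c) ∂ν) ^ 2 + 2 * t * ∫ a, K (a, c) ∂ν) + t ^ 2 := fun c => by ring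
  unfold centredSq
  simp_rw [h1, h2, h3]
  rw [integral_iterated_add ν (F := fun w => K w ^ 2 + 2 * t * K w) (G := fun _ => t ^ 2)
      (hK.sq.add (hK.const_mul _)) (BddMeas.const _),
    integral_iterated_add ν (F := fun w => K w ^ 2) (G := fun w => 2 * t * K w)
      hK.sq (hK.const_mul _), integral_iterated_const_mul,
    integral_iterated_add ν (F := K) (G := fun _ => t) hK (BddMeas.const _),
    integral_add ((hm.sq.add (hm.const_mul _)).integrable ν) (integrable_const _),
    integral_add (hm.sq.integrable ν) ((hm.const_mul _).integrable ν), integral_const_mul, hswap]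
  simp
  ring

lemma centredSq_le (hK : BddMeas K) :
    centredSq ν K ≤ ∫ a, ∫ c, K (a, c) ^ 2 ∂ν ∂ν := by
  have hKs : BddMeas fun w : S × S => K (w.2, w.1) := hK.comp measurable_swap
  have hm : BddMeas fun c => ∫ a, K (a, c) ∂ν := hKs.integral_right ν
  have h := hm.sq_integral_le ν
  rw [← hK.integral_swap ν ν] at h
  have h0 : 0 ≤ ∫ c, (∫ a, K (a, c) ∂ν) ^ 2 ∂ν := integral_nonneg fun _ => sq_nonneg _
  unfold centredSq
  linarith

/-- Double centring projects away the functions of one variable. Writing the quantity as a genuine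
square exhibits its nonnegativity and prepares Cauchy–Schwarz. -/
lemma centredSq_eq (hK : BddMeas K) (hsymm : ∀ a c, K (a, c) = K (c, a)) :
    centredSq ν K = ∫ a, ∫ c, (K (a, c) - ∫ c', K (a, c') ∂ν - ∫ c', K (c, c') ∂ν
      + ∫ a', ∫ c', K (a', c') ∂ν ∂ν) ^ 2 ∂ν ∂ν := by
  set m : S → ℝ := fun a => ∫ c, K (a, c) ∂ν with hm
  set T : ℝ := ∫ a, m a ∂ν with hT
  have hmb : BddMeas m := hK.integral_right ν
  have hm1 : BddMeas fun w : S × S => m w.1 := hmb.comp measurable_fst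
  have hm2 : BddMeas fun w : S × S => m w.2 := hmb.comp measurable_snd
  set Kc : S × S → ℝ := fun w => K w - m w.1 - m w.2 + T with hKc
  have hKcb : BddMeas Kc := ((hK.sub hm1).sub hm2).add (BddMeas.const _)
  have hcol : ∀ c, ∫ a, K (a, c) ∂ν = m c := fun c => by
    simp only [hm]; congr 1; ext a; exact hsymm a c
  have e1 : ∫ a, ∫ c, Kc (a, c) ^ 2 ∂ν ∂ν = centredSq ν K := by
    have h1 : ∀ a, ∫ c, Kc (a, c) ^ 2 ∂ν = ∫ c, K (a, c) ^ 2 ∂ν - 2 * ∫ c, K (a, c) * m c ∂ν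
        + (∫ c, m c ^ 2 ∂ν - m a ^ 2 + 2 * T * m a - T ^ 2) := by
      intro a
      have h2 : ∀ c, Kc (a, c) ^ 2 = (((K (a, c) ^ 2 - 2 * (K (a, c) * m c))
          + (2 * (T - m a)) * K (a, c)) + m c ^ 2 + (-2 * (T - m a)) * m c) + (T - m a) ^ 2 :=
        fun c => by simp only [hKc]; ring
      have hKa : BddMeas fun c => K (a, c) := hK.comp measurable_prodMk_left
      simp_rw [h2]
      have b1 := hKa.sq
      have b2 := (hKa.mul hmb).const_mul 2
      have b3 := hKa.const_mul (2 * (T - m a))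
      have b4 := hmb.sq
      have b5 := hmb.const_mul (-2 * (T - m a))
      rw [integral_add (((((b1.sub b2).add b3).add b4).add b5).integrable ν) (integrable_const _),
        integral_add ((((b1.sub b2).add b3).add b4).integrable ν) (b5.integrable ν),
        integral_add (((b1.sub b2).add b3).integrable ν) (b4.integrable ν),
        integral_add ((b1.sub b2).integrable ν) (b3.integrable ν),
        integral_sub (b1.integrable ν) (b2.integrable ν), integral_const_mul, integral_const_mul,
        integral_const_mul]
      simp only [integral_const, probReal_univ, one_smul]
      rw [show ∫ c, K (a, c) ∂ν = m a from rfl, ← hT]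
      ring
    simp_rw [h1]
    have c1 : BddMeas fun a => ∫ c, K (a, c) ^ 2 ∂ν := hK.sq.integral_right ν
    have c2 : BddMeas fun a => ∫ c, K (a, c) * m c ∂ν :=
      BddMeas.integral_right (F := fun w => K w * m w.2) (hK.mul hm2) ν
    have c3 : BddMeas fun a => ∫ c, m c ^ 2 ∂ν - m a ^ 2 + 2 * T * m a - T ^ 2 :=
      (((BddMeas.const _).sub hmb.sq).add (hmb.const_mul _)).sub (BddMeas.const _)
    rw [integral_add ((c1.sub (c2.const_mul 2)).integrable ν) (c3.integrable ν),
      integral_sub (c1.integrable ν) ((c2.const_mul 2).integrable ν), integral_const_mul,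
      BddMeas.integral_swap (F := fun w => K w * m w.2) (hK.mul hm2) ν ν]
    simp only [integral_mul_const, hcol]
    rw [integral_sub (((BddMeas.const _).sub hmb.sq |>.add (hmb.const_mul _)).integrable ν)
        (integrable_const _),
      integral_add (((BddMeas.const _).sub hmb.sq).integrable ν) ((hmb.const_mul _).integrable ν),
      integral_sub (integrable_const _) (hmb.sq.integrable ν), integral_const_mul]
    simp only [integral_const, probReal_univ, one_smul, centredSq, hcol]
    rw [← hT]
    simp_rw [← pow_two]
    ring
  exact e1.symm

lemma centredSq_nonneg (hK : BddMeas K) (hsymm : ∀ a c, K (a, c) = K (c, a)) :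
    0 ≤ centredSq ν K := by
  rw [centredSq_eq ν hK hsymm]
  exact integral_nonneg fun _ => integral_nonneg fun _ => sq_nonneg _

/-- Testing a doubly centred symmetric kernel against a centred product function. -/
lemma sq_integral_kernel_le (hK : BddMeas K) (hsymm : ∀ a c, K (a, c) = K (c, a)) {g : S → ℝ}
    (hg : BddMeas g) (hg0 : ∫ a, g a ∂ν = 0) :
    (∫ a, ∫ c, K (a, c) * (g a * g c) ∂ν ∂ν) ^ 2 ≤ centredSq ν K * (∫ a, g a ^ 2 ∂ν) ^ 2 := by
  set m : S → ℝ := fun a => ∫ c, K (a, c) ∂ν with hm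
  set T : ℝ := ∫ a, m a ∂ν with hT
  have hmb : BddMeas m := hK.integral_right ν
  have hm1 : BddMeas fun w : S × S => m w.1 := hmb.comp measurable_fst
  have hm2 : BddMeas fun w : S × S => m w.2 := hmb.comp measurable_snd
  have hg1 : BddMeas fun w : S × S => g w.1 := hg.comp measurable_fst
  have hg2 : BddMeas fun w : S × S => g w.2 := hg.comp measurable_snd
  set Kc : S × S → ℝ := fun w => K w - m w.1 - m w.2 + T with hKc
  have hKcb : BddMeas Kc := ((hK.sub hm1).sub hm2).add (BddMeas.const _)
  have e1 : ∫ a, ∫ c, Kc (a, c) ^ 2 ∂ν ∂ν = centredSq ν K := (centredSq_eq ν hK hsymm).symm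
  -- Terms of the centred kernel that depend on one variable only integrate to zero against `g ⊗ g`,
  -- because `g` has mean zero.
  have e2 : ∫ a, ∫ c, Kc (a, c) * (g a * g c) ∂ν ∂ν
      = ∫ a, ∫ c, K (a, c) * (g a * g c) ∂ν ∂ν := by
    have h1 : ∀ a, ∫ c, Kc (a, c) * (g a * g c) ∂ν
        = ∫ c, K (a, c) * (g a * g c) ∂ν - g a * ∫ c, m c * g c ∂ν := by
      intro a
      have h2 : ∀ c, Kc (a, c) * (g a * g c) = (K (a, c) * (g a * g c) - g a * (m c * g c))
          + ((T - m a) * g a) * g c := fun c => by simp only [hKc]; ring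
      have hKa : BddMeas fun c => K (a, c) := hK.comp measurable_prodMk_left
      simp_rw [h2]
      have b1 := hKa.mul (hg.const_mul (g a))
      have b2 := (hmb.mul hg).const_mul (g a)
      have b3 := hg.const_mul ((T - m a) * g a)
      rw [integral_add ((b1.sub b2).integrable ν) (b3.integrable ν),
        integral_sub (b1.integrable ν) (b2.integrable ν), integral_const_mul, integral_const_mul,
        hg0]
      ring
    simp_rw [h1]
    have b1 : BddMeas fun a => ∫ c, K (a, c) * (g a * g c) ∂ν :=
      BddMeas.integral_right (F := fun w => K w * (g w.1 * g w.2)) (hK.mul (hg1.mul hg2)) ν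
    rw [integral_sub (b1.integrable ν)
      ((hg.mul (BddMeas.const _)).integrable ν), integral_mul_const, hg0]
    ring
  have e3 := (hKcb).sq_integral_mul_le (hg1.mul hg2) (ν.prod ν)
  rw [integral_prod _ ((hKcb.mul (hg1.mul hg2)).integrable _),
    integral_prod _ (hKcb.sq.integrable _), integral_prod _ ((hg1.mul hg2).sq.integrable _)] at e3
  rw [← e2, ← e1]
  refine e3.trans (le_of_eq ?_)
  congr 1
  simp only [mul_pow, integral_const_mul, integral_mul_const]
  ring

end DoubleCentering

section

open InnerProductGeometry (angle)

/-! ### Directions seen from the vertices of a triangle. -/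

section UnitVectors

variable {E : Type*} [NormedAddCommGroup E] [InnerProductSpace ℝ E]

/-- The unit vector from `r` towards `a`, zero if `a = r`. -/
def unitVec (r a : E) : E := ‖a - r‖⁻¹ • (a - r)

lemma abs_angle_le (u v : E) : |angle u v| ≤ Real.pi := by
  rw [abs_of_nonneg (InnerProductGeometry.angle_nonneg _ _)]
  exact InnerProductGeometry.angle_le_pi _ _

lemma norm_unitVec_le (r a : E) : ‖unitVec r a‖ ≤ 1 := by
  unfold unitVec
  rw [norm_smul, norm_inv, norm_norm]
  exact inv_mul_le_one

lemma norm_unitVec {r a : E} (h : a ≠ r) : ‖unitVec r a‖ = 1 := by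
  unfold unitVec
  rw [norm_smul, norm_inv, norm_norm, inv_mul_cancel₀ (norm_ne_zero_iff.2 (sub_ne_zero.2 h))]

@[simp]
lemma unitVec_self (r : E) : unitVec r r = 0 := by simp [unitVec]

/-- Seen from the vertices of a triangle, the two other vertices cannot all be in nearly the same
direction. -/
lemma one_le_sum_norm_unitVec_sub {r a : E} (c : E) (h : a ≠ r) :
    1 ≤ ‖unitVec r a - unitVec r c‖ ^ 2 + ‖unitVec a r - unitVec a c‖ ^ 2
      + ‖unitVec c r - unitVec c a‖ ^ 2 := by
  rcases eq_or_ne c r with rfl | hcr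
  · have : ‖unitVec c a‖ = 1 := norm_unitVec h
    simp only [unitVec_self, sub_zero, zero_sub, norm_neg, this]
    nlinarith [sq_nonneg ‖unitVec a c - unitVec a c‖]
  rcases eq_or_ne c a with rfl | hca
  · have : ‖unitVec c r‖ = 1 := norm_unitVec h.symm
    simp only [unitVec_self, sub_zero, this]
    nlinarith [sq_nonneg ‖unitVec r c - unitVec r c‖]
  have key : ∀ x y z : E, y ≠ x → z ≠ x →
      ‖unitVec x y - unitVec x z‖ ^ 2 = 2 - 2 * Real.cos (EuclideanGeometry.angle y x z) := by
    intro x y z hy hz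
    rw [norm_sub_sq_real, norm_unitVec hy, norm_unitVec hz, EuclideanGeometry.angle, vsub_eq_sub,
      vsub_eq_sub, InnerProductGeometry.cos_angle, unitVec, unitVec, inner_smul_left,
      inner_smul_right]
    simp only [conj_trivial]
    have := norm_ne_zero_iff.2 (sub_ne_zero.2 hy)
    have := norm_ne_zero_iff.2 (sub_ne_zero.2 hz)
    field_simp
    ring
  have hle : ∀ x y z : E, Real.cos (EuclideanGeometry.angle y x z) ≤ 1 := fun _ _ _ =>
    Real.cos_le_one _
  have hcos : ∀ x y z : E, Real.pi / 3 ≤ EuclideanGeometry.angle y x z →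
      Real.cos (EuclideanGeometry.angle y x z) ≤ 1 / 2 := by
    intro x y z hxyz
    rw [← Real.cos_pi_div_three]
    exact Real.cos_le_cos_of_nonneg_of_le_pi (by positivity) (EuclideanGeometry.angle_le_pi _ _ _)
      hxyz
  have hsum := EuclideanGeometry.angle_add_angle_add_angle_eq_pi c h
  rw [key r a c h hcr, key a r c h.symm hca, key c r a hcr.symm hca.symm]
  rw [EuclideanGeometry.angle_comm c r a] at hsum
  -- The angles sum to `π`, so one of them is at least `π / 3`; its squared chord `2 - 2 cos` is
  -- then at least one.
  by_contra hlt
  push Not at hlt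
  have h1 := hle r a c
  have h2 := hle a r c
  have h3 := hle c r a
  have k1 := hcos r a c
  have k2 := hcos a r c
  have k3 := hcos c r a
  rcases le_or_gt (Real.pi / 3) (EuclideanGeometry.angle a r c) with g1 | g1
  · linarith [k1 g1]
  rcases le_or_gt (Real.pi / 3) (EuclideanGeometry.angle r a c) with g2 | g2
  · linarith [k2 g2]
  rcases le_or_gt (Real.pi / 3) (EuclideanGeometry.angle r c a) with g3 | g3
  · linarith [k3 g3]
  have hcc := EuclideanGeometry.angle_comm a c r
  linarith

end UnitVectors

/-! ### Measurability and boundedness of the geometric kernels. -/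

section Kernels

variable {E : Type*} [NormedAddCommGroup E] [InnerProductSpace ℝ E] [FiniteDimensional ℝ E]
  [MeasurableSpace E] [BorelSpace E] {α : Type*} [MeasurableSpace α]

@[fun_prop]
lemma measurable_angle_comp {f g : α → E} (hf : Measurable f) (hg : Measurable g) :
    Measurable fun x => angle (f x) (g x) := by
  unfold InnerProductGeometry.angle
  exact Real.continuous_arccos.measurable.comp (by fun_prop)

@[fun_prop]
lemma measurable_halfInd_comp {f g : α → E} (hf : Measurable f) (hg : Measurable g) :
    Measurable fun x => halfInd (f x) (g x) :=
  measurable_halfInd.comp (hf.prodMk hg)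

@[fun_prop]
lemma measurable_sgnInner_comp {f g : α → E} (hf : Measurable f) (hg : Measurable g) :
    Measurable fun x => sgnInner (f x) (g x) :=
  measurable_sgnInner.comp (hf.prodMk hg)

lemma bddMeas_angle {f g : α → E} (hf : Measurable f) (hg : Measurable g) :
    BddMeas fun x => angle (f x) (g x) :=
  ⟨by fun_prop, Real.pi, fun _ => abs_angle_le _ _⟩

lemma bddMeas_halfInd {f g : α → E} (hf : Measurable f) (hg : Measurable g) :
    BddMeas fun x => halfInd (f x) (g x) :=
  ⟨by fun_prop, 1, fun _ => by
    rw [abs_of_nonneg (halfInd_nonneg _ _)]; exact halfInd_le_one _ _⟩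

lemma bddMeas_sgnInner {f g : α → E} (hf : Measurable f) (hg : Measurable g) :
    BddMeas fun x => sgnInner (f x) (g x) :=
  ⟨by fun_prop, 1, fun _ => abs_sgnInner_le _ _⟩

@[fun_prop]
lemma measurable_unitVec_comp {f g : α → E} (hf : Measurable f) (hg : Measurable g) :
    Measurable fun x => unitVec (f x) (g x) := by
  unfold unitVec
  fun_prop

lemma bddMeas_inner_unitVec (e : E) {f g : α → E} (hf : Measurable f) (hg : Measurable g) :
    BddMeas fun x => inner ℝ e (unitVec (f x) (g x)) :=
  ⟨by fun_prop, ‖e‖, fun _ => (abs_real_inner_le_norm _ _).trans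
    (mul_le_of_le_one_right (norm_nonneg _) (norm_unitVec_le _ _))⟩

lemma bddMeas_norm_unitVec_sub {f g h : α → E} (hf : Measurable f) (hg : Measurable g)
    (hh : Measurable h) : BddMeas fun x => ‖unitVec (f x) (g x) - unitVec (f x) (h x)‖ ^ 2 := by
  refine BddMeas.sq (f := fun x => ‖unitVec (f x) (g x) - unitVec (f x) (h x)‖)
    ⟨by fun_prop, 1 + 1, fun x => ?_⟩
  rw [abs_norm]
  exact (norm_sub_le _ _).trans (add_le_add (norm_unitVec_le _ _) (norm_unitVec_le _ _))

end Kernels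

/-! ### Two-sided bounds for the projection variance. -/

section ProjectionVariance

/-- The probability that two independent copies are distinct. -/
def distinctProb {S : Type*} [MeasurableSpace S] (ρ : Measure S) : ℝ :=
  (ρ.prod ρ).real {w | w.1 ≠ w.2}

lemma distinctProb_nonneg {S : Type*} [MeasurableSpace S] (ρ : Measure S) : 0 ≤ distinctProb ρ := measureReal_nonneg

variable {E : Type*} [NormedAddCommGroup E] [InnerProductSpace ℝ E] [FiniteDimensional ℝ E]
  [MeasurableSpace E] [BorelSpace E]

/-- With the common vertex `r` fixed, the other four copies are independent: the three expectations
become the second moment, the squared mean and the squared column mean of the angle kernel at `r`.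
-/
lemma pcovSqArccos_diag (ρ : Measure E) [IsProbabilityMeasure ρ] :
    pcovSqArccos (ρ.map fun x => (x, x))
      = ∫ r, centredSq ρ (fun w => angle (w.1 - r) (w.2 - r)) ∂ρ := by
  have hd : Measurable fun x : E => (x, x) := by fun_prop
  have hpi : (Measure.pi fun _ : Fin 5 => ρ.map fun x => (x, x))
      = (Measure.pi fun _ : Fin 5 => ρ).map fun z i => (z i, z i) := by
    have : IsProbabilityMeasure (ρ.map fun x => (x, x)) :=
      Measure.isProbabilityMeasure_map hd.aemeasurable
    rw [Measure.pi_map_pi (μ := fun _ : Fin 5 => ρ) (f := fun _ x => (x, x))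
      fun _ => hd.aemeasurable]
  have hA : ∀ i j k : Fin 5, BddMeas fun z : Fin 5 → E => angle (z i - z k) (z j - z k) :=
    fun i j k => bddMeas_angle (by fun_prop) (by fun_prop)
  unfold pcovSqArccos
  rw [hpi]
  rw [integral_map (by fun_prop) (by fun_prop), integral_map (by fun_prop) (by fun_prop),
    integral_map (by fun_prop) (by fun_prop)]
  simp only
  rw [integral_pi_five ρ ((hA 0 3 2).mul (hA 0 3 2)), integral_pi_five ρ ((hA 0 3 2).mul (hA 1 4 2)),
    integral_pi_five ρ ((hA 0 3 2).mul (hA 1 3 2))]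
  simp only [Matrix.cons_val, integral_const_mul, integral_mul_const, integral_const,
    probReal_univ, one_smul]
  have hK : ∀ r : E, BddMeas fun w : E × E => angle (w.1 - r) (w.2 - r) := fun r =>
    bddMeas_angle (by fun_prop) (by fun_prop)
  have h3 : ∀ r : E, ∫ a, ∫ b, ∫ c, angle (a - r) (c - r) * angle (b - r) (c - r) ∂ρ ∂ρ ∂ρ
      = ∫ c, (∫ a, angle (a - r) (c - r) ∂ρ) ^ 2 ∂ρ := by
    intro r
    have h4 : ∀ a, ∫ b, ∫ c, angle (a - r) (c - r) * angle (b - r) (c - r) ∂ρ ∂ρ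
        = ∫ c, angle (a - r) (c - r) * ∫ b, angle (b - r) (c - r) ∂ρ ∂ρ := by
      intro a
      rw [BddMeas.integral_swap (F := fun w : E × E =>
        angle (a - r) (w.2 - r) * angle (w.1 - r) (w.2 - r))
        ((bddMeas_angle (by fun_prop) (by fun_prop)).mul (hK r))]
      simp only [integral_const_mul]
    simp only [h4]
    have hm : BddMeas fun c => ∫ b, angle (b - r) (c - r) ∂ρ :=
      BddMeas.integral_right (F := fun w : E × E => angle (w.2 - r) (w.1 - r))
        (bddMeas_angle (by fun_prop) (by fun_prop)) ρ
    rw [BddMeas.integral_swap (F := fun w : E × E =>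
        angle (w.1 - r) (w.2 - r) * ∫ b, angle (b - r) (w.2 - r) ∂ρ)
        ((hK r).mul (hm.comp measurable_snd))]
    simp only [integral_mul_const, pow_two]
  simp only [h3]
  unfold centredSq
  have b0 : BddMeas fun v : (E × E) × E => angle (v.1.2 - v.1.1) (v.2 - v.1.1) :=
    bddMeas_angle (by fun_prop) (by fun_prop)
  have b1 : BddMeas fun r => ∫ a, ∫ c, angle (a - r) (c - r) ^ 2 ∂ρ ∂ρ :=
    BddMeas.integral_right (F := fun w : E × E => ∫ c, angle (w.2 - w.1) (c - w.1) ^ 2 ∂ρ)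
      (BddMeas.integral_right (F := fun v : (E × E) × E =>
        angle (v.1.2 - v.1.1) (v.2 - v.1.1) ^ 2) b0.sq ρ) ρ
  have b2 : BddMeas fun r => ∫ a, ∫ c, angle (a - r) (c - r) ∂ρ ∂ρ :=
    BddMeas.integral_right (F := fun w : E × E => ∫ c, angle (w.2 - w.1) (c - w.1) ∂ρ)
      (b0.integral_right ρ) ρ
  have b3 : BddMeas fun r => ∫ c, (∫ a, angle (a - r) (c - r) ∂ρ) ^ 2 ∂ρ :=
    BddMeas.integral_right (F := fun w : E × E => (∫ a, angle (a - w.1) (w.2 - w.1) ∂ρ) ^ 2)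
      (BddMeas.sq (BddMeas.integral_right (F := fun v : (E × E) × E =>
        angle (v.2 - v.1.1) (v.1.2 - v.1.1)) (bddMeas_angle (by fun_prop) (by fun_prop)) ρ)) ρ
  rw [integral_sub ((b1.add b2.sq).integrable ρ) ((b3.const_mul 2).integrable ρ),
    integral_add (b1.integrable ρ) (b2.sq.integrable ρ), integral_const_mul]
  simp only [← pow_two]

lemma measurableSet_ne : MeasurableSet {w : E × E | w.1 ≠ w.2} :=
  (measurableSet_eq_fun measurable_fst measurable_snd).compl

open Classical in
lemma bddMeas_ne : BddMeas fun w : E × E => if w.1 ≠ w.2 then (1 : ℝ) else 0 :=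
  ⟨Measurable.ite measurableSet_ne measurable_const measurable_const, 1, fun w => by
    split_ifs <;> simp⟩

open Classical in
lemma distinctProb_eq (ρ : Measure E) [IsProbabilityMeasure ρ] :
    distinctProb ρ = ∫ r, ∫ a, (if r ≠ a then (1 : ℝ) else 0) ∂ρ ∂ρ := by
  rw [distinctProb, ← integral_indicator_one measurableSet_ne,
    ← integral_prod (f := fun w : E × E => if w.1 ≠ w.2 then (1 : ℝ) else 0)
      (bddMeas_ne.integrable _)]
  congr 1
  ext w
  by_cases h : w.1 = w.2 <;> simp [h]

lemma distinctProb_of_atomless (ρ : Measure E) [IsProbabilityMeasure ρ] (h : ∀ v, ρ {v} = 0) :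
    distinctProb ρ = 1 := by
  have : (ρ.prod ρ) {w : E × E | w.1 ≠ w.2}ᶜ = 0 := by
    rw [Measure.measure_prod_null measurableSet_ne.compl]
    refine Filter.Eventually.of_forall fun a => ?_
    have : Prod.mk a ⁻¹' {w : E × E | w.1 ≠ w.2}ᶜ = {a} := by
      ext b; simp [eq_comm]
    simp [this, h]
  rw [distinctProb, measureReal_def, (prob_compl_eq_zero_iff measurableSet_ne).1 this]
  simp

/-- Distinct images have distinct preimages. Applied to a coordinate map, this lets one
nondegenerate coordinate vouch for the whole response. -/
lemma distinctProb_map_le {S F : Type*} [MeasurableSpace S]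
    [NormedAddCommGroup F] [InnerProductSpace ℝ F]
    [FiniteDimensional ℝ F] [MeasurableSpace F] [BorelSpace F] (ρ : Measure S)
    [IsProbabilityMeasure ρ] {φ : S → F} (hφ : Measurable φ) :
    distinctProb (ρ.map φ) ≤ distinctProb ρ := by
  unfold distinctProb
  rw [Measure.map_prod_map _ _ hφ hφ, measureReal_def, measureReal_def,
    Measure.map_apply (hφ.prodMap hφ) measurableSet_ne]
  refine ENNReal.toReal_mono (measure_ne_top _ _) (measure_mono ?_)
  rintro w hw hh
  exact hw (congrArg φ hh)

lemma bddMeas_angle_sub (r : E) : BddMeas fun w : E × E => angle (w.1 - r) (w.2 - r) :=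
  bddMeas_angle (by fun_prop) (by fun_prop)

lemma bddMeas_centredSq_angle (ρ : Measure E) [IsProbabilityMeasure ρ] :
    BddMeas fun r => centredSq ρ (fun w => angle (w.1 - r) (w.2 - r)) := by
  unfold centredSq
  have b0 : BddMeas fun v : (E × E) × E => angle (v.1.2 - v.1.1) (v.2 - v.1.1) :=
    bddMeas_angle (by fun_prop) (by fun_prop)
  have b1 : BddMeas fun r => ∫ a, ∫ c, angle (a - r) (c - r) ^ 2 ∂ρ ∂ρ :=
    BddMeas.integral_right (F := fun w : E × E => ∫ c, angle (w.2 - w.1) (c - w.1) ^ 2 ∂ρ)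
      (BddMeas.integral_right (F := fun v : (E × E) × E =>
        angle (v.1.2 - v.1.1) (v.2 - v.1.1) ^ 2) b0.sq ρ) ρ
  have b2 : BddMeas fun r => ∫ a, ∫ c, angle (a - r) (c - r) ∂ρ ∂ρ :=
    BddMeas.integral_right (F := fun w : E × E => ∫ c, angle (w.2 - w.1) (c - w.1) ∂ρ)
      (b0.integral_right ρ) ρ
  have b3 : BddMeas fun r => ∫ c, (∫ a, angle (a - r) (c - r) ∂ρ) ^ 2 ∂ρ :=
    BddMeas.integral_right (F := fun w : E × E => (∫ a, angle (a - w.1) (w.2 - w.1) ∂ρ) ^ 2)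
      (BddMeas.sq (BddMeas.integral_right (F := fun v : (E × E) × E =>
        angle (v.2 - v.1.1) (v.1.2 - v.1.1)) (bddMeas_angle (by fun_prop) (by fun_prop)) ρ)) ρ
  exact (b1.add b2.sq).sub (b3.const_mul 2)

open Classical in
-- After subtracting `π / 2` the kernel vanishes at `a = r`, the angle with the zero vector being `π
-- / 2`, and is at most `π / 2` in absolute value elsewhere.
lemma centredSq_angle_le (ρ : Measure E) [IsProbabilityMeasure ρ] (r : E) :
    centredSq ρ (fun w => angle (w.1 - r) (w.2 - r))
      ≤ Real.pi ^ 2 / 4 * ∫ a, (if r ≠ a then (1 : ℝ) else 0) ∂ρ := by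
  have h1 := centredSq_add_const ρ (bddMeas_angle_sub r) (-(Real.pi / 2))
  have hK : BddMeas fun w : E × E => angle (w.1 - r) (w.2 - r) + -(Real.pi / 2) :=
    (bddMeas_angle_sub r).add (BddMeas.const _)
  rw [← h1]
  refine (centredSq_le ρ hK).trans ?_
  rw [← integral_const_mul]
  refine integral_mono ((hK.sq.integral_right ρ).integrable ρ)
    (((bddMeas_ne.comp measurable_prodMk_left).const_mul _).integrable ρ) fun a => ?_
  have h2 : ∀ c, (angle (a - r) (c - r) + -(Real.pi / 2)) ^ 2
      ≤ Real.pi ^ 2 / 4 * (if r ≠ a then (1 : ℝ) else 0) := by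
    intro c
    split_ifs with h
    · have h3 := InnerProductGeometry.angle_nonneg (a - r) (c - r)
      have h4 := InnerProductGeometry.angle_le_pi (a - r) (c - r)
      nlinarith
    · push Not at h
      simp [h]
  calc _ ≤ ∫ _c, Real.pi ^ 2 / 4 * (if r ≠ a then (1 : ℝ) else 0) ∂ρ :=
        integral_mono ((hK.sq.comp measurable_prodMk_left).integrable ρ) (integrable_const _) h2
    _ = _ := by simp

/-- The projection variance is controlled by the probability that two copies are distinct. -/
lemma pcovSqArccos_diag_le (ρ : Measure E) [IsProbabilityMeasure ρ] :
    pcovSqArccos (ρ.map fun x => (x, x)) ≤ Real.pi ^ 2 / 4 * distinctProb ρ := by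
  classical
  rw [pcovSqArccos_diag, distinctProb_eq, ← integral_const_mul]
  exact integral_mono ((bddMeas_centredSq_angle ρ).integrable ρ)
    (((bddMeas_ne.integral_right ρ).const_mul _).integrable ρ) fun r => centredSq_angle_le ρ r

lemma integral_sq_sub_eq {S : Type*} [MeasurableSpace S] (ρ : Measure S) [IsProbabilityMeasure ρ]
    {x : S → ℝ} (hx : BddMeas x) :
    ∫ a, (x a - ∫ b, x b ∂ρ) ^ 2 ∂ρ = (∫ a, ∫ c, (x a - x c) ^ 2 ∂ρ ∂ρ) / 2 := by
  set m := ∫ b, x b ∂ρ with hm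
  have h1 : ∀ a, ∫ c, (x a - x c) ^ 2 ∂ρ = x a ^ 2 - 2 * m * x a + ∫ c, x c ^ 2 ∂ρ := by
    intro a
    have : ∀ c, (x a - x c) ^ 2 = (x a ^ 2 - (2 * x a) * x c) + x c ^ 2 := fun c => by ring
    simp_rw [this]
    rw [integral_add (((BddMeas.const _).sub (hx.const_mul _)).integrable ρ) (hx.sq.integrable ρ),
      integral_sub (integrable_const _) ((hx.const_mul _).integrable ρ), integral_const_mul, ← hm]
    simp
    ring
  have h2 : ∀ a, (x a - m) ^ 2 = (x a ^ 2 - 2 * m * x a) + m ^ 2 := fun a => by ring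
  simp_rw [h1, h2]
  rw [integral_add ((hx.sq.sub (hx.const_mul _)).integrable ρ) (integrable_const _),
    integral_add ((hx.sq.sub (hx.const_mul _)).integrable ρ) (integrable_const _),
    integral_sub (hx.sq.integrable ρ) ((hx.const_mul _).integrable ρ), integral_const_mul, ← hm]
  simp
  ring

/-- The centred angle kernel at `r` dominates the variance of each coordinate of the direction
seen from `r`. -/
lemma centredSq_angle_ge [Nontrivial E] (ρ : Measure E) [IsProbabilityMeasure ρ] (r : E) {c : ℝ}
    (hc : ∀ e u : E, ∫ α : Metric.sphere (0 : E) 1, inner ℝ (α : E) e * sgnInner u α ∂(dirMeasure E)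
        = c * inner ℝ e (‖u‖⁻¹ • u)) {e : E} (he : ‖e‖ = 1) :
    c ^ 4 / (64 * Real.pi ^ 2)
        * ((∫ a, ∫ b, (inner ℝ e (unitVec r a) - inner ℝ e (unitVec r b)) ^ 2 ∂ρ ∂ρ) / 2) ^ 2
      ≤ centredSq ρ (fun w => angle (w.1 - r) (w.2 - r)) := by
  set x : E → ℝ := fun a => inner ℝ e (unitVec r a) with hx
  have hxb : BddMeas x := bddMeas_inner_unitVec e measurable_const measurable_id
  set m := ∫ a, x a ∂ρ with hm
  set g : E → ℝ := fun a => x a - m with hg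
  have hgb : BddMeas g := hxb.sub (BddMeas.const _)
  have hg0 : ∫ a, g a ∂ρ = 0 := by
    simp only [hg]; rw [integral_sub (hxb.integrable ρ) (integrable_const _)]; simp [hm]
  change c ^ 4 / (64 * Real.pi ^ 2) * ((∫ a, ∫ b, (x a - x b) ^ 2 ∂ρ ∂ρ) / 2) ^ 2 ≤ _
  rw [← integral_sq_sub_eq ρ hxb]
  set V := ∫ a, g a ^ 2 ∂ρ with hV
  change c ^ 4 / (64 * Real.pi ^ 2) * V ^ 2 ≤ _
  have hV0 : 0 ≤ V := integral_nonneg fun _ => sq_nonneg _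
  have hgx : ∫ a, g a * x a ∂ρ = V := by
    have : ∀ a, g a * x a = g a ^ 2 + m * g a := fun a => by simp only [hg]; ring
    simp_rw [this]
    rw [integral_add (hgb.sq.integrable ρ) ((hgb.const_mul _).integrable ρ), integral_const_mul,
      hg0, mul_zero, add_zero]
  set D := centredSq ρ (fun w => angle (w.1 - r) (w.2 - r)) with hD
  have hsymm : ∀ a b : E, angle (a - r) (b - r) = angle (b - r) (a - r) := fun a b =>
    InnerProductGeometry.angle_comm _ _
  have hD0 : 0 ≤ D := centredSq_nonneg ρ (bddMeas_angle_sub r) hsymm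
  have htest := sq_integral_kernel_le ρ (bddMeas_angle_sub r) hsymm hgb hg0
  simp only [← hD, ← hV] at htest
  set s : E × Metric.sphere (0 : E) 1 → ℝ := fun w => sgnInner (w.1 - r) w.2 * g w.1 with hs
  have hsb : BddMeas s := (bddMeas_sgnInner (by fun_prop) (by fun_prop)).mul
    (hgb.comp measurable_fst)
  have hss : BddMeas fun w : Metric.sphere (0 : E) 1 × E => s (w.2, w.1) :=
    hsb.comp measurable_swap
  set G : Metric.sphere (0 : E) 1 → ℝ := fun α => ∫ a, s (a, α) ∂ρ with hG
  have hGb : BddMeas G := hss.integral_right ρ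
  -- Insert the sign representation of the angle. The constant `π / 2` drops out because `g` is
  -- centred, leaving minus a quarter of the squared norm of `G`.
  have hJ : ∫ a, ∫ b, angle (a - r) (b - r) * (g a * g b) ∂ρ ∂ρ
      = -(1 / 4) * ∫ α, G α ^ 2 ∂(dirMeasure E) := by
    have h1 : ∀ a b, angle (a - r) (b - r) * (g a * g b)
        = Real.pi / 2 * g a * g b + -(1 / 4) * ∫ α, s (a, α) * s (b, α) ∂(dirMeasure E) := by
      intro a b
      have h2 : ∀ α : Metric.sphere (0 : E) 1, s (a, α) * s (b, α)
          = (g a * g b) * (sgnInner (a - r) (α : E) * sgnInner (b - r) α) := fun α => by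
        simp only [hs]; ring
      simp_rw [h2]
      rw [integral_const_mul, integral_sgnInner_mul]
      ring
    have h3 : ∀ a, ∫ b, angle (a - r) (b - r) * (g a * g b) ∂ρ
        = -(1 / 4) * ∫ α, s (a, α) * G α ∂(dirMeasure E) := by
      intro a
      simp_rw [h1]
      have b1 : BddMeas fun v : E × Metric.sphere (0 : E) 1 => s (a, v.2) * s (v.1, v.2) :=
        (hsb.comp (by fun_prop : Measurable fun v : E × Metric.sphere (0 : E) 1 => (a, v.2))).mul
          hsb
      rw [integral_add ((hgb.const_mul _).integrable ρ)
        (((b1.integral_right (dirMeasure E)).const_mul _).integrable ρ), integral_const_mul,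
        integral_const_mul, hg0, b1.integral_swap ρ (dirMeasure E)]
      simp only [integral_const_mul, mul_zero, zero_add, hG]
    simp_rw [h3]
    rw [integral_const_mul, BddMeas.integral_swap (F := fun w => s w * G w.2)
      (hsb.mul (hGb.comp measurable_snd)) ρ (dirMeasure E)]
    simp only [integral_mul_const]
    congr 2; ext α
    rw [pow_two]
  have hin : BddMeas fun α : Metric.sphere (0 : E) 1 => inner ℝ (α : E) e :=
    ⟨by fun_prop, ‖e‖, fun α => abs_inner_sphere_le α e⟩
  -- The norm of `G` is bounded below by testing it against `α ↦ ⟪α, e⟫`, whose integral against the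
  -- sign field is known.
  have hcs := hin.sq_integral_mul_le hGb (dirMeasure E)
  have hfirst : ∫ α : Metric.sphere (0 : E) 1, inner ℝ (α : E) e * G α ∂(dirMeasure E)
      = c * V := by
    have h1 : ∀ α : Metric.sphere (0 : E) 1, inner ℝ (α : E) e * G α
        = ∫ a, g a * (inner ℝ (α : E) e * sgnInner (a - r) (α : E)) ∂ρ := by
      intro α
      simp only [hG]
      rw [← integral_const_mul]
      congr 1; ext a
      simp only [hs]; ring
    simp_rw [h1]
    rw [BddMeas.integral_swap (F := fun w : Metric.sphere (0 : E) 1 × E =>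
      g w.2 * (inner ℝ (w.1 : E) e * sgnInner (w.2 - r) (w.1 : E)))
      ((hgb.comp measurable_snd).mul ((hin.comp measurable_fst).mul
        (bddMeas_sgnInner (by fun_prop) (by fun_prop)))) (dirMeasure E) ρ]
    simp only [integral_const_mul, hc]
    rw [← hgx, ← integral_const_mul]
    congr 1; ext a
    simp only [hx, unitVec]; ring
  have hin2 : ∫ α : Metric.sphere (0 : E) 1, inner ℝ (α : E) e ^ 2 ∂(dirMeasure E)
      ≤ 2 * Real.pi := by
    calc _ ≤ ∫ _α : Metric.sphere (0 : E) 1, (1 : ℝ) ∂(dirMeasure E) := by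
          refine integral_mono (hin.sq.integrable _) (integrable_const _) fun α => ?_
          have := abs_inner_sphere_le α e
          rw [he] at this
          exact (sq_le_one_iff_abs_le_one _).2 this
      _ = _ := by simp [dirMeasure_univ]
  set Q := ∫ α, G α ^ 2 ∂(dirMeasure E) with hQ
  have hQ0 : 0 ≤ Q := integral_nonneg fun _ => sq_nonneg _
  rw [hfirst] at hcs
  have hcV : (c * V) ^ 2 ≤ 2 * Real.pi * Q := hcs.trans (mul_le_mul_of_nonneg_right hin2 hQ0)
  rw [hJ] at htest
  rcases hV0.eq_or_lt with h0 | hVpos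
  · rw [← h0]; simpa using hD0
  have hsq : ((c * V) ^ 2) ^ 2 ≤ (2 * Real.pi * Q) ^ 2 := pow_le_pow_left₀ (sq_nonneg _) hcV 2
  have hpi := Real.pi_pos
  rw [div_mul_eq_mul_div, div_le_iff₀ (by positivity)]
  -- Combine `(cV)² ≤ 2πQ` with `(Q/4)² ≤ D V²`.
  have hfin : (c ^ 4 * V ^ 2) * V ^ 2 ≤ (D * (64 * Real.pi ^ 2)) * V ^ 2 := by
    nlinarith [mul_le_mul_of_nonneg_left htest (by positivity : (0:ℝ) ≤ 64 * Real.pi ^ 2)]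
  exact le_of_mul_le_mul_right hfin (by positivity)

/-- Sum the coordinate bounds over an orthonormal basis. One factor of the dimension comes from
Cauchy–Schwarz on the sum, the other from using the same upper bound for every coordinate. -/
lemma centredSq_angle_ge_spread [Nontrivial E] (ρ : Measure E) [IsProbabilityMeasure ρ] (r : E)
    {c : ℝ}
    (hc : ∀ e u : E, ∫ α : Metric.sphere (0 : E) 1, inner ℝ (α : E) e * sgnInner u α ∂(dirMeasure E)
        = c * inner ℝ e (‖u‖⁻¹ • u)) :
    c ^ 4 / (64 * Real.pi ^ 2) / (Module.finrank ℝ E) ^ 2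
        * ((∫ a, ∫ b, ‖unitVec r a - unitVec r b‖ ^ 2 ∂ρ ∂ρ) / 2) ^ 2
      ≤ centredSq ρ (fun w => angle (w.1 - r) (w.2 - r)) := by
  set b := stdOrthonormalBasis ℝ E
  set V : Fin (Module.finrank ℝ E) → ℝ := fun i =>
    (∫ a, ∫ a', (inner ℝ (b i) (unitVec r a) - inner ℝ (b i) (unitVec r a')) ^ 2 ∂ρ ∂ρ) / 2 with hV
  set D := centredSq ρ (fun w => angle (w.1 - r) (w.2 - r))
  have hd : (0 : ℝ) < Module.finrank ℝ E := by exact_mod_cast Module.finrank_pos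
  have hb : ∀ i, BddMeas fun w : E × E =>
      (inner ℝ (b i) (unitVec r w.1) - inner ℝ (b i) (unitVec r w.2)) ^ 2 := fun i =>
    ((bddMeas_inner_unitVec _ (by fun_prop) (by fun_prop)).sub
      (bddMeas_inner_unitVec _ (by fun_prop) (by fun_prop))).sq
  have hsum : (∫ a, ∫ a', ‖unitVec r a - unitVec r a'‖ ^ 2 ∂ρ ∂ρ) / 2 = ∑ i, V i := by
    simp only [hV, ← Finset.sum_div]
    congr 1
    rw [← integral_finsetSum _ fun i _ => ((hb i).integral_right ρ).integrable ρ]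
    congr 1; ext a
    rw [← integral_finsetSum _ fun i _ => ((hb i).comp measurable_prodMk_left).integrable ρ]
    congr 1; ext a'
    rw [← b.sum_sq_inner_right]
    simp only [inner_sub_right]
  rw [hsum]
  set k := c ^ 4 / (64 * Real.pi ^ 2) with hk
  have hk0 : 0 ≤ k := by positivity
  have h1 : ∀ i, k * V i ^ 2 ≤ D := fun i => centredSq_angle_ge ρ r hc (b.norm_eq_one i)
  have h2 : (∑ i, V i) ^ 2 ≤ Module.finrank ℝ E * ∑ i, V i ^ 2 := by
    simpa using sq_sum_le_card_mul_sum_sq (s := Finset.univ) (f := V)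
  have h3 : k * ∑ i, V i ^ 2 ≤ Module.finrank ℝ E * D := by
    rw [Finset.mul_sum]
    simpa using Finset.sum_le_card_nsmul Finset.univ _ D fun i _ => h1 i
  rw [div_mul_eq_mul_div, div_le_iff₀ (by positivity)]
  calc k * (∑ i, V i) ^ 2 ≤ k * (Module.finrank ℝ E * ∑ i, V i ^ 2) := by gcongr
    _ = Module.finrank ℝ E * (k * ∑ i, V i ^ 2) := by ring
    _ ≤ Module.finrank ℝ E * (Module.finrank ℝ E * D) := by gcongr
    _ = _ := by ring

/-- On average over the vertex, the directions to two other points are spread out. -/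
lemma distinctProb_le_spread (ρ : Measure E) [IsProbabilityMeasure ρ] :
    distinctProb ρ ≤ 3 * ∫ r, ∫ a, ∫ b, ‖unitVec r a - unitVec r b‖ ^ 2 ∂ρ ∂ρ ∂ρ := by
  classical
  have hb : ∀ {f g h : (E × E) × E → E}, Measurable f → Measurable g → Measurable h →
      BddMeas fun v => ‖unitVec (f v) (g v) - unitVec (f v) (h v)‖ ^ 2 := fun hf hg hh =>
    bddMeas_norm_unitVec_sub hf hg hh
  have b1 : BddMeas fun v : (E × E) × E =>
      ‖unitVec v.1.1 v.1.2 - unitVec v.1.1 v.2‖ ^ 2 := hb (by fun_prop) (by fun_prop) (by fun_prop)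
  have b2 : BddMeas fun v : (E × E) × E =>
      ‖unitVec v.1.2 v.1.1 - unitVec v.1.2 v.2‖ ^ 2 := hb (by fun_prop) (by fun_prop) (by fun_prop)
  have b3 : BddMeas fun v : (E × E) × E =>
      ‖unitVec v.2 v.1.1 - unitVec v.2 v.1.2‖ ^ 2 := hb (by fun_prop) (by fun_prop) (by fun_prop)
  set I := ∫ r, ∫ a, ∫ b, ‖unitVec r a - unitVec r b‖ ^ 2 ∂ρ ∂ρ ∂ρ with hI
  have e2 : ∫ r, ∫ a, ∫ b, ‖unitVec a r - unitVec a b‖ ^ 2 ∂ρ ∂ρ ∂ρ = I :=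
    BddMeas.integral_swap (F := fun w : E × E => ∫ b, ‖unitVec w.2 w.1 - unitVec w.2 b‖ ^ 2 ∂ρ)
      (b2.integral_right ρ) ρ ρ
  have e3 : ∫ r, ∫ a, ∫ b, ‖unitVec b r - unitVec b a‖ ^ 2 ∂ρ ∂ρ ∂ρ = I := by
    rw [← e2]
    congr 1; ext r
    rw [BddMeas.integral_swap (F := fun w : E × E => ‖unitVec w.2 r - unitVec w.2 w.1‖ ^ 2)
      (bddMeas_norm_unitVec_sub (by fun_prop) (by fun_prop) (by fun_prop)) ρ ρ]
  -- The three vertices are exchangeable, so the triangle inequality below integrates to three times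
  -- one vertex's spread.
  have hsplit : ∫ r, ∫ a, ∫ b, (‖unitVec r a - unitVec r b‖ ^ 2 + ‖unitVec a r - unitVec a b‖ ^ 2
      + ‖unitVec b r - unitVec b a‖ ^ 2) ∂ρ ∂ρ ∂ρ = 3 * I := by
    have h1 : ∀ r a, ∫ b, (‖unitVec r a - unitVec r b‖ ^ 2 + ‖unitVec a r - unitVec a b‖ ^ 2
      + ‖unitVec b r - unitVec b a‖ ^ 2) ∂ρ = ∫ b, ‖unitVec r a - unitVec r b‖ ^ 2 ∂ρ
        + ∫ b, ‖unitVec a r - unitVec a b‖ ^ 2 ∂ρ + ∫ b, ‖unitVec b r - unitVec b a‖ ^ 2 ∂ρ := by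
      intro r a
      have c1 : BddMeas fun b => ‖unitVec r a - unitVec r b‖ ^ 2 :=
        b1.comp (measurable_prodMk_left (x := (r, a)))
      have c2 : BddMeas fun b => ‖unitVec a r - unitVec a b‖ ^ 2 :=
        b2.comp (measurable_prodMk_left (x := (r, a)))
      have c3 : BddMeas fun b => ‖unitVec b r - unitVec b a‖ ^ 2 :=
        b3.comp (measurable_prodMk_left (x := (r, a)))
      rw [integral_add ((c1.add c2).integrable ρ) (c3.integrable ρ),
        integral_add (c1.integrable ρ) (c2.integrable ρ)]
    simp_rw [h1]
    rw [integral_iterated_add ρ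
        (F := fun w : E × E => ∫ b, ‖unitVec w.1 w.2 - unitVec w.1 b‖ ^ 2 ∂ρ
          + ∫ b, ‖unitVec w.2 w.1 - unitVec w.2 b‖ ^ 2 ∂ρ)
        (G := fun w : E × E => ∫ b, ‖unitVec b w.1 - unitVec b w.2‖ ^ 2 ∂ρ)
        ((b1.integral_right ρ).add (b2.integral_right ρ)) (b3.integral_right ρ),
      integral_iterated_add ρ
        (F := fun w : E × E => ∫ b, ‖unitVec w.1 w.2 - unitVec w.1 b‖ ^ 2 ∂ρ)
        (G := fun w : E × E => ∫ b, ‖unitVec w.2 w.1 - unitVec w.2 b‖ ^ 2 ∂ρ)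
        (b1.integral_right ρ) (b2.integral_right ρ), e2, e3]
    ring
  rw [← hsplit, distinctProb_eq]
  have b4 : BddMeas fun w : E × E => ∫ b, (‖unitVec w.1 w.2 - unitVec w.1 b‖ ^ 2
      + ‖unitVec w.2 w.1 - unitVec w.2 b‖ ^ 2 + ‖unitVec b w.1 - unitVec b w.2‖ ^ 2) ∂ρ :=
    ((b1.add b2).add b3).integral_right ρ
  refine integral_mono ((bddMeas_ne.integral_right ρ).integrable ρ)
    ((b4.integral_right ρ).integrable ρ) fun r => ?_
  refine integral_mono ((bddMeas_ne.comp measurable_prodMk_left).integrable ρ)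
    ((b4.comp measurable_prodMk_left).integrable ρ) fun a => ?_
  change (if r ≠ a then (1 : ℝ) else 0) ≤ _
  split_ifs with h
  · calc (1 : ℝ) = ∫ _b, (1 : ℝ) ∂ρ := by simp
      _ ≤ _ := integral_mono (integrable_const _)
        ((((b1.add b2).add b3).comp (measurable_prodMk_left (x := (r, a)))).integrable ρ)
        fun b => one_le_sum_norm_unitVec_sub b (Ne.symm h)
  · exact integral_nonneg fun b => by positivity

/-- A lower bound for the projection variance that depends only on the dimension and on the
probability that two independent copies are distinct. -/
theorem pcovSqArccos_diag_ge [Nontrivial E] (ρ : Measure E) [IsProbabilityMeasure ρ] :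
    Real.pi ^ 2 / (144 * (Module.finrank ℝ E) ^ 6) * distinctProb ρ ^ 2
      ≤ pcovSqArccos (ρ.map fun x => (x, x)) := by
  obtain ⟨c, hcd, hc⟩ := exists_integral_inner_mul_sgnInner (E := E)
  set d : ℝ := (Module.finrank ℝ E : ℝ) with hd
  have hd0 : 0 < d := by rw [hd]; exact_mod_cast Module.finrank_pos
  set k := c ^ 4 / (64 * Real.pi ^ 2) / d ^ 2 with hk
  have hpi := Real.pi_pos
  -- From `c ≥ 2π / d`: four powers of `d` come from `c⁴`, two from summing over coordinates.
  have hk0 : Real.pi ^ 2 / (4 * d ^ 6) ≤ k := by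
    have h1 : (2 * Real.pi / d) ^ 4 ≤ c ^ 4 := pow_le_pow_left₀ (by positivity) hcd 4
    calc Real.pi ^ 2 / (4 * d ^ 6) = (2 * Real.pi / d) ^ 4 / (64 * Real.pi ^ 2) / d ^ 2 := by
          field_simp; norm_num
      _ ≤ _ := by rw [hk]; gcongr
  have hkn : 0 ≤ k := le_trans (by positivity) hk0
  set T : E → ℝ := fun r => (∫ a, ∫ b, ‖unitVec r a - unitVec r b‖ ^ 2 ∂ρ ∂ρ) with hT
  have hTb : BddMeas T :=
    BddMeas.integral_right (F := fun w : E × E => ∫ b, ‖unitVec w.1 w.2 - unitVec w.1 b‖ ^ 2 ∂ρ)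
      (BddMeas.integral_right (F := fun v : (E × E) × E =>
        ‖unitVec v.1.1 v.1.2 - unitVec v.1.1 v.2‖ ^ 2)
        (bddMeas_norm_unitVec_sub (by fun_prop) (by fun_prop) (by fun_prop)) ρ) ρ
  have h1 : distinctProb ρ ≤ 3 * ∫ r, T r ∂ρ := distinctProb_le_spread ρ
  have h2 := hTb.sq_integral_le ρ
  have h3 : ∫ r, k / 4 * T r ^ 2 ∂ρ ≤ pcovSqArccos (ρ.map fun x => (x, x)) := by
    rw [pcovSqArccos_diag]
    refine integral_mono ((hTb.sq.const_mul _).integrable ρ)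
      ((bddMeas_centredSq_angle ρ).integrable ρ) fun r => ?_
    have := centredSq_angle_ge_spread ρ r hc
    refine le_trans (le_of_eq ?_) this
    simp only [hT]
    ring
  rw [integral_const_mul] at h3
  refine le_trans ?_ h3
  -- Jensen's inequality over the vertex. With the `4` in the bound for `k` and the `4` from halving
  -- the spread, this `9` makes up `144`.
  have h4 : distinctProb ρ ^ 2 ≤ 9 * ∫ r, T r ^ 2 ∂ρ := by
    have := pow_le_pow_left₀ (distinctProb_nonneg ρ) h1 2
    nlinarith
  calc Real.pi ^ 2 / (144 * d ^ 6) * distinctProb ρ ^ 2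
      ≤ Real.pi ^ 2 / (144 * d ^ 6) * (9 * ∫ r, T r ^ 2 ∂ρ) := by gcongr
    _ = (Real.pi ^ 2 / (4 * d ^ 6)) / 4 * ∫ r, T r ^ 2 ∂ρ := by field_simp; ring
    _ ≤ _ := by
      have : 0 ≤ ∫ r, T r ^ 2 ∂ρ := integral_nonneg fun _ => sq_nonneg _
      gcongr

end ProjectionVariance

end

/-! ### Population consequences of the knockoff property. -/

section Knockoffs

variable {p q : ℕ} {μ : Measure (Obs p q)} [IsProbabilityMeasure μ] {j : Fin p}

lemma measurable_swapAt (j : Fin p) : Measurable (swapAt j) := by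
  unfold swapAt
  refine Measurable.prodMk ?_ ?_ <;>
  · rw [measurable_pi_iff]
    intro i
    rcases eq_or_ne i j with rfl | h
    · simp only [Function.update_self]; fun_prop
    · simp only [Function.update_of_ne h]; fun_prop

/-- Exchanging an inactive feature with its knockoff leaves the joint law with the response
unchanged. -/
lemma map_swapAt_of_isInactive (hk : IsExactKnockoff μ) (hj : IsInactive μ j) :
    μ.map (fun w => (swapAt j (w.1, w.2.1), w.2.2)) = μ.map fun w => ((w.1, w.2.1), w.2.2) := by
  obtain ⟨κ, hκ, hinv, hcomp⟩ := hj
  have hx : Measurable fun w : Obs p q => w.1 := measurable_fst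
  have hu : Measurable fun w : Obs p q => (w.1, w.2.1) := by fun_prop
  have hy : Measurable fun w : Obs p q => w.2.2 := by fun_prop
  have h1 := (condIndepFun_iff_condDistrib_prod_ae_eq_prodMkRight (μ := μ) hy
    (by fun_prop : Measurable fun w : Obs p q => w.2.1) hx).1 hk.condIndep
  have h2 := condDistrib_ae_eq_of_measure_eq_compProd (μ := μ) (fun w : Obs p q => w.1)
    hy.aemeasurable hcomp
  -- By conditional independence, `κ` evaluated at `x` alone is also the conditional law of the
  -- response given both `x` and `x̃`.
  have h3 : condDistrib (fun w : Obs p q => w.2.2) (fun w => (w.1, w.2.1)) μ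
      =ᵐ[μ.map fun w => (w.1, w.2.1)] κ.prodMkRight (Fin p → ℝ) := by
    refine h1.trans ?_
    rw [show (μ.map fun w => w.1) = (μ.map fun w => (w.1, w.2.1)).map Prod.fst by
      rw [Measure.map_map measurable_fst hu]; rfl] at h2
    exact ae_of_ae_map measurable_fst.aemeasurable h2
  have hlaw : (μ.map fun w => ((w.1, w.2.1), w.2.2))
      = (μ.map fun w => (w.1, w.2.1)) ⊗ₘ κ.prodMkRight (Fin p → ℝ) := by
    rw [← Measure.compProd_congr h3, compProd_map_condDistrib hy.aemeasurable]
  have hsw : Measurable fun v : ((Fin p → ℝ) × (Fin p → ℝ)) × EuclideanSpace ℝ (Fin q) =>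
      (swapAt j v.1, v.2) := by
    have := measurable_swapAt j
    fun_prop
  have : (μ.map fun w => (swapAt j (w.1, w.2.1), w.2.2))
      = (μ.map fun w => ((w.1, w.2.1), w.2.2)).map fun v => (swapAt j v.1, v.2) := by
    rw [Measure.map_map hsw (by fun_prop)]; rfl
  rw [this, hlaw]
  ext s hs
  rw [Measure.map_apply hsw hs, Measure.compProd_apply (hsw hs), Measure.compProd_apply hs]
  -- The law of `(x, x̃)` may be swapped freely, and `κ` does not notice the changed coordinate.
  conv_rhs => rw [← hk.exchangeable j]
  rw [lintegral_map (Kernel.measurable_kernel_prodMk_left hs) (measurable_swapAt j)]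
  congr 1
  ext u
  simp only [Kernel.prodMkRight_apply, swapAt, hinv]
  rfl

lemma map_feature_response_of_isInactive (hk : IsExactKnockoff μ) (hj : IsInactive μ j) :
    (μ.map fun w => (w.2.1 j, w.2.2)) = μ.map fun w => (w.1 j, w.2.2) := by
  have h := congrArg (Measure.map fun v : ((Fin p → ℝ) × (Fin p → ℝ)) ×
    EuclideanSpace ℝ (Fin q) => (v.1.1 j, v.2)) (map_swapAt_of_isInactive hk hj)
  have := measurable_swapAt j
  rw [Measure.map_map (by fun_prop) (by fun_prop), Measure.map_map (by fun_prop) (by fun_prop)] at h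
  convert h using 2 <;>
  · funext w
    simp [swapAt]

lemma W_eq_zero_of_isInactive (form : PcovForm) (hk : IsExactKnockoff μ) (hj : IsInactive μ j) :
    W form μ j = 0 := by
  rw [W, map_feature_response_of_isInactive hk hj, sub_self]

/-- Carries the variance bound and the absence of atoms from features to knockoffs. -/
lemma map_knockoff_eq_featureLaw (hk : IsExactKnockoff μ) (j : Fin p) :
    (μ.map fun w => w.2.1 j) = featureLaw μ j := by
  have h := congrArg (Measure.map fun v : (Fin p → ℝ) × (Fin p → ℝ) => v.1 j) (hk.exchangeable j)
  have := measurable_swapAt j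
  rw [Measure.map_map (by fun_prop) (by fun_prop), Measure.map_map (by fun_prop) (by fun_prop),
    Measure.map_map (by fun_prop) (by fun_prop)] at h
  rw [featureLaw]
  convert h using 2 <;>
  · funext w
    simp [swapAt]

/-- The response space is a single point, so a constant Dirac kernel is a conditional law. This
disposes of `q = 0`, where no lower bound for the response variance is available. -/
lemma isInactive_of_response_dim_zero {μ : Measure (Obs p 0)} [IsProbabilityMeasure μ]
    (k : Fin p) : IsInactive μ k := by
  refine ⟨Kernel.const _ (Measure.dirac 0), inferInstance, fun _ _ => rfl, ?_⟩
  rw [Measure.compProd_const, Measure.prod_dirac, Measure.map_map (by fun_prop) (by fun_prop)]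
  congr 1
  ext w
  · rfl
  · exact Fin.elim0 (by assumption)

end Knockoffs

section

open InnerProductGeometry (angle)

/-! ### Agreement of the integral and arccosine forms without atoms. -/

section Forms

variable {E F : Type*}
  [NormedAddCommGroup E] [InnerProductSpace ℝ E] [FiniteDimensional ℝ E]
  [MeasurableSpace E] [BorelSpace E]
  [NormedAddCommGroup F] [InnerProductSpace ℝ F] [FiniteDimensional ℝ F]
  [MeasurableSpace F] [BorelSpace F]

lemma map_pi_pair {S ι : Type*} [MeasurableSpace S] [Fintype ι] (ν : Measure S)
    [IsProbabilityMeasure ν] {i j : ι} (hij : i ≠ j) :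
    (Measure.pi fun _ : ι => ν).map (fun z => (z i, z j)) = ν.prod ν := by
  have h := (iIndepFun_pi (μ := fun _ : ι => ν) (X := fun _ x => x)
    fun _ => aemeasurable_id).indepFun hij
  rw [indepFun_iff_map_prod_eq_prod_map_map (measurable_pi_apply i).aemeasurable
    (measurable_pi_apply j).aemeasurable] at h
  rw [h, (measurePreserving_eval (fun _ : ι => ν) i).map_eq,
    (measurePreserving_eval (fun _ : ι => ν) j).map_eq]

lemma ae_pi_ne {S ι : Type*} [MeasurableSpace S] [Fintype ι] (ν : Measure S)
    [IsProbabilityMeasure ν] {φ : S → E} (hφ : Measurable φ) (h : ∀ v, (ν.map φ) {v} = 0)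
    {i j : ι} (hij : i ≠ j) : ∀ᵐ z ∂(Measure.pi fun _ : ι => ν), φ (z i) ≠ φ (z j) := by
  have hms : MeasurableSet {w : S × S | φ w.1 = φ w.2} :=
    measurableSet_eq_fun (by fun_prop) (by fun_prop)
  have h0 : ∀ᵐ w ∂(ν.prod ν), φ w.1 ≠ φ w.2 := by
    rw [ae_iff]
    simp only [not_not]
    rw [Measure.measure_prod_null hms]
    refine Filter.Eventually.of_forall fun a => ?_
    have := h (φ a)
    rw [Measure.map_apply hφ (measurableSet_singleton _)] at this
    have hset : Prod.mk a ⁻¹' {w : S × S | φ w.1 = φ w.2} = φ ⁻¹' {φ a} := by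
      ext b
      simp [eq_comm]
    change ν (Prod.mk a ⁻¹' _) = 0
    rw [hset]
    exact this
  rw [← map_pi_pair ν hij] at h0
  exact ae_of_ae_map (p := fun w : S × S => φ w.1 ≠ φ w.2)
    (by fun_prop : Measurable fun z : ι → S => (z i, z j)).aemeasurable h0

lemma measurable_measureReal_le (ρ : Measure (ℝ × ℝ)) [IsFiniteMeasure ρ]
    {P : (ℝ × ℝ) → (ℝ × ℝ) → Prop} (hP : MeasurableSet {v : (ℝ × ℝ) × (ℝ × ℝ) | P v.1 v.2}) :
    Measurable fun t => ρ.real {w | P t w} :=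
  (measurable_measure_prodMk_left hP).ennreal_toReal

lemma cdfGap_map (ν : Measure (E × F)) [IsProbabilityMeasure ν] (α : E) (β : F) :
    cdfGap (ν.map fun w => (inner ℝ α w.1, inner ℝ β w.2))
      = ∫ r, (∫ w, halfInd (w.1 - r.1) α * halfInd (w.2 - r.2) β ∂ν
          - (∫ w, halfInd (w.1 - r.1) α ∂ν) * ∫ w, halfInd (w.2 - r.2) β ∂ν) ^ 2 ∂ν := by
  have hφ : Measurable fun w : E × F => ((inner ℝ α w.1 : ℝ), (inner ℝ β w.2 : ℝ)) := by fun_prop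
  have : IsProbabilityMeasure (ν.map fun w : E × F => ((inner ℝ α w.1 : ℝ), (inner ℝ β w.2 : ℝ))) :=
    Measure.isProbabilityMeasure_map hφ.aemeasurable
  have m1 : MeasurableSet {v : (ℝ × ℝ) × (ℝ × ℝ) | v.2.1 ≤ v.1.1} :=
    measurableSet_le (by fun_prop) (by fun_prop)
  have m2 : MeasurableSet {v : (ℝ × ℝ) × (ℝ × ℝ) | v.2.2 ≤ v.1.2} :=
    measurableSet_le (by fun_prop) (by fun_prop)
  unfold cdfGap
  rw [integral_map hφ.aemeasurable]
  · congr 1; ext r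
    have n1 : MeasurableSet {w : ℝ × ℝ | w.1 ≤ inner ℝ α r.1} :=
      measurableSet_le (by fun_prop) (by fun_prop)
    have n2 : MeasurableSet {w : ℝ × ℝ | w.2 ≤ inner ℝ β r.2} :=
      measurableSet_le (by fun_prop) (by fun_prop)
    have n3 : MeasurableSet {w : ℝ × ℝ | w.1 ≤ inner ℝ α r.1 ∧ w.2 ≤ inner ℝ β r.2} := n1.inter n2
    rw [map_measureReal_apply hφ n1, map_measureReal_apply hφ n2, map_measureReal_apply hφ n3,
      ← integral_indicator_one (hφ n1), ← integral_indicator_one (hφ n2),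
      ← integral_indicator_one (hφ n3)]
    classical
    congr 2
    · congr 1; ext w
      simp only [Set.indicator_apply, Set.mem_preimage, halfInd, inner_sub_right, sub_nonpos,
        Set.mem_ofPred_eq, Pi.one_apply]
      split_ifs <;> simp_all
    · congr 1 <;>
      · congr 1; ext w
        simp only [Set.indicator_apply, Set.mem_preimage, halfInd, inner_sub_right, sub_nonpos,
          Set.mem_ofPred_eq, Pi.one_apply]
  · exact (((measurable_measureReal_le _
      (P := fun t w => w.1 ≤ t.1 ∧ w.2 ≤ t.2) (m1.inter m2)).sub
      ((measurable_measureReal_le _ (P := fun t w => w.1 ≤ t.1) m1).mul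
        (measurable_measureReal_le _ (P := fun t w => w.2 ≤ t.2) m2))).pow_const
        2).aestronglyMeasurable

/-- At a fixed vertex, `(p - uv)² = p² + u²v² - 2puv`, and each product of means is one expectation
over independent copies. The copies are labelled as in the arccosine form. -/
lemma cdfGap_map_eq_integral_pi (ν : Measure (E × F)) [IsProbabilityMeasure ν] (α : E) (β : F) :
    cdfGap (ν.map fun w => (inner ℝ α w.1, inner ℝ β w.2))
      = ∫ z, (halfInd ((z 0).1 - (z 2).1) α * halfInd ((z 3).1 - (z 2).1) α)
          * (halfInd ((z 0).2 - (z 2).2) β * halfInd ((z 3).2 - (z 2).2) β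
            + halfInd ((z 1).2 - (z 2).2) β * halfInd ((z 4).2 - (z 2).2) β
            - 2 * (halfInd ((z 1).2 - (z 2).2) β * halfInd ((z 3).2 - (z 2).2) β))
          ∂(Measure.pi fun _ : Fin 5 => ν) := by
  rw [cdfGap_map]
  have hh : ∀ i : Fin 5, BddMeas fun z : Fin 5 → E × F => halfInd ((z i).1 - (z 2).1) α :=
    fun i => bddMeas_halfInd (by fun_prop) (by fun_prop)
  have hk : ∀ i : Fin 5, BddMeas fun z : Fin 5 → E × F => halfInd ((z i).2 - (z 2).2) β :=
    fun i => bddMeas_halfInd (by fun_prop) (by fun_prop)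
  rw [integral_pi_five ν (((hh 0).mul (hh 3)).mul ((((hk 0).mul (hk 3)).add
    ((hk 1).mul (hk 4))).sub (((hk 1).mul (hk 3)).const_mul 2)))]
  simp only [Matrix.cons_val]
  congr 1; ext r
  set h : E × F → ℝ := fun w => halfInd (w.1 - r.1) α with hhd
  set k : E × F → ℝ := fun w => halfInd (w.2 - r.2) β with hkd
  have bh : BddMeas h := bddMeas_halfInd (by fun_prop) (by fun_prop)
  have bk : BddMeas k := bddMeas_halfInd (by fun_prop) (by fun_prop)
  change (∫ w, h w * k w ∂ν - (∫ w, h w ∂ν) * ∫ w, k w ∂ν) ^ 2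
    = ∫ a, ∫ b, ∫ c, ∫ d, h a * h c * (k a * k c + k b * k d - 2 * (k b * k c)) ∂ν ∂ν ∂ν ∂ν
  set p := ∫ w, h w * k w ∂ν
  set u := ∫ w, h w ∂ν with hu
  set v := ∫ w, k w ∂ν with hv
  have e1 : ∀ a b c, ∫ d, h a * h c * (k a * k c + k b * k d - 2 * (k b * k c)) ∂ν
      = (h a * k a) * (h c * k c) + (h a * k b * v) * h c - (2 * h a * k b) * (h c * k c) := by
    intro a b c
    rw [integral_const_mul, integral_sub (((BddMeas.const _).add (bk.const_mul _)).integrable ν)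
      (integrable_const _), integral_add (integrable_const _) ((bk.const_mul _).integrable ν)]
    simp only [integral_const_mul, integral_const, probReal_univ, one_smul]
    rw [← hv]; ring
  have e2 : ∀ a b, ∫ c, ((h a * k a) * (h c * k c) + (h a * k b * v) * h c
      - (2 * h a * k b) * (h c * k c)) ∂ν
      = h a * k a * p + (h a * v * u - 2 * h a * p) * k b := by
    intro a b
    rw [integral_sub ((((bh.mul bk).const_mul _).add (bh.const_mul _)).integrable ν)
      (((bh.mul bk).const_mul _).integrable ν), integral_add (((bh.mul bk).const_mul _).integrable ν)
      ((bh.const_mul _).integrable ν), integral_const_mul, integral_const_mul, integral_const_mul]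
    ring
  have e3 : ∀ a, ∫ b, (h a * k a * p + (h a * v * u - 2 * h a * p) * k b) ∂ν
      = (h a * k a) * p + h a * ((v * u - 2 * p) * v) := by
    intro a
    rw [integral_add (integrable_const _) ((bk.const_mul _).integrable ν)]
    simp only [integral_const_mul, integral_const, probReal_univ, one_smul]
    rw [← hv]; ring
  simp_rw [e1, e2, e3]
  rw [integral_add (((bh.mul bk).mul (BddMeas.const _)).integrable ν)
    ((bh.mul (BddMeas.const _)).integrable ν), integral_mul_const, integral_mul_const]
  ring

/-- For atomless marginals the integral form of the squared projection covariance agrees with its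
arccosine form. -/
theorem pcovSqIntegral_eq_pcovSqArccos (ν : Measure (E × F)) [IsProbabilityMeasure ν]
    (hE : ∀ v, (ν.map Prod.fst) {v} = 0) (hF : ∀ v, (ν.map Prod.snd) {v} = 0) :
    pcovSqIntegral ν = pcovSqArccos ν := by
  set P := Measure.pi fun _ : Fin 5 => ν with hP
  set Φ : Metric.sphere (0 : E) 1 → Metric.sphere (0 : F) 1 → (Fin 5 → E × F) → ℝ :=
    fun α β z => (halfInd ((z 0).1 - (z 2).1) (α : E) * halfInd ((z 3).1 - (z 2).1) (α : E))
          * (halfInd ((z 0).2 - (z 2).2) (β : F) * halfInd ((z 3).2 - (z 2).2) (β : F)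
            + halfInd ((z 1).2 - (z 2).2) (β : F) * halfInd ((z 4).2 - (z 2).2) (β : F)
            - 2 * (halfInd ((z 1).2 - (z 2).2) (β : F) * halfInd ((z 3).2 - (z 2).2) (β : F)))
    with hΦ
  have hΦb : BddMeas fun v : (Metric.sphere (0 : E) 1 × Metric.sphere (0 : F) 1) ×
      (Fin 5 → E × F) => Φ v.1.1 v.1.2 v.2 := by
    have hh : ∀ i : Fin 5, BddMeas fun v : (Metric.sphere (0 : E) 1 × Metric.sphere (0 : F) 1) ×
      (Fin 5 → E × F) => halfInd ((v.2 i).1 - (v.2 2).1) (v.1.1 : E) :=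
      fun i => bddMeas_halfInd (by fun_prop) (by fun_prop)
    have hk : ∀ i : Fin 5, BddMeas fun v : (Metric.sphere (0 : E) 1 × Metric.sphere (0 : F) 1) ×
      (Fin 5 → E × F) => halfInd ((v.2 i).2 - (v.2 2).2) (v.1.2 : F) :=
      fun i => bddMeas_halfInd (by fun_prop) (by fun_prop)
    exact ((hh 0).mul (hh 3)).mul ((((hk 0).mul (hk 3)).add
      ((hk 1).mul (hk 4))).sub (((hk 1).mul (hk 3)).const_mul 2))
  have s1 : pcovSqIntegral ν
      = ∫ α, ∫ β, ∫ z, Φ α β z ∂P ∂(dirMeasure F) ∂(dirMeasure E) := by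
    unfold pcovSqIntegral
    congr 1; ext α; congr 1; ext β
    exact cdfGap_map_eq_integral_pi ν (α : E) (β : F)
  have s2 : pcovSqIntegral ν
      = ∫ z, ∫ α, ∫ β, Φ α β z ∂(dirMeasure F) ∂(dirMeasure E) ∂P := by
    rw [s1]
    have h1 : ∀ α, ∫ β, ∫ z, Φ α β z ∂P ∂(dirMeasure F)
        = ∫ z, ∫ β, Φ α β z ∂(dirMeasure F) ∂P := fun α =>
      BddMeas.integral_swap (F := fun w : Metric.sphere (0 : F) 1 × (Fin 5 → E × F) => Φ α w.1 w.2)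
        (hΦb.comp (by fun_prop : Measurable fun w : Metric.sphere (0 : F) 1 × (Fin 5 → E × F) =>
          ((α, w.1), w.2))) (dirMeasure F) P
    simp_rw [h1]
    exact BddMeas.integral_swap (F := fun w : Metric.sphere (0 : E) 1 × (Fin 5 → E × F) =>
      ∫ β, Φ w.1 β w.2 ∂(dirMeasure F)) (BddMeas.integral_right
        (F := fun v : (Metric.sphere (0 : E) 1 × (Fin 5 → E × F)) × Metric.sphere (0 : F) 1 =>
          Φ v.1.1 v.2 v.1.2) (hΦb.comp (by fun_prop : Measurable fun v :
            (Metric.sphere (0 : E) 1 × (Fin 5 → E × F)) × Metric.sphere (0 : F) 1 =>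
              ((v.1.1, v.2), v.1.2))) (dirMeasure F)) (dirMeasure E) P
  set a : Fin 5 → Fin 5 → (Fin 5 → E × F) → ℝ := fun i j z =>
    angle ((z i).1 - (z 2).1) ((z j).1 - (z 2).1) with ha
  set b : Fin 5 → Fin 5 → (Fin 5 → E × F) → ℝ := fun i j z =>
    angle ((z i).2 - (z 2).2) ((z j).2 - (z 2).2) with hb
  have hab : ∀ i j, BddMeas (a i j) := fun i j => bddMeas_angle (by fun_prop) (by fun_prop)
  have hbb : ∀ i j, BddMeas (b i j) := fun i j => bddMeas_angle (by fun_prop) (by fun_prop)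
  -- Each product of half-space indicators integrates to `π - ∠`, provided the difference vectors
  -- are nonzero; absence of atoms ensures this almost surely.
  have s3 : ∀ᵐ z ∂P, ∫ α, ∫ β, Φ α β z ∂(dirMeasure F) ∂(dirMeasure E)
      = (a 0 3 z * b 0 3 z + a 0 3 z * b 1 4 z - 2 * (a 0 3 z * b 1 3 z))
        + Real.pi * (2 * b 1 3 z - b 0 3 z - b 1 4 z) := by
    filter_upwards [ae_pi_ne ν measurable_fst hE (i := (0 : Fin 5)) (j := 2) (by decide),
      ae_pi_ne ν measurable_fst hE (i := (3 : Fin 5)) (j := 2) (by decide),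
      ae_pi_ne ν measurable_snd hF (i := (0 : Fin 5)) (j := 2) (by decide),
      ae_pi_ne ν measurable_snd hF (i := (1 : Fin 5)) (j := 2) (by decide),
      ae_pi_ne ν measurable_snd hF (i := (3 : Fin 5)) (j := 2) (by decide),
      ae_pi_ne ν measurable_snd hF (i := (4 : Fin 5)) (j := 2) (by decide)]
      with z h1 h2 h3 h4 h5 h6
    have hk : ∀ u v : F, BddMeas fun β : Metric.sphere (0 : F) 1 =>
        halfInd u (β : F) * halfInd v (β : F) := fun u v =>
      (bddMeas_halfInd (by fun_prop) (by fun_prop)).mul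
        (bddMeas_halfInd (by fun_prop) (by fun_prop))
    simp only [hΦ]
    simp_rw [integral_const_mul]
    rw [integral_mul_const,
      integral_sub (((hk _ _).add (hk _ _)).integrable _) (((hk _ _).const_mul 2).integrable _),
      integral_add ((hk _ _).integrable _) ((hk _ _).integrable _), integral_const_mul,
      integral_halfInd_mul (sub_ne_zero.2 h1) (sub_ne_zero.2 h2),
      integral_halfInd_mul (sub_ne_zero.2 h3) (sub_ne_zero.2 h5),
      integral_halfInd_mul (sub_ne_zero.2 h4) (sub_ne_zero.2 h6),
      integral_halfInd_mul (sub_ne_zero.2 h4) (sub_ne_zero.2 h5)]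
    simp only [ha, hb]
    ring
  -- The three response angles have the same mean, so the terms multiplied by `π` cancel in
  -- expectation.
  have hb0 : ∀ i j : Fin 5, (i = 0 ∧ j = 3 ∨ i = 1 ∧ j = 4 ∨ i = 1 ∧ j = 3) → ∫ z, b i j z ∂P
      = ∫ r, ∫ a, ∫ c, angle (a.2 - r.2) (c.2 - r.2) ∂ν ∂ν ∂ν := by
    rintro i j (⟨rfl, rfl⟩ | ⟨rfl, rfl⟩ | ⟨rfl, rfl⟩) <;>
    · rw [integral_pi_five ν (hbb _ _)]
      simp only [hb, Matrix.cons_val, integral_const, probReal_univ, one_smul]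
  rw [s2, integral_congr_ae s3, integral_add
    (((((hab 0 3).mul (hbb 0 3)).add ((hab 0 3).mul (hbb 1 4))).sub
      (((hab 0 3).mul (hbb 1 3)).const_mul 2)).integrable P)
    ((((((hbb 1 3).const_mul 2).sub (hbb 0 3)).sub (hbb 1 4)).const_mul _).integrable P),
    integral_sub ((((hab 0 3).mul (hbb 0 3)).add ((hab 0 3).mul (hbb 1 4))).integrable P)
      ((((hab 0 3).mul (hbb 1 3)).const_mul 2).integrable P),
    integral_add (((hab 0 3).mul (hbb 0 3)).integrable P)
      (((hab 0 3).mul (hbb 1 4)).integrable P), integral_const_mul, integral_const_mul,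
    integral_sub ((((hbb 1 3).const_mul 2).sub (hbb 0 3)).integrable P) ((hbb 1 4).integrable P),
    integral_sub (((hbb 1 3).const_mul 2).integrable P) ((hbb 0 3).integrable P),
    integral_const_mul, hb0 0 3 (by simp), hb0 1 4 (by simp), hb0 1 3 (by simp)]
  unfold pcovSqArccos
  ring

end Forms

end

section

open InnerProductGeometry (angle)

/-! ### Counting index tuples and expanding doubly centred sums. -/

section Counting

variable {n : ℕ}

lemma sum_fin_five (f : (Fin 5 → Fin n) → ℝ) :
    ∑ i, f i = ∑ r, ∑ a, ∑ b, ∑ c, ∑ d, f ![a, b, r, c, d] := by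
  let e : (Fin n × Fin n × Fin n × Fin n × Fin n) ≃ (Fin 5 → Fin n) :=
    { toFun := fun w => ![w.2.1, w.2.2.1, w.1, w.2.2.2.1, w.2.2.2.2]
      invFun := fun i => (i 2, i 0, i 1, i 3, i 4)
      left_inv := fun w => rfl
      right_inv := fun i => by funext k; fin_cases k <;> rfl }
  rw [← e.sum_comp]
  simp only [Fintype.sum_prod_type]
  rfl

lemma card_filter_eq_le (m : Fin 5) (j : Fin n) :
    (Finset.univ.filter fun i : Fin 5 → Fin n => i m = j).card ≤ n ^ 4 := by
  have h := Finset.card_le_card_of_injOn (s := Finset.univ.filter fun i : Fin 5 → Fin n => i m = j)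
    (t := (Finset.univ : Finset (Fin 4 → Fin n))) (fun i => i ∘ m.succAbove)
    (fun _ _ => Finset.mem_coe.2 (Finset.mem_univ _)) ?_
  · simpa using h
  · intro i hi i' hi' hii
    simp only [Finset.coe_filter, Finset.mem_univ, true_and, Set.mem_ofPred_eq] at hi hi'
    funext k
    rcases eq_or_ne k m with rfl | hk
    · rw [hi, hi']
    · obtain ⟨l, rfl⟩ := Fin.exists_succAbove_eq hk
      exact congrFun hii l

lemma card_filter_eq_eq_le {m m' : Fin 5} (hm : m ≠ m') :
    (Finset.univ.filter fun i : Fin 5 → Fin n => i m = i m').card ≤ n ^ 4 := by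
  have h := Finset.card_le_card_of_injOn
    (s := Finset.univ.filter fun i : Fin 5 → Fin n => i m = i m')
    (t := (Finset.univ : Finset (Fin 4 → Fin n))) (fun i => i ∘ m.succAbove)
    (fun _ _ => Finset.mem_coe.2 (Finset.mem_univ _)) ?_
  · simpa using h
  · intro i hi i' hi' hii
    simp only [Finset.coe_filter, Finset.mem_univ, true_and, Set.mem_ofPred_eq] at hi hi'
    have key : ∀ k, k ≠ m → i k = i' k := by
      intro k hk
      obtain ⟨l, rfl⟩ := Fin.exists_succAbove_eq hk
      exact congrFun hii l
    funext k
    rcases eq_or_ne k m with rfl | hk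
    · rw [hi, hi', key _ hm.symm]
    · exact key k hk

lemma card_filter_mem_range_le (j : Fin n) :
    (Finset.univ.filter fun i : Fin 5 → Fin n => ∃ m, i m = j).card ≤ 5 * n ^ 4 := by
  have : (Finset.univ.filter fun i : Fin 5 → Fin n => ∃ m, i m = j)
      ⊆ Finset.univ.biUnion fun m : Fin 5 => Finset.univ.filter fun i => i m = j := by
    intro i hi
    simpa using hi
  refine (Finset.card_le_card this).trans (Finset.card_biUnion_le.trans ?_)
  refine (Finset.sum_le_card_nsmul _ _ (n ^ 4) fun m _ => card_filter_eq_le m j).trans ?_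
  simp

/-- A non-injective tuple has a coincidence at one of the `20` ordered pairs of distinct positions,
and each coincidence costs one free index. -/
lemma card_filter_not_injective_le :
    (Finset.univ.filter fun i : Fin 5 → Fin n => ¬ Function.Injective i).card ≤ 20 * n ^ 4 := by
  have : (Finset.univ.filter fun i : Fin 5 → Fin n => ¬ Function.Injective i)
      ⊆ (Finset.univ : Finset (Fin 5)).offDiag.biUnion fun m =>
        Finset.univ.filter fun i => i m.1 = i m.2 := by
    intro i hi
    have hi' := (Finset.mem_filter.1 hi).2
    simp only [Function.Injective] at hi'
    push Not at hi'
    obtain ⟨m, m', h, hne⟩ := hi'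
    simp only [Finset.mem_biUnion, Finset.mem_offDiag, Finset.mem_filter, Finset.mem_univ,
      true_and]
    exact ⟨(m, m'), hne, h⟩
  refine (Finset.card_le_card this).trans (Finset.card_biUnion_le.trans ?_)
  refine (Finset.sum_le_card_nsmul _ _ (n ^ 4) fun m hm =>
    card_filter_eq_eq_le (Finset.mem_offDiag.1 hm).2.2).trans ?_
  simp [Finset.offDiag_card]

/-- The inner product of doubly centred symmetric matrices. -/
lemma sum_doublyCentred_mul (hn : 0 < n) {a b : Fin n → Fin n → ℝ} (ha : ∀ k l, a k l = a l k)
    (hb : ∀ k l, b k l = b l k) :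
    ∑ k, ∑ l, (a k l - (n : ℝ)⁻¹ * ∑ l', a k l' - (n : ℝ)⁻¹ * ∑ k', a k' l
        + ((n : ℝ) ^ 2)⁻¹ * ∑ k', ∑ l', a k' l')
      * (b k l - (n : ℝ)⁻¹ * ∑ l', b k l' - (n : ℝ)⁻¹ * ∑ k', b k' l
        + ((n : ℝ) ^ 2)⁻¹ * ∑ k', ∑ l', b k' l')
      = ∑ k, ∑ l, a k l * b k l + ((n : ℝ) ^ 2)⁻¹ * ((∑ k, ∑ l, a k l) * ∑ k, ∑ l, b k l)
        - 2 * (n : ℝ)⁻¹ * ∑ l, (∑ k, a k l) * ∑ k, b k l := by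
  have hN : (n : ℝ) ≠ 0 := by exact_mod_cast hn.ne'
  have hcol : ∀ {a : Fin n → Fin n → ℝ}, (∀ k l, a k l = a l k) →
      ∀ l, ∑ k', a k' l = ∑ l', a l l' := fun h l => Finset.sum_congr rfl fun k _ => h k l
  simp only [hcol ha, hcol hb]
  set R : Fin n → ℝ := fun k => ∑ l, a k l with hR
  set Q : Fin n → ℝ := fun k => ∑ l, b k l with hQ
  set A := ∑ k, R k with hA
  set B := ∑ k, Q k with hB
  change ∑ k, ∑ l, (a k l - (n : ℝ)⁻¹ * R k - (n : ℝ)⁻¹ * R l + ((n : ℝ) ^ 2)⁻¹ * A)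
      * (b k l - (n : ℝ)⁻¹ * Q k - (n : ℝ)⁻¹ * Q l + ((n : ℝ) ^ 2)⁻¹ * B)
    = ∑ k, ∑ l, a k l * b k l + ((n : ℝ) ^ 2)⁻¹ * (A * B) - 2 * (n : ℝ)⁻¹ * ∑ l, R l * Q l
  have hmix : ∑ k, ∑ l, a k l * Q l = ∑ l, R l * Q l := by
    rw [Finset.sum_comm]
    refine Finset.sum_congr rfl fun l _ => ?_
    rw [← Finset.sum_mul, hcol ha]
  have hmix' : ∑ k, ∑ l, R l * b k l = ∑ l, R l * Q l := by
    rw [Finset.sum_comm]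
    refine Finset.sum_congr rfl fun l _ => ?_
    rw [← Finset.mul_sum, hcol hb]
  have hrow : ∀ k, ∑ l, (a k l - (n : ℝ)⁻¹ * R k - (n : ℝ)⁻¹ * R l + ((n : ℝ) ^ 2)⁻¹ * A)
      * (b k l - (n : ℝ)⁻¹ * Q k - (n : ℝ)⁻¹ * Q l + ((n : ℝ) ^ 2)⁻¹ * B)
      = ∑ l, a k l * b k l - (n : ℝ)⁻¹ * ∑ l, a k l * Q l - (n : ℝ)⁻¹ * ∑ l, R l * b k l
        + ((n : ℝ) ^ 2)⁻¹ * ∑ l, R l * Q l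
        - (n : ℝ)⁻¹ * (R k * Q k) + ((n : ℝ) ^ 2)⁻¹ * (R k * B) + ((n : ℝ) ^ 2)⁻¹ * (A * Q k)
        - ((n : ℝ) ^ 3)⁻¹ * (A * B) := by
    intro k
    have h1 : ∀ l, (a k l - (n : ℝ)⁻¹ * R k - (n : ℝ)⁻¹ * R l + ((n : ℝ) ^ 2)⁻¹ * A)
      * (b k l - (n : ℝ)⁻¹ * Q k - (n : ℝ)⁻¹ * Q l + ((n : ℝ) ^ 2)⁻¹ * B)
      = a k l * b k l - (n : ℝ)⁻¹ * (a k l * Q l) - (n : ℝ)⁻¹ * (R l * b k l)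
        + ((n : ℝ) ^ 2)⁻¹ * (R l * Q l)
        + a k l * (((n : ℝ) ^ 2)⁻¹ * B - (n : ℝ)⁻¹ * Q k)
        + b k l * (((n : ℝ) ^ 2)⁻¹ * A - (n : ℝ)⁻¹ * R k)
        - R l * ((n : ℝ)⁻¹ * (((n : ℝ) ^ 2)⁻¹ * B - (n : ℝ)⁻¹ * Q k))
        - Q l * ((n : ℝ)⁻¹ * (((n : ℝ) ^ 2)⁻¹ * A - (n : ℝ)⁻¹ * R k))
        + (((n : ℝ) ^ 2)⁻¹ * A - (n : ℝ)⁻¹ * R k) * (((n : ℝ) ^ 2)⁻¹ * B - (n : ℝ)⁻¹ * Q k) :=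
      fun l => by ring
    simp_rw [h1]
    simp only [Finset.sum_add_distrib, Finset.sum_sub_distrib, ← Finset.mul_sum, ← Finset.sum_mul,
      Finset.sum_const, Finset.card_univ, Fintype.card_fin, nsmul_eq_mul]
    rw [← hA, ← hB, show ∑ l, a k l = R k from rfl, show ∑ l, b k l = Q k from rfl]
    field_simp
    ring
  simp_rw [hrow]
  simp only [Finset.sum_add_distrib, Finset.sum_sub_distrib, ← Finset.mul_sum, ← Finset.sum_mul,
      Finset.sum_const, Finset.card_univ, Fintype.card_fin, nsmul_eq_mul, hmix, hmix']
  rw [← hA, ← hB]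
  field_simp
  ring

end Counting

/-! ### The sample covariance as a V-statistic of order five. -/

section VStatistic

variable {E F : Type*} [NormedAddCommGroup E] [InnerProductSpace ℝ E]
  [NormedAddCommGroup F] [InnerProductSpace ℝ F] {n : ℕ}

lemma ang_comm (x : Fin n → E) (k l r : Fin n) : ang x k l r = ang x l k r := by
  unfold ang
  rw [InnerProductGeometry.angle_comm]
  congr 1
  exact propext or_comm

lemma abs_ang_le (x : Fin n → E) (k l r : Fin n) : |ang x k l r| ≤ Real.pi := by
  unfold ang
  split_ifs
  · simpa using Real.pi_pos.le
  · exact abs_angle_le _ _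

/-- The kernel of the V-statistic `samplePcovSq`. -/
def pcovKernel (x : Fin n → E) (y : Fin n → F) (i : Fin 5 → Fin n) : ℝ :=
  ang x (i 0) (i 3) (i 2) * ang y (i 0) (i 3) (i 2)
    + ang x (i 0) (i 3) (i 2) * ang y (i 1) (i 4) (i 2)
    - 2 * (ang x (i 0) (i 3) (i 2) * ang y (i 1) (i 3) (i 2))

lemma abs_pcovKernel_le (x : Fin n → E) (y : Fin n → F) (i : Fin 5 → Fin n) :
    |pcovKernel x y i| ≤ 4 * Real.pi ^ 2 := by
  have h : ∀ k l r k' l', |ang x k l r * ang y k' l' r| ≤ Real.pi ^ 2 := by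
    intro k l r k' l'
    rw [abs_mul, pow_two]
    exact mul_le_mul (abs_ang_le _ _ _ _) (abs_ang_le _ _ _ _) (abs_nonneg _) Real.pi_pos.le
  unfold pcovKernel
  have h1 := abs_le.1 (h (i 0) (i 3) (i 2) (i 0) (i 3))
  have h2 := abs_le.1 (h (i 0) (i 3) (i 2) (i 1) (i 4))
  have h3 := abs_le.1 (h (i 0) (i 3) (i 2) (i 1) (i 3))
  rw [abs_le]
  constructor <;> linarith [h1.1, h1.2, h2.1, h2.2, h3.1, h3.2]

/-- Expanding the double centring for each vertex `r` gives the three parts of the kernel; an index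
that a part does not use contributes a factor `n`. -/
lemma samplePcovSq_eq_sum (hn : 0 < n) (x : Fin n → E) (y : Fin n → F) :
    samplePcovSq x y = ((n : ℝ) ^ 5)⁻¹ * ∑ i, pcovKernel x y i := by
  have hN : (n : ℝ) ≠ 0 := by exact_mod_cast hn.ne'
  have h1 : ∑ k, ∑ l, ∑ r, angC x k l r * angC y k l r
      = ∑ r, ∑ k, ∑ l, angC x k l r * angC y k l r := by
    rw [Finset.sum_congr rfl fun k _ => Finset.sum_comm, Finset.sum_comm]
  unfold samplePcovSq
  rw [h1, sum_fin_five]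
  simp only [Finset.mul_sum]
  refine Finset.sum_congr rfl fun r _ => ?_
  simp only [← Finset.mul_sum]
  have h2 := sum_doublyCentred_mul hn (fun k l => ang_comm x k l r) (fun k l => ang_comm y k l r)
  simp only [angC]
  rw [h2]
  simp only [pcovKernel, Matrix.cons_val]
  have h3 : ∑ a, ∑ b : Fin n, ∑ c, ∑ d : Fin n, ang x a c r * ang y a c r
      = (n : ℝ) ^ 2 * ∑ a, ∑ c, ang x a c r * ang y a c r := by
    simp only [Finset.sum_const, Finset.card_univ, Fintype.card_fin, nsmul_eq_mul, Finset.mul_sum]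
    refine Finset.sum_congr rfl fun a _ => Finset.sum_congr rfl fun c _ => by ring
  have h4 : ∑ a, ∑ b, ∑ c, ∑ d, ang x a c r * ang y b d r
      = (∑ k, ∑ l, ang x k l r) * ∑ k, ∑ l, ang y k l r := by
    simp only [← Finset.mul_sum, ← Finset.sum_mul]
  have h5 : ∑ a, ∑ b, ∑ c, ∑ d : Fin n, ang x a c r * ang y b c r
      = (n : ℝ) * ∑ l, (∑ k, ang x k l r) * ∑ k, ang y k l r := by
    simp only [Finset.sum_const, Finset.card_univ, Fintype.card_fin, nsmul_eq_mul,
      ← Finset.mul_sum]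
    congr 1
    have h6 : ∀ a, ∑ b, ∑ c, ang x a c r * ang y b c r
        = ∑ c, ang x a c r * ∑ b, ang y b c r := fun a => by
      rw [Finset.sum_comm]; simp only [Finset.mul_sum]
    simp only [h6]
    rw [Finset.sum_comm]
    simp only [Finset.sum_mul]
  simp only [Finset.sum_add_distrib, Finset.sum_sub_distrib]
  have h7 : ∑ a, ∑ b, ∑ c, ∑ d : Fin n, 2 * (ang x a c r * ang y b c r)
      = 2 * ∑ a, ∑ b, ∑ c, ∑ d : Fin n, ang x a c r * ang y b c r := by
    simp only [← Finset.mul_sum]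
  rw [h7, h3, h4, h5]
  field_simp

lemma abs_samplePcovSq_le (x : Fin n → E) (y : Fin n → F) :
    |samplePcovSq x y| ≤ 4 * Real.pi ^ 2 := by
  rcases Nat.eq_zero_or_pos n with rfl | hn
  · simp [samplePcovSq]; positivity
  rw [samplePcovSq_eq_sum hn, abs_mul, abs_of_nonneg (by positivity : (0 : ℝ) ≤ ((n : ℝ) ^ 5)⁻¹),
    inv_mul_le_iff₀ (by positivity)]
  refine (Finset.abs_sum_le_sum_abs _ _).trans
    ((Finset.sum_le_card_nsmul _ _ _ fun i _ => abs_pcovKernel_le x y i).trans ?_)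
  simp

lemma pcovKernel_congr {x x' : Fin n → E} {y y' : Fin n → F} {i : Fin 5 → Fin n}
    (hx : ∀ m, x (i m) = x' (i m)) (hy : ∀ m, y (i m) = y' (i m)) :
    pcovKernel x y i = pcovKernel x' y' i := by
  simp only [pcovKernel, ang, hx, hy]

/-- Changing one observation changes the statistic by `O(1 / n)`. -/
lemma abs_samplePcovSq_update_sub_le {S : Type*} (hn : 0 < n) (X : S → E) (Y : S → F)
    (z : Fin n → S) (j : Fin n) (s : S) :
    |samplePcovSq (fun i => X (Function.update z j s i)) (fun i => Y (Function.update z j s i))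
      - samplePcovSq (fun i => X (z i)) (fun i => Y (z i))| ≤ 40 * Real.pi ^ 2 / n := by
  have hN : (0 : ℝ) < n := by exact_mod_cast hn
  set x := fun i => X (z i)
  set y := fun i => Y (z i)
  set x' := fun i => X (Function.update z j s i)
  set y' := fun i => Y (Function.update z j s i)
  have hk : ∀ i : Fin 5 → Fin n, |pcovKernel x' y' i - pcovKernel x y i|
      ≤ if ∃ m, i m = j then 8 * Real.pi ^ 2 else 0 := by
    intro i
    split_ifs with h
    · have h1 := abs_le.1 (abs_pcovKernel_le x' y' i)
      have h2 := abs_le.1 (abs_pcovKernel_le x y i)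
      rw [abs_le]; constructor <;> linarith [h1.1, h1.2, h2.1, h2.2]
    · push Not at h
      rw [pcovKernel_congr (x := x') (x' := x) (y := y') (y' := y)
        (fun m => by simp [x, x', Function.update_of_ne (h m)])
        (fun m => by simp [y, y', Function.update_of_ne (h m)]), sub_self, abs_zero]
  -- Of the `n⁵` tuples only `5n⁴` see the changed observation, and each kernel value moves by at
  -- most twice `4π²`.
  have hcard : ((Finset.univ.filter fun i : Fin 5 → Fin n => ∃ m, i m = j).card : ℝ)
      ≤ 5 * (n : ℝ) ^ 4 := by exact_mod_cast card_filter_mem_range_le j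
  rw [samplePcovSq_eq_sum hn, samplePcovSq_eq_sum hn, ← mul_sub, ← Finset.sum_sub_distrib, abs_mul,
    abs_of_nonneg (by positivity : (0 : ℝ) ≤ ((n : ℝ) ^ 5)⁻¹), inv_mul_le_iff₀ (by positivity)]
  calc _ ≤ ∑ i : Fin 5 → Fin n, (if ∃ m, i m = j then 8 * Real.pi ^ 2 else 0) :=
        (Finset.abs_sum_le_sum_abs _ _).trans (Finset.sum_le_sum fun i _ => hk i)
    _ = ((Finset.univ.filter fun i : Fin 5 → Fin n => ∃ m, i m = j).card : ℝ)
          * (8 * Real.pi ^ 2) := by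
        rw [← Finset.sum_filter, Finset.sum_const, nsmul_eq_mul]
    _ ≤ 5 * (n : ℝ) ^ 4 * (8 * Real.pi ^ 2) := by gcongr
    _ = _ := by field_simp; norm_num

end VStatistic

/-! ### Bias and exponential concentration of the sample covariance. -/

section Concentration

variable {E F : Type*}
  [NormedAddCommGroup E] [InnerProductSpace ℝ E] [FiniteDimensional ℝ E]
  [MeasurableSpace E] [BorelSpace E]
  [NormedAddCommGroup F] [InnerProductSpace ℝ F] [FiniteDimensional ℝ F]
  [MeasurableSpace F] [BorelSpace F]
  {S : Type*} [MeasurableSpace S] {n : ℕ}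

lemma measurable_ang {X : S → E} (hX : Measurable X) (k l r : Fin n) :
    Measurable fun z : Fin n → S => ang (fun i => X (z i)) k l r := by
  unfold ang
  split_ifs
  · exact measurable_const
  · fun_prop

lemma bddMeas_pcovKernel {X : S → E} {Y : S → F} (hX : Measurable X) (hY : Measurable Y)
    (i : Fin 5 → Fin n) :
    BddMeas fun z : Fin n → S => pcovKernel (fun i => X (z i)) (fun i => Y (z i)) i := by
  refine ⟨?_, 4 * Real.pi ^ 2, fun z => abs_pcovKernel_le _ _ _⟩
  unfold pcovKernel
  have h1 := fun k l r => measurable_ang (n := n) hX k l r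
  have h2 := fun k l r => measurable_ang (n := n) hY k l r
  exact (((h1 _ _ _).mul (h2 _ _ _)).add ((h1 _ _ _).mul (h2 _ _ _))).sub
    (((h1 _ _ _).mul (h2 _ _ _)).const_mul 2)

lemma measurable_samplePcovSq {X : S → E} {Y : S → F} (hX : Measurable X) (hY : Measurable Y) :
    Measurable fun z : Fin n → S => samplePcovSq (fun i => X (z i)) (fun i => Y (z i)) := by
  rcases Nat.eq_zero_or_pos n with rfl | hn
  · simp [samplePcovSq]
  simp_rw [samplePcovSq_eq_sum hn]
  exact (Finset.measurable_sum _ fun i _ => (bddMeas_pcovKernel hX hY i).meas).const_mul _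

lemma map_pi_comp_injective {ι κ : Type*} [Fintype ι] [Fintype κ] (μ : Measure S)
    [IsProbabilityMeasure μ] {i : κ → ι} (hi : Function.Injective i) :
    (Measure.pi fun _ : ι => μ).map (fun z k => z (i k)) = Measure.pi fun _ : κ => μ := by
  have h := (iIndepFun_pi (μ := fun _ : ι => μ) (X := fun _ x => x)
    fun _ => aemeasurable_id).precomp hi
  rw [iIndepFun_iff_map_fun_eq_pi_map
    (fun k => (measurable_pi_apply (i k)).aemeasurable)] at h
  rw [h]
  congr 1
  funext k
  exact (measurePreserving_eval (fun _ : ι => μ) (i k)).map_eq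

/-- Distinct indices select five independent copies and never trigger the zero convention in `ang`.
-/
lemma integral_pcovKernel_of_injective (μ : Measure S) [IsProbabilityMeasure μ] {X : S → E}
    {Y : S → F} (hX : Measurable X) (hY : Measurable Y) {i : Fin 5 → Fin n}
    (hi : Function.Injective i) :
    ∫ z, pcovKernel (fun j => X (z j)) (fun j => Y (z j)) i ∂(Measure.pi fun _ : Fin n => μ)
      = pcovSqArccos (μ.map fun s => (X s, Y s)) := by
  have hXY : Measurable fun s => (X s, Y s) := hX.prodMk hY
  have : IsProbabilityMeasure (μ.map fun s => (X s, Y s)) :=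
    Measure.isProbabilityMeasure_map hXY.aemeasurable
  have hpi : (Measure.pi fun _ : Fin 5 => μ.map fun s => (X s, Y s))
      = (Measure.pi fun _ : Fin n => μ).map fun z k => (X (z (i k)), Y (z (i k))) := by
    rw [← Measure.pi_map_pi (μ := fun _ : Fin 5 => μ) (f := fun _ s => (X s, Y s))
      fun _ => hXY.aemeasurable, ← map_pi_comp_injective μ hi,
      Measure.map_map (by fun_prop) (by fun_prop)]
    rfl
  have hA : ∀ k l r : Fin 5, BddMeas fun z : Fin 5 → E × F =>
      angle ((z k).1 - (z r).1) ((z l).1 - (z r).1) :=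
    fun k l r => bddMeas_angle (by fun_prop) (by fun_prop)
  have hB : ∀ k l r : Fin 5, BddMeas fun z : Fin 5 → E × F =>
      angle ((z k).2 - (z r).2) ((z l).2 - (z r).2) :=
    fun k l r => bddMeas_angle (by fun_prop) (by fun_prop)
  unfold pcovSqArccos
  rw [← integral_const_mul, ← integral_add (((hA 0 3 2).mul (hB 0 3 2)).integrable _)
    (((hA 0 3 2).mul (hB 1 4 2)).integrable _), ← integral_sub
    ((((hA 0 3 2).mul (hB 0 3 2)).add ((hA 0 3 2).mul (hB 1 4 2))).integrable _)
    ((((hA 0 3 2).mul (hB 1 3 2)).const_mul 2).integrable _), hpi, integral_map (by fun_prop)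
    ((((hA 0 3 2).mul (hB 0 3 2)).add ((hA 0 3 2).mul (hB 1 4 2))).sub
      (((hA 0 3 2).mul (hB 1 3 2)).const_mul 2)).meas.aestronglyMeasurable]
  congr 1
  ext z
  have hne : ∀ k l : Fin 5, k ≠ l → i k ≠ i l := fun k l h h' => h (hi h')
  have hang : ∀ {G : Type _} [NormedAddCommGroup G] [InnerProductSpace ℝ G] (x : Fin n → G)
      (k l r : Fin 5), k ≠ r → l ≠ r →
      ang x (i k) (i l) (i r) = angle (x (i k) - x (i r)) (x (i l) - x (i r)) := by
    intro G _ _ x k l r h1 h2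
    unfold ang
    rw [if_neg]
    exact not_or.2 ⟨hne _ _ h1, hne _ _ h2⟩
  unfold pcovKernel
  rw [hang _ 0 3 2 (by decide) (by decide)]
  have hang' : ∀ (x : Fin n → F) (k l r : Fin 5), k ≠ r → l ≠ r →
      ang x (i k) (i l) (i r) = angle (x (i k) - x (i r)) (x (i l) - x (i r)) := by
    intro x k l r h1 h2
    unfold ang
    rw [if_neg]
    exact not_or.2 ⟨hne _ _ h1, hne _ _ h2⟩
  rw [hang' _ 0 3 2 (by decide) (by decide), hang' _ 1 4 2 (by decide) (by decide),
    hang' _ 1 3 2 (by decide) (by decide)]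

lemma abs_pcovSqArccos_le (ν : Measure (E × F)) [IsProbabilityMeasure ν] :
    |pcovSqArccos ν| ≤ 4 * Real.pi ^ 2 := by
  have h := integral_pcovKernel_of_injective (n := 5) ν measurable_fst measurable_snd
    (i := id) Function.injective_id
  have hid : (ν.map fun s => (s.1, s.2)) = ν := Measure.map_id
  rw [hid] at h
  rw [← h]
  exact abs_integral_le_of_abs_le fun z => abs_pcovKernel_le _ _ _

/-- The V-statistic is biased by `O(1 / n)` only. -/
lemma abs_integral_samplePcovSq_sub_le (hn : 0 < n) (μ : Measure S) [IsProbabilityMeasure μ]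
    {X : S → E} {Y : S → F} (hX : Measurable X) (hY : Measurable Y) :
    |∫ z, samplePcovSq (fun j => X (z j)) (fun j => Y (z j)) ∂(Measure.pi fun _ : Fin n => μ)
      - pcovSqArccos (μ.map fun s => (X s, Y s))| ≤ 160 * Real.pi ^ 2 / n := by
  have hN : (0 : ℝ) < n := by exact_mod_cast hn
  have : IsProbabilityMeasure (μ.map fun s => (X s, Y s)) :=
    Measure.isProbabilityMeasure_map (hX.prodMk hY).aemeasurable
  set θ := pcovSqArccos (μ.map fun s => (X s, Y s)) with hθ
  set I : (Fin 5 → Fin n) → ℝ := fun i =>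
    ∫ z, pcovKernel (fun j => X (z j)) (fun j => Y (z j)) i ∂(Measure.pi fun _ : Fin n => μ)
    with hI
  have h1 : ∫ z, samplePcovSq (fun j => X (z j)) (fun j => Y (z j))
      ∂(Measure.pi fun _ : Fin n => μ) = ((n : ℝ) ^ 5)⁻¹ * ∑ i, I i := by
    simp_rw [samplePcovSq_eq_sum hn]
    rw [integral_const_mul, integral_finsetSum _ fun i _ =>
      (bddMeas_pcovKernel hX hY i).integrable _]
  have h2 : θ = ((n : ℝ) ^ 5)⁻¹ * ∑ _i : Fin 5 → Fin n, θ := by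
    simp only [Finset.sum_const, Finset.card_univ, Fintype.card_fun, Fintype.card_fin,
      nsmul_eq_mul]
    push_cast
    field_simp
  -- Only tuples with a repeated index contribute to the bias.
  have hk : ∀ i, |I i - θ| ≤ if ¬ Function.Injective i then 8 * Real.pi ^ 2 else 0 := by
    intro i
    by_cases h : Function.Injective i
    · rw [show I i = θ from integral_pcovKernel_of_injective μ hX hY h, sub_self, abs_zero]
      simp [h]
    · rw [if_pos h]
      have h3 := abs_le.1 (abs_pcovSqArccos_le (μ.map fun s => (X s, Y s)))
      have h4 : |I i| ≤ 4 * Real.pi ^ 2 := abs_integral_le_of_abs_le fun z => abs_pcovKernel_le _ _ _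
      rw [abs_le] at h4 ⊢
      constructor <;> linarith [h3.1, h3.2, h4.1, h4.2]
  have hcard : ((Finset.univ.filter fun i : Fin 5 → Fin n => ¬ Function.Injective i).card : ℝ)
      ≤ 20 * (n : ℝ) ^ 4 := by exact_mod_cast card_filter_not_injective_le
  rw [h1, h2, ← mul_sub, ← Finset.sum_sub_distrib, abs_mul,
    abs_of_nonneg (by positivity : (0 : ℝ) ≤ ((n : ℝ) ^ 5)⁻¹), inv_mul_le_iff₀ (by positivity)]
  calc _ ≤ ∑ i : Fin 5 → Fin n, (if ¬ Function.Injective i then 8 * Real.pi ^ 2 else 0) :=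
        (Finset.abs_sum_le_sum_abs _ _).trans (Finset.sum_le_sum fun i _ => hk i)
    _ = ((Finset.univ.filter fun i : Fin 5 → Fin n => ¬ Function.Injective i).card : ℝ)
          * (8 * Real.pi ^ 2) := by
        rw [← Finset.sum_filter, Finset.sum_const, nsmul_eq_mul]
    _ ≤ 20 * (n : ℝ) ^ 4 * (8 * Real.pi ^ 2) := by gcongr
    _ = _ := by field_simp; norm_num

/-- Exponential concentration of the squared sample projection covariance. -/
theorem measure_samplePcovSq_sub_ge_le (hn : 0 < n) (μ : Measure S) [IsProbabilityMeasure μ]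
    {X : S → E} {Y : S → F} (hX : Measurable X) (hY : Measurable Y) {t : ℝ} (ht0 : 0 ≤ t)
    (ht1 : t ≤ 1) :
    (Measure.pi fun _ : Fin n => μ).real {z | t ≤ |samplePcovSq (fun j => X (z j))
        (fun j => Y (z j)) - pcovSqArccos (μ.map fun s => (X s, Y s))|}
      ≤ 6 * Real.exp (-(n * t ^ 2 / (3200 * Real.pi ^ 4))) := by
  have hN : (0 : ℝ) < n := by exact_mod_cast hn
  have hpi := Real.pi_pos
  have hpi3 := Real.pi_gt_three
  set b := 160 * Real.pi ^ 2 / n with hb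
  have hb0 : 0 ≤ b := by positivity
  have hnb : n * b = 160 * Real.pi ^ 2 := by rw [hb]; field_simp
  have he : Real.exp 1 ≤ 3 := Real.exp_one_lt_three.le
  have hexp : Real.exp (-(n * t ^ 2 / (3200 * Real.pi ^ 4)) + 1)
      ≤ 3 * Real.exp (-(n * t ^ 2 / (3200 * Real.pi ^ 4))) := by
    rw [Real.exp_add, mul_comm]
    gcongr
  have hpi4 : 9 ≤ Real.pi ^ 2 := by nlinarith
  -- Above the bias bound `b`, McDiarmid applies at level `t - b`. As `n b = 160π²` and `t ≤ 1`,
  -- restoring `t²` in the exponent costs a factor of at most `e ≤ 3`, which turns `2` into `6`.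
  -- Below `b` the exponent is at least `-1` and the claimed bound exceeds one.
  rcases le_or_gt b t with hbt | hbt
  · have hmc := measure_bounded_differences μ (c := 40 * Real.pi ^ 2 / n) (M := 4 * Real.pi ^ 2)
      (by positivity) (measurable_samplePcovSq (n := n) hX hY)
      (fun z => abs_samplePcovSq_le _ _)
      (fun z j s => abs_samplePcovSq_update_sub_le hn X Y z j s) (ε := t - b) (by linarith)
    have hbias := abs_integral_samplePcovSq_sub_le hn μ hX hY
    refine (measureReal_mono ?_).trans (hmc.trans ?_)
    · intro z hz
      have hz' : t ≤ |samplePcovSq (fun j => X (z j)) (fun j => Y (z j))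
        - pcovSqArccos (μ.map fun s => (X s, Y s))| := hz
      change t - b ≤ |_|
      have := abs_sub_le (samplePcovSq (fun j => X (z j)) (fun j => Y (z j)))
        (∫ z, samplePcovSq (fun j => X (z j)) (fun j => Y (z j)) ∂(Measure.pi fun _ : Fin n => μ))
        (pcovSqArccos (μ.map fun s => (X s, Y s)))
      linarith
    · refine le_trans ?_ ((mul_le_mul_of_nonneg_left hexp two_pos.le).trans (by linarith))
      gcongr
      have h1 : -(t - b) ^ 2 / (2 * (n * (40 * Real.pi ^ 2 / n) ^ 2))
          = -(n * (t - b) ^ 2) / (3200 * Real.pi ^ 4) := by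
        field_simp; ring
      rw [h1, div_le_iff₀ (by positivity), add_mul, neg_mul, div_mul_cancel₀ _ (by positivity)]
      have h2 : n * (t - b) ^ 2 = n * t ^ 2 - 2 * t * (n * b) + b * (n * b) := by ring
      rw [h2, hnb]
      nlinarith [mul_nonneg hb0 (by positivity : 0 ≤ 160 * Real.pi ^ 2), sq_nonneg Real.pi,
        mul_le_mul_of_nonneg_right ht1 (by positivity : 0 ≤ Real.pi ^ 2),
        mul_le_mul_of_nonneg_right hpi4 (by positivity : 0 ≤ Real.pi ^ 2)]
  · have h1 : n * t ^ 2 / (3200 * Real.pi ^ 4) ≤ 1 := by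
      rw [div_le_one (by positivity)]
      have : n * t ^ 2 ≤ n * b := by
        have : t ^ 2 ≤ b := by nlinarith
        gcongr
      rw [hnb] at this
      nlinarith [mul_le_mul_of_nonneg_right hpi4 (by positivity : 0 ≤ Real.pi ^ 2)]
    have h2 : 1 ≤ Real.exp (-(n * t ^ 2 / (3200 * Real.pi ^ 4)) + 1) :=
      Real.one_le_exp (by linarith)
    refine measureReal_le_one.trans ?_
    linarith

end Concentration

end

/-! ### Stability of the correlation ratio. -/

section Ratios

lemma abs_ratio_sub_le {m M t a b v A B V : ℝ} (hm : 0 < m) (ha : m ≤ a) (hb : m ≤ b)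
    (haM : a ≤ M) (hv : |v| ≤ M) (hBM : B ≤ M) (ht : t ≤ m / 2) (hA : |A - a| ≤ t)
    (hB : |B - b| ≤ t) (hV : |V - v| ≤ t) :
    |V / (√A * √B) - v / (√a * √b)| ≤ (2 / m + 4 * M ^ 2 / m ^ 3) * t := by
  have ht0 : 0 ≤ t := (abs_nonneg _).trans hA
  have hA' : m / 2 ≤ A := by linarith [(abs_le.1 hA).1]
  have hB' : m / 2 ≤ B := by linarith [(abs_le.1 hB).1]
  have hM : 0 < M := by linarith
  have hA0 : 0 ≤ A := by linarith
  have hB0 : 0 ≤ B := by linarith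
  have ha0 : 0 ≤ a := by linarith
  have hb0 : 0 ≤ b := by linarith
  set p := √A * √B with hp
  set r := √a * √b with hr
  have hp2 : p ^ 2 = A * B := by
    rw [hp, mul_pow, Real.sq_sqrt (by linarith), Real.sq_sqrt (by linarith)]
  have hr2 : r ^ 2 = a * b := by
    rw [hr, mul_pow, Real.sq_sqrt (by linarith), Real.sq_sqrt (by linarith)]
  have hpm : m / 2 ≤ p := by
    refine le_of_sq_le_sq ?_ (by positivity)
    rw [hp2, pow_two]; gcongr
  have hrm : m ≤ r := by
    refine le_of_sq_le_sq ?_ (by positivity)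
    rw [hr2, pow_two]; gcongr
  clear_value p r
  have hp0 : 0 < p := by linarith
  have hr0 : 0 < r := by linarith
  -- Passing to squares avoids perturbing square roots: `r² - p² = ab - AB` is linear in the errors,
  -- and `r + p ≥ m`.
  have hpr : |r - p| ≤ 2 * M * t / m := by
    have h1 : |(r - p) * (r + p)| ≤ 2 * M * t := by
      have h2 : (r - p) * (r + p) = -(a * (B - b)) - (A - a) * B := by
        have : (r - p) * (r + p) = r ^ 2 - p ^ 2 := by ring
        rw [this, hr2, hp2]; ring
      rw [h2]
      refine (abs_sub _ _).trans ?_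
      rw [abs_neg, abs_mul, abs_mul, abs_of_pos (by linarith : 0 < a),
        abs_of_pos (by linarith : 0 < B)]
      have e1 : a * |B - b| ≤ M * t := by gcongr
      have e2 : |A - a| * B ≤ t * M := by gcongr
      linarith
    rw [abs_mul, abs_of_pos (by linarith : 0 < r + p)] at h1
    rw [le_div_iff₀ hm]
    refine le_trans ?_ h1
    gcongr
    linarith
  have hsplit : V / p - v / r = (V - v) / p + v * (r - p) / (p * r) := by
    field_simp; ring
  rw [hsplit]
  refine (abs_add_le _ _).trans ?_
  rw [abs_div, abs_div, abs_mul, abs_of_pos hp0, abs_of_pos (mul_pos hp0 hr0)]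
  have e1 : |V - v| / p ≤ t / (m / 2) := by gcongr
  have e2 : |v| * |r - p| / (p * r) ≤ M * (2 * M * t / m) / (m / 2 * m) := by gcongr
  refine (add_le_add e1 e2).trans (le_of_eq ?_)
  field_simp
  ring

end Ratios

/-! ### From covariances to correlations, for either form. -/

section Population

variable {E F : Type*}
  [NormedAddCommGroup E] [InnerProductSpace ℝ E] [FiniteDimensional ℝ E]
  [MeasurableSpace E] [BorelSpace E]
  [NormedAddCommGroup F] [InnerProductSpace ℝ F] [FiniteDimensional ℝ F]
  [MeasurableSpace F] [BorelSpace F]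
  {S : Type*} [MeasurableSpace S]

lemma pcovSq_eq_pcovSqArccos (form : PcovForm) (μ : Measure S) [IsProbabilityMeasure μ]
    {X : S → E} {Y : S → F} (hX : Measurable X) (hY : Measurable Y)
    (hXa : form = PcovForm.integral → ∀ v, (μ.map X) {v} = 0)
    (hYa : form = PcovForm.integral → ∀ v, (μ.map Y) {v} = 0) :
    pcovSq form (μ.map fun s => (X s, Y s)) = pcovSqArccos (μ.map fun s => (X s, Y s)) := by
  have hXY : Measurable fun s => (X s, Y s) := hX.prodMk hY
  have : IsProbabilityMeasure (μ.map fun s => (X s, Y s)) :=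
    Measure.isProbabilityMeasure_map hXY.aemeasurable
  cases form with
  | arccos => rfl
  | integral =>
    refine pcovSqIntegral_eq_pcovSqArccos _ ?_ ?_
    · rw [Measure.map_map measurable_fst hXY]; exact hXa rfl
    · rw [Measure.map_map measurable_snd hXY]; exact hYa rfl

lemma pvarSq_map_eq (form : PcovForm) (μ : Measure S) {X : S → E} (hX : Measurable X) :
    pvarSq form (μ.map X) = pcovSq form (μ.map fun s => (X s, X s)) := by
  rw [pvarSq, Measure.map_map (by fun_prop) hX]
  rfl

lemma pcSq_map_eq (form : PcovForm) (μ : Measure S) {X : S → E} {Y : S → F} (hX : Measurable X)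
    (hY : Measurable Y) :
    pcSq form (μ.map fun s => (X s, Y s)) = pcovSq form (μ.map fun s => (X s, Y s))
      / (√(pvarSq form (μ.map X)) * √(pvarSq form (μ.map Y))) := by
  rw [pcSq, Measure.map_map measurable_fst (hX.prodMk hY),
    Measure.map_map measurable_snd (hX.prodMk hY)]
  rfl

/-- The constant through which errors in the squared covariances enter the squared correlation. -/
def ratioConst (m : ℝ) : ℝ := 2 / m + 4 * (4 * Real.pi ^ 2) ^ 2 / m ^ 3

lemma abs_samplePcSq_sub_le (form : PcovForm) (μ : Measure S) [IsProbabilityMeasure μ]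
    {X : S → E} {Y : S → F} (hX : Measurable X) (hY : Measurable Y)
    (hXa : form = PcovForm.integral → ∀ v, (μ.map X) {v} = 0)
    (hYa : form = PcovForm.integral → ∀ v, (μ.map Y) {v} = 0) {m t : ℝ} (hm : 0 < m)
    (hXm : m ≤ pvarSq form (μ.map X)) (hYm : m ≤ pvarSq form (μ.map Y)) (ht : t ≤ m / 2)
    {n : ℕ} {z : Fin n → S}
    (hxx : |samplePcovSq (fun i => X (z i)) (fun i => X (z i))
      - pcovSqArccos (μ.map fun s => (X s, X s))| ≤ t)
    (hyy : |samplePcovSq (fun i => Y (z i)) (fun i => Y (z i))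
      - pcovSqArccos (μ.map fun s => (Y s, Y s))| ≤ t)
    (hxy : |samplePcovSq (fun i => X (z i)) (fun i => Y (z i))
      - pcovSqArccos (μ.map fun s => (X s, Y s))| ≤ t) :
    |samplePcSq (fun i => X (z i)) (fun i => Y (z i)) - pcSq form (μ.map fun s => (X s, Y s))|
      ≤ ratioConst m * t := by
  have p1 : IsProbabilityMeasure (μ.map fun s => (X s, Y s)) :=
    Measure.isProbabilityMeasure_map (hX.prodMk hY).aemeasurable
  have p2 : IsProbabilityMeasure (μ.map fun s => (X s, X s)) :=
    Measure.isProbabilityMeasure_map (hX.prodMk hX).aemeasurable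
  rw [pcSq_map_eq form μ hX hY]
  rw [pvarSq_map_eq form μ hX, pcovSq_eq_pcovSqArccos form μ hX hX hXa hXa] at hXm ⊢
  rw [pvarSq_map_eq form μ hY, pcovSq_eq_pcovSqArccos form μ hY hY hYa hYa] at hYm ⊢
  rw [pcovSq_eq_pcovSqArccos form μ hX hY hXa hYa]
  exact abs_ratio_sub_le hm hXm hYm ((le_abs_self _).trans (abs_pcovSqArccos_le _))
    (abs_pcovSqArccos_le _) ((le_abs_self _).trans (abs_samplePcovSq_le _ _)) ht hxx hyy hxy

end Population

/-! ### Concentration of the knockoff statistics. -/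

section Knockoffs

variable {p q n : ℕ} {μ : Measure (Obs p q)} [IsProbabilityMeasure μ]

/-- A lower bound for the projection variance of a nondegenerate response. -/
def responseConst (q : ℕ) (σ₀ : ℝ) : ℝ :=
  Real.pi ^ 2 / (144 * q ^ 6) * (min 1 (4 * σ₀ ^ 2 / Real.pi ^ 2)) ^ 2

lemma responseConst_pos {q : ℕ} (hq : 0 < q) {σ₀ : ℝ} (hσ₀ : 0 < σ₀) : 0 < responseConst q σ₀ := by
  have := Real.pi_pos
  have : (0 : ℝ) < q := by exact_mod_cast hq
  have : 0 < min 1 (4 * σ₀ ^ 2 / Real.pi ^ 2) := lt_min one_pos (by positivity)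
  unfold responseConst
  positivity

/-- Nondegeneracy of one coordinate forces two copies of it, hence of the whole response, to differ
with positive probability, which bounds the vector's projection variance below. In the integral form
that probability is one. -/
lemma responseConst_le_pvarSq (form : PcovForm) (hq : 0 < q) {σ₀ : ℝ}
    (hat : form = PcovForm.integral → ∀ v, responseLaw μ {v} = 0)
    (hnd : Nondegenerate form μ σ₀) : responseConst q σ₀ ≤ pvarSq form (responseLaw μ) := by
  have hy : Measurable fun w : Obs p q => w.2.2 := by fun_prop
  have hprob : IsProbabilityMeasure (responseLaw μ) :=
    Measure.isProbabilityMeasure_map hy.aemeasurable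
  have hnt : Nontrivial (EuclideanSpace ℝ (Fin q)) :=
    Module.nontrivial_of_finrank_pos (R := ℝ) (by rw [finrank_euclideanSpace_fin]; exact hq)
  have hpi := Real.pi_pos
  have hδ : min 1 (4 * σ₀ ^ 2 / Real.pi ^ 2) ≤ distinctProb (responseLaw μ) := by
    cases form with
    | integral =>
      rw [distinctProb_of_atomless _ (hat rfl)]
      exact min_le_left _ _
    | arccos =>
      refine (min_le_right _ _).trans ?_
      have hc : Measurable fun y : EuclideanSpace ℝ (Fin q) => y ⟨0, hq⟩ := by fun_prop
      have hprob' : IsProbabilityMeasure ((responseLaw μ).map fun y => y ⟨0, hq⟩) :=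
        Measure.isProbabilityMeasure_map hc.aemeasurable
      have h1 : σ₀ ^ 2 ≤ pcovSqArccos
          (((responseLaw μ).map fun y => y ⟨0, hq⟩).map fun x => (x, x)) := hnd.2 ⟨0, hq⟩
      have h2 := h1.trans (pcovSqArccos_diag_le _)
      have h3 := distinctProb_map_le (responseLaw μ) hc
      rw [div_le_iff₀ (by positivity)]
      nlinarith [mul_le_mul_of_nonneg_left h3 (by positivity : 0 ≤ Real.pi ^ 2 / 4)]
  have hδ0 : 0 ≤ min 1 (4 * σ₀ ^ 2 / Real.pi ^ 2) := le_min zero_le_one (by positivity)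
  have hfinal := pcovSqArccos_diag_ge (responseLaw μ)
  rw [finrank_euclideanSpace_fin] at hfinal
  have heq : pvarSq form (responseLaw μ) = pcovSqArccos ((responseLaw μ).map fun x => (x, x)) :=
    pcovSq_eq_pcovSqArccos form (responseLaw μ) (X := fun x => x) (Y := fun x => x) measurable_id
      measurable_id (fun h => by simpa using hat h) (fun h => by simpa using hat h)
  rw [heq]
  refine le_trans ?_ hfinal
  unfold responseConst
  gcongr

variable {Ω : Type*} [MeasurableSpace Ω] {P : Measure Ω} [IsProbabilityMeasure P]
  {Z : Fin n → Ω → Obs p q}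

lemma measure_iid_samplePcovSq_sub_ge_le {S E F : Type*} [MeasurableSpace S]
    [NormedAddCommGroup E] [InnerProductSpace ℝ E] [FiniteDimensional ℝ E]
    [MeasurableSpace E] [BorelSpace E]
    [NormedAddCommGroup F] [InnerProductSpace ℝ F] [FiniteDimensional ℝ F]
    [MeasurableSpace F] [BorelSpace F] {μ : Measure S} [IsProbabilityMeasure μ]
    {Z : Fin n → Ω → S} (hn : 0 < n) (hZ : ∀ i, Measurable (Z i)) (hind : iIndepFun Z P)
    (hlaw : ∀ i, P.map (Z i) = μ) {X : S → E} {Y : S → F} (hX : Measurable X) (hY : Measurable Y)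
    {t : ℝ} (ht0 : 0 ≤ t) (ht1 : t ≤ 1) :
    P.real {ω | t ≤ |samplePcovSq (fun j => X (Z j ω)) (fun j => Y (Z j ω))
        - pcovSqArccos (μ.map fun s => (X s, Y s))|}
      ≤ 6 * Real.exp (-(n * t ^ 2 / (3200 * Real.pi ^ 4))) := by
  have hmap : P.map (fun ω i => Z i ω) = Measure.pi fun _ => μ := by
    rw [(iIndepFun_iff_map_fun_eq_pi_map fun i => (hZ i).aemeasurable).1 hind]
    simp only [hlaw]
  have h := measure_samplePcovSq_sub_ge_le hn μ hX hY ht0 ht1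
  rw [← hmap, map_measureReal_apply (measurable_pi_lambda _ hZ)
    (measurableSet_le measurable_const ((measurable_samplePcovSq hX hY).sub_const _).abs)] at h
  exact h

/-- The sample knockoff statistic concentrates around its population version. -/
lemma measure_sampleW_sub_ge_le (form : PcovForm) (hn : 0 < n) (hk : IsExactKnockoff μ)
    (hat : form = PcovForm.integral →
      (∀ k t, featureLaw μ k {t} = 0) ∧ (∀ v, responseLaw μ {v} = 0))
    {m : ℝ} (hm : 0 < m) (hXm : ∀ k, m ≤ pvarSq form (featureLaw μ k))
    (hYm : m ≤ pvarSq form (responseLaw μ))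
    (hZ : ∀ i, Measurable (Z i)) (hind : iIndepFun Z P) (hlaw : ∀ i, P.map (Z i) = μ)
    {t a : ℝ} (ht0 : 0 ≤ t) (ht1 : t ≤ 1) (htm : t ≤ m / 2) (ha : 2 * ratioConst m * t < a)
    (j : Fin p) :
    P.real {ω | a ≤ |sampleW (fun i => Z i ω) j - W form μ j|}
      ≤ 30 * Real.exp (-(n * t ^ 2 / (3200 * Real.pi ^ 4))) := by
  have hX : Measurable fun w : Obs p q => w.1 j := by fun_prop
  have hX' : Measurable fun w : Obs p q => w.2.1 j := by fun_prop
  have hY : Measurable fun w : Obs p q => w.2.2 := by fun_prop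
  have b1 := measure_iid_samplePcovSq_sub_ge_le hn hZ hind hlaw hX hX ht0 ht1
  have b2 := measure_iid_samplePcovSq_sub_ge_le hn hZ hind hlaw hY hY ht0 ht1
  have b3 := measure_iid_samplePcovSq_sub_ge_le hn hZ hind hlaw hX hY ht0 ht1
  have b4 := measure_iid_samplePcovSq_sub_ge_le hn hZ hind hlaw hX' hX' ht0 ht1
  have b5 := measure_iid_samplePcovSq_sub_ge_le hn hZ hind hlaw hX' hY ht0 ht1
  set B1 := {ω | t ≤ |samplePcovSq (fun i => (Z i ω).1 j) (fun i => (Z i ω).1 j)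
    - pcovSqArccos (μ.map fun w => (w.1 j, w.1 j))|}
  set B2 := {ω | t ≤ |samplePcovSq (fun i => (Z i ω).2.2) (fun i => (Z i ω).2.2)
    - pcovSqArccos (μ.map fun w => (w.2.2, w.2.2))|}
  set B3 := {ω | t ≤ |samplePcovSq (fun i => (Z i ω).1 j) (fun i => (Z i ω).2.2)
    - pcovSqArccos (μ.map fun w => (w.1 j, w.2.2))|}
  set B4 := {ω | t ≤ |samplePcovSq (fun i => (Z i ω).2.1 j) (fun i => (Z i ω).2.1 j)
    - pcovSqArccos (μ.map fun w => (w.2.1 j, w.2.1 j))|}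
  set B5 := {ω | t ≤ |samplePcovSq (fun i => (Z i ω).2.1 j) (fun i => (Z i ω).2.2)
    - pcovSqArccos (μ.map fun w => (w.2.1 j, w.2.2))|}
  -- Five covariances enter, the response variance being shared by both correlations; with a tail
  -- factor `6` each this gives `30`. Off their bad events each correlation errs by at most
  -- `ratioConst m * t`.
  have hsub : {ω | a ≤ |sampleW (fun i => Z i ω) j - W form μ j|}
      ⊆ B1 ∪ B2 ∪ B3 ∪ B4 ∪ B5 := by
    intro ω hω
    by_contra hno
    simp only [Set.mem_union, not_or] at hno
    obtain ⟨⟨⟨⟨h1, h2⟩, h3⟩, h4⟩, h5⟩ := hno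
    have h1' := (not_le.1 (show ¬ t ≤ _ from h1)).le
    have h2' := (not_le.1 (show ¬ t ≤ _ from h2)).le
    have h3' := (not_le.1 (show ¬ t ≤ _ from h3)).le
    have h4' := (not_le.1 (show ¬ t ≤ _ from h4)).le
    have h5' := (not_le.1 (show ¬ t ≤ _ from h5)).le
    have hko := map_knockoff_eq_featureLaw hk j
    have c1 := abs_samplePcSq_sub_le form μ hX hY (fun h => (hat h).1 j) (fun h => (hat h).2) hm
      (hXm j) hYm htm h1' h2' h3'
    have c2 := abs_samplePcSq_sub_le form μ hX' hY (fun h => by rw [hko]; exact (hat h).1 j)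
      (fun h => (hat h).2) hm (by rw [hko]; exact hXm j) hYm htm h4' h2' h5'
    have hω' : a ≤ |sampleW (fun i => Z i ω) j - W form μ j| := hω
    unfold sampleW W at hω'
    rw [abs_le] at c1 c2
    have : |(samplePcSq (fun i => (Z i ω).1 j) (fun i => (Z i ω).2.2)
        - samplePcSq (fun i => (Z i ω).2.1 j) (fun i => (Z i ω).2.2))
        - (pcSq form (μ.map fun w => (w.1 j, w.2.2)) - pcSq form (μ.map fun w => (w.2.1 j, w.2.2)))|
        ≤ 2 * ratioConst m * t := by
      rw [abs_le]
      constructor <;> linarith [c1.1, c1.2, c2.1, c2.2]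
    linarith
  refine (measureReal_mono hsub).trans ?_
  have u1 := measureReal_union_le (μ := P) (B1 ∪ B2 ∪ B3 ∪ B4) B5
  have u2 := measureReal_union_le (μ := P) (B1 ∪ B2 ∪ B3) B4
  have u3 := measureReal_union_le (μ := P) (B1 ∪ B2) B3
  have u4 := measureReal_union_le (μ := P) B1 B2
  linarith

/-- A union bound stated through a covering of the whole space, so that measurability of `S` is not
needed. -/
lemma one_sub_le_measureReal_of_forall_notMem {κ : Type*} (T : Finset κ) {bad : κ → Set Ω}
    {S : Set Ω} {e : ℝ} (hS : ∀ ω, (∀ k ∈ T, ω ∉ bad k) → ω ∈ S)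
    (hb : ∀ k ∈ T, P.real (bad k) ≤ e) : 1 - T.card * e ≤ P.real S := by
  have hcov : (Set.univ : Set Ω) ⊆ S ∪ ⋃ k ∈ T, bad k := by
    intro ω _
    by_cases h : ∀ k ∈ T, ω ∉ bad k
    · exact Or.inl (hS ω h)
    · push Not at h
      obtain ⟨k, hk, hω⟩ := h
      exact Or.inr (Set.mem_biUnion hk hω)
  have h1 : 1 ≤ P.real (S ∪ ⋃ k ∈ T, bad k) := by
    rw [← probReal_univ (μ := P)]
    exact measureReal_mono hcov
  have h2 := measureReal_union_le (μ := P) S (⋃ k ∈ T, bad k)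
  have h3 := measureReal_biUnion_finset_le (μ := P) T bad
  have h4 : ∑ k ∈ T, P.real (bad k) ≤ T.card * e := by
    simpa using Finset.sum_le_card_nsmul T _ e hb
  linarith

lemma mul_sq_mul_rpow {n : ℕ} (hn : 0 < n) (ε κ : ℝ) :
    n * (ε * (n : ℝ) ^ (-κ)) ^ 2 = ε ^ 2 * (n : ℝ) ^ (1 - 2 * κ) := by
  have hN : (0 : ℝ) < n := by exact_mod_cast hn
  have h1 : ((n : ℝ) ^ (-κ)) ^ 2 = (n : ℝ) ^ (-(2 * κ)) := by
    rw [← Real.rpow_natCast, ← Real.rpow_mul hN.le]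
    congr 1
    push_cast; ring
  have h2 : (n : ℝ) ^ (1 - 2 * κ) = n * (n : ℝ) ^ (-(2 * κ)) := by
    rw [sub_eq_add_neg, Real.rpow_add hN, Real.rpow_one]
  rw [mul_pow, h1, h2]
  ring

lemma activeSet_eq_empty_of_dim_zero {μ : Measure (Obs p 0)} [IsProbabilityMeasure μ] :
    activeSet μ = ∅ := by
  ext k
  simp [activeSet, isInactive_of_response_dim_zero]

lemma mem_activeSet {ν : Measure (Obs p q)} {k : Fin p} : k ∈ activeSet ν ↔ ¬ IsInactive ν k := by
  simp [activeSet]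

lemma mem_screenedSet {z : Fin n → Obs p q} {δ : ℝ} {j : Fin p} :
    j ∈ screenedSet z δ ↔ δ ≤ sampleW z j := by
  simp [screenedSet]

end Knockoffs

end ProjCorr

end

/-! ### Choice of constants and separation of active from inactive features. -/

open ProjCorr
theorem theorem6 (form : PcovForm) (q : ℕ) (σ₀ c₃ κ : ℝ)
    (hσ₀ : 0 < σ₀) (hc₃ : 0 < c₃) (hκ₀ : 0 < κ) (hκ₁ : κ < 1 / 2) :
    ∃ C c₄ : ℝ, 0 < C ∧ 0 < c₄ ∧
      ∀ (n p : ℕ), 0 < n →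
      ∀ (μ : Measure (Obs p q)) [IsProbabilityMeasure μ],
        -- for the integral form, features and response have no atoms
        (form = PcovForm.integral →
          (∀ k t, featureLaw μ k {t} = 0) ∧ (∀ v, responseLaw μ {v} = 0)) →
        Nondegenerate form μ σ₀ →
        IsExactKnockoff μ →
        (∀ k ∈ activeSet μ, 2 * c₃ * (n : ℝ) ^ (-κ) ≤ W form μ k) →
      ∀ (Ω : Type*) [MeasurableSpace Ω] (P : Measure Ω) [IsProbabilityMeasure P]
        (Z : Fin n → Ω → Obs p q),
        (∀ i, Measurable (Z i)) → iIndepFun Z P → (∀ i, P.map (Z i) = μ) →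
        (∀ δ : ℝ, δ ≤ c₃ * (n : ℝ) ^ (-κ) →
          1 - C * ((activeSet μ).card * Real.exp (-c₄ * (n : ℝ) ^ (1 - 2 * κ)))
            ≤ P.real {ω | activeSet μ ⊆ screenedSet (fun i => Z i ω) δ}) ∧
        1 - C * (p * Real.exp (-c₄ * (n : ℝ) ^ (1 - 2 * κ)))
          ≤ P.real {ω | ∀ k ∈ activeSet μ, ∀ j ∉ activeSet μ,
              sampleW (fun i => Z i ω) j < sampleW (fun i => Z i ω) k} := by
  rcases Nat.eq_zero_or_pos q with rfl | hq
  · refine ⟨1, 1, one_pos, one_pos, ?_⟩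
    intro n p hn μ _ _ _ _ _ Ω _ P _ Z _ _ _
    rw [activeSet_eq_empty_of_dim_zero]
    refine ⟨fun δ _ => ?_, ?_⟩
    · simp
    · simp only [Finset.notMem_empty, false_implies, implies_true, Set.ofPred_true, probReal_univ]
      have : 0 ≤ 1 * (p * Real.exp (-1 * (n : ℝ) ^ (1 - 2 * κ))) := by positivity
      linarith
  have hpi := Real.pi_pos
  -- A common lower bound for the projection variances of the features, the knockoffs and the
  -- response.
  set m := min (σ₀ ^ 2) (responseConst q σ₀) with hm
  have hm0 : 0 < m := lt_min (by positivity) (responseConst_pos hq hσ₀)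
  have hL0 : 0 < ratioConst m := by unfold ratioConst; positivity
  -- Covariances are controlled to within `ε n^(-κ)`. The first two entries meet the ranges required
  -- by concentration and by the ratio bound; the third makes the error of `Ŵ` at most `c₃ n^(-κ) /
  -- 2`, strictly below the threshold.
  set ε := min (min 1 (m / 2)) (c₃ / (4 * ratioConst m)) with hε
  have hε0 : 0 < ε := lt_min (lt_min one_pos (by positivity)) (by positivity)
  have hε1 : ε ≤ 1 := (min_le_left _ _).trans (min_le_left _ _)
  have hεm : ε ≤ m / 2 := (min_le_left _ _).trans (min_le_right _ _)
  have hεc : 2 * ratioConst m * ε < c₃ := by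
    have h1 : ε ≤ c₃ / (4 * ratioConst m) := min_le_right _ _
    rw [le_div_iff₀ (by positivity)] at h1
    linarith
  refine ⟨30, ε ^ 2 / (3200 * Real.pi ^ 4), by norm_num, by positivity, ?_⟩
  intro n p hn μ _ hat hnd hk hW Ω _ P _ Z hZ hind hlaw
  have hN : (1 : ℝ) ≤ n := by exact_mod_cast hn
  set a := (n : ℝ) ^ (-κ) with ha
  have ha0 : 0 < a := Real.rpow_pos_of_pos (by linarith) _
  have ha1 : a ≤ 1 := Real.rpow_le_one_of_one_le_of_nonpos hN (by linarith)
  set x := Real.exp (-(ε ^ 2 / (3200 * Real.pi ^ 4)) * (n : ℝ) ^ (1 - 2 * κ)) with hx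
  have hbad : ∀ j, P.real {ω | c₃ * a ≤ |sampleW (fun i => Z i ω) j - W form μ j|} ≤ 30 * x := by
    intro j
    have h := measure_sampleW_sub_ge_le (a := c₃ * a) (t := ε * a) form hn hk hat hm0
      (fun k => (min_le_left _ _).trans (hnd.1 k))
      ((min_le_right _ _).trans (responseConst_le_pvarSq form hq (fun h => (hat h).2) hnd))
      hZ hind hlaw (by positivity) (mul_le_one₀ hε1 ha0.le ha1)
      ((mul_le_of_le_one_right hε0.le ha1).trans hεm) (by nlinarith) j
    rw [mul_sq_mul_rpow hn] at h
    refine h.trans (le_of_eq ?_)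
    rw [hx]
    congr 2
    ring
  refine ⟨fun δ hδ => ?_, ?_⟩
  -- Only the active statistics need to be accurate here, hence the factor `s` in place of `p`.
  · have h := one_sub_le_measureReal_of_forall_notMem (P := P)
      (S := {ω | activeSet μ ⊆ screenedSet (fun i => Z i ω) δ}) (activeSet μ) ?_
      fun k _ => hbad k
    · refine le_trans (le_of_eq ?_) h
      ring
    · intro ω hω k hkA
      have h1 : |sampleW (fun i => Z i ω) k - W form μ k| < c₃ * a :=
        not_le.1 (show ¬ c₃ * a ≤ _ from hω k hkA)
      rw [mem_screenedSet]
      have h2 := hW k hkA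
      linarith [(abs_lt.1 h1).1]
  · have h := one_sub_le_measureReal_of_forall_notMem (P := P)
      (S := {ω | ∀ k ∈ activeSet μ, ∀ j ∉ activeSet μ,
        sampleW (fun i => Z i ω) j < sampleW (fun i => Z i ω) k}) Finset.univ ?_
      fun k _ => hbad k
    · refine le_trans (le_of_eq ?_) h
      simp only [Finset.card_univ, Fintype.card_fin]
      ring
    · intro ω hω k hkA j hj
      have h1 : |sampleW (fun i => Z i ω) k - W form μ k| < c₃ * a :=
        not_le.1 (show ¬ c₃ * a ≤ _ from hω k (Finset.mem_univ _))
      have h2 : |sampleW (fun i => Z i ω) j - W form μ j| < c₃ * a :=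
        not_le.1 (show ¬ c₃ * a ≤ _ from hω j (Finset.mem_univ _))
      -- An inactive statistic lies below `c₃ n^(-κ)` because its target is zero, while an active
      -- one lies above it.
      rw [W_eq_zero_of_isInactive form hk (not_not.1 fun h => hj (mem_activeSet.2 h))] at h2
      have h3 := hW k hkA
      linarith [(abs_lt.1 h1).1, (abs_lt.1 h2).2]
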